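/- Let a bigerm be a pair $\phi=[\phi_1,\phi_2]$ of analytic germs $\phi_i:(\mathbb C,0)\to(\mathbb C^2,0)$ (parameter $t_i$, coordinates $x,y$ on $\mathbb C^2$) which are primitive (injective near $0$) parametrizations of two distinct branches of plane curve, and let $m_i\ge 1$ be the multiplicity of the $i$-th branch, $m=(m_1,m_2)$. Let $\delta\in\{1,2\}$. We say that $\phi$ is in Puiseux form (in case $\delta$) if $\phi_1=(t_1^{m_1},\sum_{i>m_1}a_{1i}t_1^i)$ and $\phi_2=(\sum_{i>m_2}a_{2i}t_2^i,\,t_2^{m_2})$ when $\delta=1$ (distinct tangents), respectively $\phi_2=(t_2^{m_2},\sum_{i>m_2}a_{2i}t_2^i)$ when $\delta=2$ (same tangent). Triples $(\rho_1,\rho_2,\sigma)$ of germs of analytic automorphisms of $(\mathbb C,0)$, $(\mathbb C,0)$, $(\mathbb C^2,0)$ act by $(\rho_1,\rho_2,\sigma)\cdot\phi=[\sigma\circ\phi_1\circ\rho_1^{-1},\ \sigma\circ\phi_2\circ\rho_2^{-1}]$. Let $\mathcal A[\delta]$ be the group of those with $j^1\rho_i=t_i$ and with $j^1\sigma=(x,y)$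 if $\delta=1$, respectively $j^1\sigma=(x+by,y)$ for some $b\in\mathbb C$ if $\delta=2$. Let $j^k$ denote the $k$-jet at the origin, and let $\mathcal A^k[\delta]$ be the group of $k$-jets of elements of $\mathcal A[\delta]$, acting on $k$-jets of pairs of map germs. Let $\Gamma_\phi=\{(\mathrm{ord}_{t_1}\eta(\phi_1),\mathrm{ord}_{t_2}\eta(\phi_2)):\eta\in\mathbb C\{x,y\}\}\subset(\mathbb N\cup\{\infty\})^2$ be the semigroup of values. For $\omega=\eta_1dx+\eta_2dy$ put $\nu_i(\omega)=\mathrm{ord}_{t_i}\big(\eta_1(\phi_i)\phi_{i1}'+\eta_2(\phi_i)\phi_{i2}'\big)+1$ and $\nu=(\nu_1,\nu_2)$, and let $\Lambda_\phi[\delta]=\{\nu(\omega)-m\}$, where $\omega$ runs over the forms $\eta_1dx+(\beta(\delta-1)y+\eta_2)dy$ with $\eta_1,\eta_2\in(x,y)^2\mathbb C\{x,y\}$ and $\beta\in\mathbb C$. Fix $\Gamma$ and $\Lambda[\delta]$, and let $\Sigma_{\Gamma,\Lambda[\delta]}$ be the set of bigerms $\phi$ in Puiseux form in case $\delta$ with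 $\Gamma_\phi=\Gamma$ and $\Lambda_\phi[\delta]=\Lambda[\delta]$. For $j\in\mathbb N$ write $\underline j=(j,j)$, and let $F_1(\underline j)=\{(b_1,b_2)\in\Lambda[\delta]: b_1=j,\ b_2>j\}$, $F_2(\underline j)=\{(b_1,b_2)\in\Lambda[\delta]: b_2=j,\ b_1>j\}$; let $\underline j\in M$ mean that $\underline j\in\Lambda[\delta]$ and $F_1(\underline j)=F_2(\underline j)=\emptyset$. Let $N$ be the set of $\varphi\in\Sigma_{\Gamma,\Lambda[\delta]}$ in normal form, that is, with $$\varphi_1=\Big(t_1^{m_1},\sum_{j>m_1,\ \underline j\notin M,\ F_1(\underline j)=\emptyset}a_{1j}t_1^j\Big),\qquad \varphi_2=\Big(\sum_{j>m_2,\ F_2(\underline j)=\emptyset}a_{2j}t_2^j,\ t_2^{m_2}\Big)\ (\delta=1),\qquad \varphi_2=\Big(t_2^{m_2},\sum_{j>m_2,\ F_2(\underline j)=\emptyset}a_{2j}t_2^j\Big)\ (\delta=2).$$ Then: (1) Every $\phi\in\Sigma_{\Gamma,\Lambda[\delta]}$ is $\mathcal A[\delta]$-equivalent to an element of $N$, and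 this element is unique. (2) Let $\phi\in N$. Then $\Gamma$ has a conductor $(c_1,c_2)$ (the least element of $\mathbb N^2$ with $(c_1,c_2)+\mathbb N^2\subset\Gamma$), and with $c=\max\{c_1,c_2\}$ one has $\phi=j^c\phi$ and $$j^c(N)\cap\mathcal A^c[\delta](j^c\phi)=\{j^c\phi\}.$$ -/

import Mathlib

open Filter Topology

namespace TwoBranches

noncomputable section

/-- The two cases for the tangents of the branches: `distinct` is `δ = 1`, `same` is `δ = 2`. -/
inductive TangentCase
  | distinct
  | same

/-- A pair of (representatives of) map germs `(ℂ, 0) → ℂ²`.  Germs are compared with `GermEq`. -/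
structure MapPair where
  fst : ℂ → ℂ × ℂ
  snd : ℂ → ℂ × ℂ

/-- Equality of the germs at `0` of both components. -/
def GermEq (φ ψ : MapPair) : Prop :=
  φ.fst =ᶠ[𝓝 0] ψ.fst ∧ φ.snd =ᶠ[𝓝 0] ψ.snd

/-- A bigerm of a reduced plane curve with two branches: both components are analytic map germs
`(ℂ, 0) → (ℂ², 0)` that parametrize their images one-to-one (each is a primitive
parametrization of a branch), and the two branches are different (they meet only at the origin). -/
structure IsBigerm (φ : MapPair) : Prop where
  analytic_fst : AnalyticAt ℂ φ.fst 0
  analytic_snd : AnalyticAt ℂ φ.snd 0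
  fst_zero : φ.fst 0 = 0
  snd_zero : φ.snd 0 = 0
  reduced : ∃ U ∈ 𝓝 (0 : ℂ), Set.InjOn φ.fst U ∧ Set.InjOn φ.snd U ∧
    ∀ s ∈ U, ∀ t ∈ U, φ.fst s = φ.snd t → s = 0 ∧ t = 0

/-! ### The groups `𝒜` and `𝒜[δ]` and their actions -/

/-- A germ at the origin of an analytic automorphism of `E`, with its inverse germ. -/
structure GermAut (E : Type) [NormedAddCommGroup E] [NormedSpace ℂ E] where
  toFun : E → E
  invFun : E → E
  analytic_toFun : AnalyticAt ℂ toFun 0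
  analytic_invFun : AnalyticAt ℂ invFun 0
  toFun_zero : toFun 0 = 0
  invFun_zero : invFun 0 = 0
  left_inv : ∀ᶠ z in 𝓝 (0 : E), invFun (toFun z) = z
  right_inv : ∀ᶠ z in 𝓝 (0 : E), toFun (invFun z) = z

/-- Elements `(ρ₁, ρ₂, σ)` of the group `𝒜`: coordinate changes in the two sources and in the
common target. -/
structure AGroup where
  ρ₁ : GermAut ℂ
  ρ₂ : GermAut ℂ
  σ : GermAut (ℂ × ℂ)

/-- `(ρ₁, ρ₂, σ) · φ = [σ ∘ φ₁ ∘ ρ₁⁻¹, σ ∘ φ₂ ∘ ρ₂⁻¹]`. -/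
def AGroup.act (g : AGroup) (φ : MapPair) : MapPair where
  fst := g.σ.toFun ∘ φ.fst ∘ g.ρ₁.invFun
  snd := g.σ.toFun ∘ φ.snd ∘ g.ρ₂.invFun

/-- The subgroup `𝒜[δ]`: the source changes are tangent to the identity, and the linear part of
`σ` is `(x, y)` if the tangents are distinct, and `(x + b y, y)` for some `b` if they coincide. -/
def ASub (δ : TangentCase) : Set AGroup :=
  {g | deriv g.ρ₁.toFun 0 = 1 ∧ deriv g.ρ₂.toFun 0 = 1 ∧
    ∃ b : ℂ, (δ = TangentCase.distinct → b = 0) ∧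
      ∀ v : ℂ × ℂ, fderiv ℂ g.σ.toFun 0 v = (v.1 + b * v.2, v.2)}

/-- `ψ` is `𝒜[δ]`-equivalent to `φ`. -/
def AEquiv (δ : TangentCase) (φ ψ : MapPair) : Prop :=
  ∃ g ∈ ASub δ, GermEq ψ (g.act φ)

/-! ### Jets -/

/-- The coefficient of `t ^ j` in the Taylor series of `f` at `0`. -/
def tcoeff (f : ℂ → ℂ) (j : ℕ) : ℂ :=
  iteratedDeriv j f 0 / (j.factorial : ℂ)

/-- The Taylor polynomial of degree at most `k` at `0`. -/
def taylorPoly (k : ℕ) (f : ℂ → ℂ) (t : ℂ) : ℂ :=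
  ∑ j ∈ Finset.range (k + 1), tcoeff f j * t ^ j

/-- The `k`-jet of a pair of map germs, as a pair of polynomial maps. -/
def jet (k : ℕ) (φ : MapPair) : MapPair where
  fst t := (taylorPoly k (fun s => (φ.fst s).1) t, taylorPoly k (fun s => (φ.fst s).2) t)
  snd t := (taylorPoly k (fun s => (φ.snd s).1) t, taylorPoly k (fun s => (φ.snd s).2) t)

/-- The orbit of a `k`-jet `z` under the group `𝒜ᵏ[δ]` of `k`-jets of elements of `𝒜[δ]`. -/
def jetOrbit (δ : TangentCase) (k : ℕ) (z : MapPair) : Set MapPair :=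
  {w | ∃ g ∈ ASub δ, w = jet k (g.act z)}

/-! ### Values -/

/-- The order in `t` of a one-variable analytic germ at `0`. -/
def ord (f : ℂ → ℂ) : ℕ∞ := analyticOrderAt f 0

/-- The multiplicity of a branch given by a parametrization. -/
def mult (γ : ℂ → ℂ × ℂ) : ℕ :=
  (min (ord fun t => (γ t).1) (ord fun t => (γ t).2)).toNat

/-- The order of a function along a branch. -/
def valFun (γ : ℂ → ℂ × ℂ) (η : ℂ × ℂ → ℂ) : ℕ∞ := ord fun t => η (γ t)

/-- The value along a branch of the differential form `η₁ dx + η₂ dy`. -/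
def valForm (γ : ℂ → ℂ × ℂ) (η₁ η₂ : ℂ × ℂ → ℂ) : ℕ∞ :=
  ord (fun t => η₁ (γ t) * deriv (fun s => (γ s).1) t + η₂ (γ t) * deriv (fun s => (γ s).2) t) + 1

/-- The semigroup of values `Γ` of a bigerm (values of zero divisors are `∞`). -/
def semigroup (φ : MapPair) : Set (ℕ∞ × ℕ∞) :=
  {v | ∃ η : ℂ × ℂ → ℂ, AnalyticAt ℂ η 0 ∧ v = (valFun φ.fst η, valFun φ.snd η)}

/-- `c` is the conductor of `Γ`: the least `c ∈ ℕ²` with `c + ℕ² ⊆ Γ`. -/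
def IsConductor (Γ : Set (ℕ∞ × ℕ∞)) (c : ℕ × ℕ) : Prop :=
  IsLeast {d : ℕ × ℕ | ∀ a b : ℕ, d.1 ≤ a → d.2 ≤ b → ((a : ℕ∞), (b : ℕ∞)) ∈ Γ} c

/-- `η` belongs to the square of the maximal ideal of `ℂ{x, y}`. -/
def InMaxSq (η : ℂ × ℂ → ℂ) : Prop :=
  AnalyticAt ℂ η 0 ∧ η 0 = 0 ∧ fderiv ℂ η 0 = 0

/-- The pairs of coefficients of the differentials in `Ω[δ]`: `η₁ dx + (β (δ - 1) y + η₂) dy` with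
`η₁, η₂` in the square of the maximal ideal and `β ∈ ℂ`. -/
def Omega (δ : TangentCase) : Set ((ℂ × ℂ → ℂ) × (ℂ × ℂ → ℂ)) :=
  {ω | ∃ (η₁ η₂ : ℂ × ℂ → ℂ) (β : ℂ), InMaxSq η₁ ∧ InMaxSq η₂ ∧
    (δ = TangentCase.distinct → β = 0) ∧ ω = (η₁, fun p => β * p.2 + η₂ p)}

/-- `Λ[δ] = {ν(ω) - m : ω ∈ Ω[δ]}`, where `m` is the pair of multiplicities. -/
def LambdaSet (δ : TangentCase) (φ : MapPair) : Set (ℕ∞ × ℕ∞) :=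
  {v | ∃ ω ∈ Omega δ, v = (valForm φ.fst ω.1 ω.2 - (mult φ.fst : ℕ∞),
    valForm φ.snd ω.1 ω.2 - (mult φ.snd : ℕ∞))}

/-- The vertical fiber of `a`. -/
def fiber₁ (L : Set (ℕ∞ × ℕ∞)) (a : ℕ × ℕ) : Set (ℕ∞ × ℕ∞) :=
  {b ∈ L | b.1 = (a.1 : ℕ∞) ∧ (a.2 : ℕ∞) < b.2}

/-- The horizontal fiber of `a`. -/
def fiber₂ (L : Set (ℕ∞ × ℕ∞)) (a : ℕ × ℕ) : Set (ℕ∞ × ℕ∞) :=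
  {b ∈ L | b.2 = (a.2 : ℕ∞) ∧ (a.1 : ℕ∞) < b.1}

/-- The set `M` of maximal points of `L`. -/
def maximalPoints (L : Set (ℕ∞ × ℕ∞)) : Set (ℕ × ℕ) :=
  {a | ((a.1 : ℕ∞), (a.2 : ℕ∞)) ∈ L ∧ fiber₁ L a = ∅ ∧ fiber₂ L a = ∅}

/-! ### Puiseux forms and normal forms -/

/-- The coordinate of `φ₂` that is a pure power of `t` in Puiseux form: `y` if the tangents are
distinct, `x` if they coincide. -/
def base₂ (δ : TangentCase) (φ : MapPair) (t : ℂ) : ℂ :=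
  match δ with
  | .distinct => (φ.snd t).2
  | .same => (φ.snd t).1

/-- The other coordinate of `φ₂`. -/
def graph₂ (δ : TangentCase) (φ : MapPair) (t : ℂ) : ℂ :=
  match δ with
  | .distinct => (φ.snd t).1
  | .same => (φ.snd t).2

/-- The second coordinate of `φ₁`. -/
def graph₁ (φ : MapPair) (t : ℂ) : ℂ := (φ.fst t).2

/-- Bigerms in Puiseux form: `φ₁ = (t ^ m₁, ∑_{i > m₁} a₁ᵢ t ^ i)`, and
`φ₂ = (∑_{i > m₂} a₂ᵢ t ^ i, t ^ m₂)` or `φ₂ = (t ^ m₂, ∑_{i > m₂} a₂ᵢ t ^ i)`. -/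
structure IsPuiseux (δ : TangentCase) (φ : MapPair) : Prop where
  isBigerm : IsBigerm φ
  base₁_eq : (fun t => (φ.fst t).1) =ᶠ[𝓝 0] fun t => t ^ mult φ.fst
  lt_graph₁ : (mult φ.fst : ℕ∞) < ord (graph₁ φ)
  base₂_eq : base₂ δ φ =ᶠ[𝓝 0] fun t => t ^ mult φ.snd
  lt_graph₂ : (mult φ.snd : ℕ∞) < ord (graph₂ δ φ)

/-- The bigerms in Puiseux form with semigroup of values `Γ` and with `Λ[δ] = L`. -/
def SigmaSet (δ : TangentCase) (Γ L : Set (ℕ∞ × ℕ∞)) : Set MapPair :=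
  {φ | IsPuiseux δ φ ∧ semigroup φ = Γ ∧ LambdaSet δ φ = L}

/-- The set `N` of bigerms in normal form: `t ^ j` may occur in the series of `φ₁` only if
`(j, j) ∉ M` and the vertical fiber of `(j, j)` is empty, and in the series of `φ₂` only if the
horizontal fiber of `(j, j)` is empty. -/
def NormalForms (δ : TangentCase) (Γ L : Set (ℕ∞ × ℕ∞)) : Set MapPair :=
  {φ | φ ∈ SigmaSet δ Γ L ∧
    (∀ j : ℕ, tcoeff (graph₁ φ) j ≠ 0 → (j, j) ∉ maximalPoints L ∧ fiber₁ L (j, j) = ∅) ∧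
    (∀ j : ℕ, tcoeff (graph₂ δ φ) j ≠ 0 → fiber₂ L (j, j) = ∅)}

end

end TwoBranches

open TwoBranches

namespace TwoBranches

/-! On jets of a fixed order the group `ASub δ` acts unipotently, so its orbits are governed by its
Lie algebra, the vector fields η satisfying `VField δ`. Take a branch in Puiseux form with
coordinates X = t^m and Y and slope q = dY/dX. The part of η tangent to the branch is absorbed by a
reparametrization, and the first-order displacement among Puiseux forms is the change Y(η) − q X(η)
of the graph, `normalPart`. The form η₂ dx − η₁ dy pulls back to ± X′ times this function, so Λ[δ]
is exactly the set of pairs of orders of normal parts of tangent fields (`lambdaSet_eq_normalPart`).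
A point of Λ[δ] with least entry k thus says in which way the coefficients of degree k on the two
branches can be moved: a point of the vertical fiber of (k, k) moves the first alone, one of the
horizontal fiber the second alone, and a maximal point couples the two.

The passage between group and vector fields uses truncated series only. If a group element carries a
Puiseux form to one that agrees with it below degree k, the difference in degree k is the normal
part of the logarithm of σ (`log_step`); conversely the exponential of a field realizes its normal
part in degree k (`exp_step`).

Uniqueness, also for jets, is `NormalForms.vvan_sub`: the first degree in which two equivalent
normal forms differ would give a point of Λ[δ] that the normal form conditions forbid. For
existence, `exists_moves` eliminates the forbidden monomials one degree at a time. Finitely many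
steps suffice: by interpolation over conjugate points, every pair of functions of high order on the
branches is induced by a function on the plane (`IsPuiseux.exists_lifts`), so all higher terms can
be removed by a single change of coordinates (`exists_truncation`).

Finally, functions whose values on both branches exceed c = max(c₁, c₂) lie in the square of the
maximal ideal (`inMaxSq_of_van`). Multiplying them by constant fields shows that both fibers of (j,
j) are nonempty for j > c (`fiber_nonempty`), so a normal form has no terms beyond degree c. -/

/-! ### Order of vanishing of analytic functions of one variable -/

/-- `f` is analytic at `0` and vanishes there to order at least `n`. -/
def Van (n : ℕ) (f : ℂ → ℂ) : Prop := AnalyticAt ℂ f 0 ∧ (n : ℕ∞) ≤ ord f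

theorem van_zero_iff {f : ℂ → ℂ} : Van 0 f ↔ AnalyticAt ℂ f 0 := by simp [Van]

theorem Van.mono {n m : ℕ} {f : ℂ → ℂ} (h : Van n f) (hm : m ≤ n) : Van m f :=
  ⟨h.1, le_trans (by exact_mod_cast hm) h.2⟩

theorem ord_congr {f g : ℂ → ℂ} (h : f =ᶠ[𝓝 0] g) : ord f = ord g := analyticOrderAt_congr h

theorem Van.congr {n : ℕ} {f g : ℂ → ℂ} (h : Van n f) (e : f =ᶠ[𝓝 0] g) : Van n g :=
  ⟨h.1.congr e, by rw [← ord_congr e]; exact h.2⟩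

theorem Van.exists_eq {n : ℕ} {f : ℂ → ℂ} (h : Van n f) :
    ∃ g, AnalyticAt ℂ g 0 ∧ f =ᶠ[𝓝 0] fun t => t ^ n * g t := by
  obtain ⟨g, hg, e⟩ := (natCast_le_analyticOrderAt h.1).1 h.2
  exact ⟨g, hg, by filter_upwards [e] with t ht; simpa using ht⟩

theorem van_of_eq {n : ℕ} {f g : ℂ → ℂ} (hg : AnalyticAt ℂ g 0)
    (e : f =ᶠ[𝓝 0] fun t => t ^ n * g t) : Van n f := by
  have hf : AnalyticAt ℂ f 0 := AnalyticAt.congr (by fun_prop) e.symm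
  exact ⟨hf, (natCast_le_analyticOrderAt hf).2 ⟨g, hg, by filter_upwards [e] with t ht; simpa using ht⟩⟩

theorem van_pow (n : ℕ) : Van n (fun t => t ^ n) :=
  van_of_eq (g := fun _ => 1) (by fun_prop) (by simp)

theorem van_id : Van 1 (fun t => t) := by simpa using van_pow 1

theorem Van.add {n : ℕ} {f g : ℂ → ℂ} (hf : Van n f) (hg : Van n g) : Van n (fun t => f t + g t) :=
  ⟨hf.1.add hg.1, le_trans (le_min hf.2 hg.2) le_analyticOrderAt_add⟩

theorem Van.neg {n : ℕ} {f : ℂ → ℂ} (hf : Van n f) : Van n (fun t => -f t) :=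
  ⟨hf.1.neg, le_trans hf.2 (analyticOrderAt_neg (f := f)).ge⟩

theorem Van.sub {n : ℕ} {f g : ℂ → ℂ} (hf : Van n f) (hg : Van n g) :
    Van n (fun t => f t - g t) := by
  simpa [sub_eq_add_neg] using hf.add hg.neg

theorem Van.mul {n m : ℕ} {f g : ℂ → ℂ} (hf : Van n f) (hg : Van m g) :
    Van (n + m) (fun t => f t * g t) := by
  refine ⟨hf.1.mul hg.1, ?_⟩
  have := analyticOrderAt_mul hf.1 hg.1
  change _ ≤ analyticOrderAt (f * g) 0
  rw [this]; push_cast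
  exact add_le_add hf.2 hg.2

theorem Van.mul_left {n : ℕ} {f g : ℂ → ℂ} (hg : AnalyticAt ℂ g 0) (hf : Van n f) :
    Van n (fun t => g t * f t) := by
  simpa using (van_zero_iff.2 hg).mul hf

theorem Van.mul_right {n : ℕ} {f g : ℂ → ℂ} (hf : Van n f) (hg : AnalyticAt ℂ g 0) :
    Van n (fun t => f t * g t) := by
  simpa using hf.mul (van_zero_iff.2 hg)

theorem Van.const_mul {n : ℕ} {f : ℂ → ℂ} (c : ℂ) (hf : Van n f) : Van n (fun t => c * f t) :=
  Van.mul_left (g := fun _ => c) analyticAt_const hf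

theorem Van.pow {n : ℕ} {f : ℂ → ℂ} (hf : Van n f) (l : ℕ) : Van (l * n) (fun t => f t ^ l) := by
  induction l with
  | zero => simpa [van_zero_iff] using analyticAt_const
  | succ l ih => simpa [pow_succ, add_mul] using ih.mul hf

theorem van_const_zero (n : ℕ) : Van n (fun _ => 0) :=
  van_of_eq (g := fun _ => 0) analyticAt_const (by simp)

theorem van_sum {ι : Type*} {n : ℕ} (s : Finset ι) {f : ι → ℂ → ℂ} (h : ∀ i ∈ s, Van n (f i)) :
    Van n (fun t => ∑ i ∈ s, f i t) := by
  classical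
  induction s using Finset.induction_on with
  | empty => simpa using van_const_zero n
  | insert a s ha ih =>
    simp only [Finset.sum_insert ha]
    exact (h a (by simp)).add (ih fun i hi => h i (by simp [hi]))

theorem van_one_iff {f : ℂ → ℂ} (hf : AnalyticAt ℂ f 0) : Van 1 f ↔ f 0 = 0 := by
  constructor
  · intro h
    obtain ⟨g, -, e⟩ := h.exists_eq
    simpa using e.self_of_nhds
  · intro h
    refine ⟨hf, ?_⟩
    have := (hf.analyticOrderAt_ne_zero).2 h
    simpa [Order.one_le_iff_ne_zero, ord] using this

theorem Van.apply_zero {n : ℕ} {f : ℂ → ℂ} (h : Van n f) (hn : 0 < n) : f 0 = 0 :=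
  (van_one_iff h.1).1 (h.mono hn)

theorem Van.comp {n : ℕ} {f ρ : ℂ → ℂ} (hf : Van n f) (hρ : Van 1 ρ) :
    Van n (fun t => f (ρ t)) := by
  obtain ⟨g, hg, e⟩ := hf.exists_eq
  have h0 := hρ.apply_zero one_pos
  have hc : Tendsto ρ (𝓝 0) (𝓝 0) := by simpa [h0] using hρ.1.continuousAt.tendsto
  have hg' : AnalyticAt ℂ (fun t => g (ρ t)) 0 :=
    AnalyticAt.fun_comp (g := g) (f := ρ) (by rwa [h0]) hρ.1
  have := (hρ.pow n).mul_right hg'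
  rw [mul_one] at this
  exact this.congr (EventuallyEq.symm (e.comp_tendsto hc))

theorem AnalyticAt.comp_zero {E F G : Type*} [NormedAddCommGroup E] [NormedSpace ℂ E]
    [NormedAddCommGroup F] [NormedSpace ℂ F] [NormedAddCommGroup G] [NormedSpace ℂ G]
    {g : F → G} {f : E → F} (hg : AnalyticAt ℂ g 0) (hf : AnalyticAt ℂ f 0) (h0 : f 0 = 0) :
    AnalyticAt ℂ (fun x => g (f x)) 0 :=
  AnalyticAt.fun_comp (by rwa [h0]) hf

theorem tendsto_zero_of_analytic {E F : Type*} [NormedAddCommGroup E] [NormedSpace ℂ E]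
    [NormedAddCommGroup F] [NormedSpace ℂ F] {f : E → F} (hf : AnalyticAt ℂ f 0)
    (h0 : f 0 = 0) : Tendsto f (𝓝 0) (𝓝 0) := by
  simpa [h0] using hf.continuousAt.tendsto

/-! ### Taylor coefficients at the origin -/

theorem van_iff_tcoeff {n : ℕ} {f : ℂ → ℂ} (hf : AnalyticAt ℂ f 0) :
    Van n f ↔ ∀ i < n, tcoeff f i = 0 := by
  have := natCast_le_analyticOrderAt_iff_iteratedDeriv_eq_zero (n := n) hf
  simp only [Van, hf, true_and, ord, this, tcoeff, div_eq_zero_iff, Nat.cast_eq_zero,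
    Nat.factorial_ne_zero, or_false]

theorem Van.tcoeff_eq {n i : ℕ} {f : ℂ → ℂ} (h : Van n f) (hi : i < n) : tcoeff f i = 0 :=
  (van_iff_tcoeff h.1).1 h i hi

theorem tcoeff_congr {f g : ℂ → ℂ} (h : f =ᶠ[𝓝 0] g) (j : ℕ) : tcoeff f j = tcoeff g j := by
  simp [tcoeff, h.iteratedDeriv_eq]

theorem Van.deriv {n : ℕ} {f : ℂ → ℂ} (h : Van (n + 1) f) : Van n (deriv f) := by
  refine ⟨h.1.deriv, ?_⟩
  have h0 := h.apply_zero (Nat.succ_pos n)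
  have := (analyticOrderAt_deriv_ge_iff (n := n) h.1 h0).2
  exact this (by exact_mod_cast h.2)

theorem tcoeff_add {f g : ℂ → ℂ} (hf : AnalyticAt ℂ f 0) (hg : AnalyticAt ℂ g 0) (j : ℕ) :
    tcoeff (fun t => f t + g t) j = tcoeff f j + tcoeff g j := by
  simp only [tcoeff]
  rw [iteratedDeriv_fun_add hf.contDiffAt hg.contDiffAt, add_div]

theorem tcoeff_const_mul (f : ℂ → ℂ) (c : ℂ) (j : ℕ) :
    tcoeff (fun t => c * f t) j = c * tcoeff f j := by
  simp only [tcoeff]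
  rw [iteratedDeriv_const_mul_field, mul_div_assoc]

theorem tcoeff_sub {f g : ℂ → ℂ} (hf : AnalyticAt ℂ f 0) (hg : AnalyticAt ℂ g 0) (j : ℕ) :
    tcoeff (fun t => f t - g t) j = tcoeff f j - tcoeff g j := by
  simp only [tcoeff]
  rw [iteratedDeriv_fun_sub hf.contDiffAt hg.contDiffAt, sub_div]

theorem tcoeff_mul {f g : ℂ → ℂ} (hf : AnalyticAt ℂ f 0) (hg : AnalyticAt ℂ g 0) (j : ℕ) :
    tcoeff (fun t => f t * g t) j =
      ∑ p ∈ Finset.HasAntidiagonal.antidiagonal j, tcoeff f p.1 * tcoeff g p.2 := by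
  simp only [tcoeff]
  rw [iteratedDeriv_fun_mul hf.contDiffAt hg.contDiffAt,
    Finset.Nat.sum_antidiagonal_eq_sum_range_succ_mk, Finset.sum_div]
  refine Finset.sum_congr rfl fun i hi => ?_
  have hi' : i ≤ j := Nat.lt_succ_iff.1 (Finset.mem_range.1 hi)
  have h1 : (j.choose i : ℂ) * i.factorial * (j - i).factorial = j.factorial := by
    exact_mod_cast Nat.choose_mul_factorial_mul_factorial hi'
  have h2 := Nat.factorial_ne_zero i
  have h3 := Nat.factorial_ne_zero (j - i)
  have h4 := Nat.factorial_ne_zero j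
  rw [← h1]
  have h5 : (j.choose i : ℂ) ≠ 0 := by exact_mod_cast (Nat.choose_pos hi').ne'
  field_simp

theorem tcoeff_pow (n j : ℕ) : tcoeff (fun t => t ^ n) j = if j = n then 1 else 0 := by
  simp only [tcoeff]
  rw [iteratedDeriv_fun_pow_zero]
  split_ifs with h
  · subst h; exact div_self (by exact_mod_cast Nat.factorial_ne_zero j)
  · simp

theorem tcoeff_sum {ι : Type*} (s : Finset ι) {f : ι → ℂ → ℂ} (h : ∀ i ∈ s, AnalyticAt ℂ (f i) 0)
    (j : ℕ) : tcoeff (fun t => ∑ i ∈ s, f i t) j = ∑ i ∈ s, tcoeff (f i) j := by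
  simp only [tcoeff]
  rw [iteratedDeriv_fun_sum fun i hi => (h i hi).contDiffAt, Finset.sum_div]

theorem analyticAt_taylorPoly (k : ℕ) (f : ℂ → ℂ) : AnalyticAt ℂ (taylorPoly k f) 0 := by
  unfold taylorPoly
  fun_prop

theorem tcoeff_taylorPoly (k : ℕ) (f : ℂ → ℂ) (j : ℕ) :
    tcoeff (taylorPoly k f) j = if j ≤ k then tcoeff f j else 0 := by
  unfold taylorPoly
  rw [tcoeff_sum _ fun i _ => by fun_prop]
  have : ∀ i ∈ Finset.range (k + 1), tcoeff (fun t => tcoeff f i * t ^ i) j =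
      if j = i then tcoeff f i else 0 := by
    intro i _
    rw [tcoeff_const_mul, tcoeff_pow]; simp
  rw [Finset.sum_congr rfl this, Finset.sum_ite_eq]
  simp

theorem van_sub_taylorPoly {f : ℂ → ℂ} (hf : AnalyticAt ℂ f 0) (k : ℕ) :
    Van (k + 1) (fun t => f t - taylorPoly k f t) := by
  have h := analyticAt_taylorPoly k f
  rw [van_iff_tcoeff (hf.fun_sub h)]
  intro i hi
  rw [tcoeff_sub hf h, tcoeff_taylorPoly, if_pos (Nat.lt_succ_iff.1 hi), sub_self]

theorem van_sub_iff {n : ℕ} {f g : ℂ → ℂ} (hf : AnalyticAt ℂ f 0) (hg : AnalyticAt ℂ g 0) :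
    Van n (fun t => f t - g t) ↔ ∀ i < n, tcoeff f i = tcoeff g i := by
  rw [van_iff_tcoeff (hf.fun_sub hg)]
  simp only [tcoeff_sub hf hg, sub_eq_zero]

theorem eventuallyEq_of_tcoeff {f g : ℂ → ℂ} (hf : AnalyticAt ℂ f 0) (hg : AnalyticAt ℂ g 0)
    (h : ∀ j, tcoeff f j = tcoeff g j) : f =ᶠ[𝓝 0] g := by
  have : ord (fun t => f t - g t) = ⊤ := by
    rw [ENat.eq_top_iff_forall_ge]
    intro m
    exact ((van_sub_iff hf hg).2 fun i _ => h i).2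
  filter_upwards [analyticOrderAt_eq_top.1 this] with t ht
  exact sub_eq_zero.1 ht

theorem van_sub_monomial {k : ℕ} {f : ℂ → ℂ} (h : Van k f) :
    Van (k + 1) (fun t => f t - tcoeff f k * t ^ k) := by
  rw [van_sub_iff h.1 (by fun_prop)]
  intro i hi
  rw [tcoeff_const_mul, tcoeff_pow]
  rcases Nat.lt_succ_iff_lt_or_eq.1 hi with h1 | rfl
  · simp [h.tcoeff_eq h1, h1.ne]
  · simp

/-! ### Orders of vanishing and asymptotic estimates -/

theorem Van.isBigO {n : ℕ} {f : ℂ → ℂ} (h : Van n f) : f =O[𝓝 0] fun t : ℂ => t ^ n := by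
  obtain ⟨g, hg, e⟩ := h.exists_eq
  refine e.trans_isBigO ?_
  have : g =O[𝓝 0] fun _ => (1 : ℂ) := hg.continuousAt.norm.isBoundedUnder_le.isBigO_one ℂ
  simpa using (Asymptotics.isBigO_refl (fun t : ℂ => t ^ n) (𝓝 0)).mul this

/-- If the order were some j ≤ n, then f = t^j g with g(0) ≠ 0, while g = (f / t^n) t^(n−j) tends to
0 off the origin. This turns estimates from strict differentiability into statements about orders.
-/
theorem van_of_isLittleO {n : ℕ} {f : ℂ → ℂ} (hf : AnalyticAt ℂ f 0)
    (h : f =o[𝓝 0] fun t : ℂ => t ^ n) : Van (n + 1) f := by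
  by_contra hcon
  have hlt : ord f < (n + 1 : ℕ) := by
    by_contra h'
    exact hcon ⟨hf, not_lt.1 h'⟩
  obtain ⟨j, hj⟩ := ENat.ne_top_iff_exists.1 (ne_top_of_lt hlt)
  rw [← hj] at hlt
  have hjn : j ≤ n := by
    have : j < n + 1 := by exact_mod_cast hlt
    omega
  obtain ⟨g, hg, hg0, e⟩ := (hf.analyticOrderAt_eq_natCast (n := j)).1 hj.symm
  apply hg0
  have h1 : Tendsto (fun t => f t / t ^ n) (𝓝[≠] 0) (𝓝 0) :=
    (h.mono nhdsWithin_le_nhds).tendsto_div_nhds_zero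
  have h2 : Tendsto (fun t : ℂ => t ^ (n - j)) (𝓝[≠] 0) (𝓝 (0 ^ (n - j))) :=
    ((continuous_pow (n - j)).tendsto 0).mono_left nhdsWithin_le_nhds
  have h3 := h1.mul h2
  rw [zero_mul] at h3
  have h4 : Tendsto g (𝓝[≠] 0) (𝓝 (g 0)) := hg.continuousAt.tendsto.mono_left nhdsWithin_le_nhds
  refine tendsto_nhds_unique (h4.congr' ?_) h3
  filter_upwards [e.filter_mono nhdsWithin_le_nhds, self_mem_nhdsWithin] with t ht hne
  have hne' : t ≠ 0 := hne
  simp only [sub_zero, smul_eq_mul] at ht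
  rw [ht]
  have : t ^ n = t ^ (n - j) * t ^ j := by rw [← pow_add, Nat.sub_add_cancel hjn]
  rw [this]
  field_simp

theorem van_of_isBigO {n : ℕ} {f : ℂ → ℂ} (hf : AnalyticAt ℂ f 0)
    (h : f =O[𝓝 0] fun t : ℂ => t ^ n) : Van n f := by
  cases n with
  | zero => exact van_zero_iff.2 hf
  | succ n =>
    refine van_of_isLittleO hf (h.trans_isLittleO ?_)
    have : (fun t : ℂ => t) =o[𝓝 0] fun _ => (1 : ℂ) := by
      rw [Asymptotics.isLittleO_one_iff]; exact tendsto_id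
    simpa [pow_succ] using (Asymptotics.isBigO_refl (fun t : ℂ => t ^ n) (𝓝 0)).mul_isLittleO this

theorem ord_pow (n : ℕ) : ord (fun t => t ^ n) = n := by
  have h : AnalyticAt ℂ (fun t : ℂ => t ^ n) 0 := by fun_prop
  exact (h.analyticOrderAt_eq_natCast).2 ⟨fun _ => 1, by fun_prop, by simp, by simp⟩

theorem ord_mul {f g : ℂ → ℂ} (hf : AnalyticAt ℂ f 0) (hg : AnalyticAt ℂ g 0) :
    ord (fun t => f t * g t) = ord f + ord g := analyticOrderAt_mul hf hg

theorem ord_eq_natCast_iff {f : ℂ → ℂ} (hf : AnalyticAt ℂ f 0) (n : ℕ) :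
    ord f = n ↔ Van n f ∧ tcoeff f n ≠ 0 := by
  have := analyticOrderAt_eq_nat_iff_iteratedDeriv_eq_zero (n := n) hf
  rw [van_iff_tcoeff hf]
  simp only [ord, this, tcoeff, ne_eq, div_eq_zero_iff, Nat.cast_eq_zero,
    Nat.factorial_ne_zero, or_false]

theorem ord_eq_of_van_sub {k : ℕ} {d : ℂ} {f : ℂ → ℂ}
    (h : Van (k + 1) (fun t => f t - d * t ^ k)) (hd : d ≠ 0) : ord f = k := by
  have hf : AnalyticAt ℂ f 0 := by
    have := h.1.add (g := fun t => d * t ^ k) (by fun_prop)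
    exact this.congr (Eventually.of_forall fun t => by simp)
  rw [ord_eq_natCast_iff hf]
  have key := (van_sub_iff hf (by fun_prop)).1 h
  have h2 : ∀ i, tcoeff (fun t : ℂ => d * t ^ k) i = if i = k then d else 0 := by
    intro i; rw [tcoeff_const_mul, tcoeff_pow]; simp
  refine ⟨(van_iff_tcoeff hf).2 fun i hi => ?_, ?_⟩
  · rw [key i (by omega), h2, if_neg hi.ne]
  · rw [key k (by omega), h2, if_pos rfl]; exact hd

theorem ord_comp {f ρ : ℂ → ℂ} (hρ : AnalyticAt ℂ ρ 0) (h0 : ρ 0 = 0) (h1 : deriv ρ 0 ≠ 0) :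
    ord (fun t => f (ρ t)) = ord f := by
  have := analyticOrderAt_comp_of_deriv_ne_zero (f := f) hρ h1
  rw [h0] at this
  exact this

/-! ### Logarithms of substitutions tangent to the identity -/

/-- `ρ` is analytic, fixes `0` and has derivative `1` there. -/
def Tangent (ρ : ℂ → ℂ) : Prop := Van 2 (fun t => ρ t - t)

theorem Tangent.van {ρ : ℂ → ℂ} (h : Tangent ρ) : Van 1 ρ :=
  ((h.mono one_le_two).add van_id).congr (Eventually.of_forall fun t => by simp)

theorem tangent_of_deriv {ρ : ℂ → ℂ} (ha : AnalyticAt ℂ ρ 0) (h0 : ρ 0 = 0)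
    (h1 : deriv ρ 0 = 1) : Tangent ρ := by
  unfold Tangent
  rw [van_sub_iff ha (by fun_prop)]
  intro i hi
  interval_cases i
  · simp [tcoeff, h0]
  · simp [tcoeff, h1]

theorem Tangent.deriv_eq {ρ : ℂ → ℂ} (h : Tangent ρ) : deriv ρ 0 = 1 := by
  have := (van_sub_iff h.van.1 (by fun_prop)).1 h 1 one_lt_two
  simpa [tcoeff] using this

theorem Tangent.pow_sub {ρ : ℂ → ℂ} (h : Tangent ρ) (n : ℕ) :
    Van (n + 1) (fun t => ρ t ^ n - t ^ n) := by
  induction n with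
  | zero => simpa using van_const_zero 1
  | succ n ih =>
    have h1 : Van (n + 2) (fun t => ρ t ^ n * (ρ t - t)) := by simpa using (h.van.pow n).mul h
    have h2 : Van (n + 2) (fun t => (ρ t ^ n - t ^ n) * t) := ih.mul van_id
    exact (h1.add h2).congr (Eventually.of_forall fun t => by ring)

/-- With u = t^n g, both ρ^n − t^n and t^n (g ∘ ρ − g) gain one order. This gain makes f ↦ f ∘ ρ − f
nilpotent on jets, so a truncated logarithm is meaningful. -/
theorem Tangent.comp_sub {ρ u : ℂ → ℂ} (h : Tangent ρ) {n : ℕ} (hu : Van n u) :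
    Van (n + 1) (fun t => u (ρ t) - u t) := by
  obtain ⟨g, hg, e⟩ := hu.exists_eq
  have hg' : AnalyticAt ℂ (fun t => g (ρ t)) 0 :=
    AnalyticAt.comp_zero hg h.van.1 (h.van.apply_zero one_pos)
  have h1 := (h.pow_sub n).mul_right hg'
  have h2 : Van 1 (fun t => g (ρ t) - g t) := by
    rw [van_one_iff (hg'.fun_sub hg)]
    simp [h.van.apply_zero one_pos]
  have h3 := (van_pow n).mul h2
  have e' := e.comp_tendsto (tendsto_zero_of_analytic h.van.1 (h.van.apply_zero one_pos))
  refine (h1.add h3).congr ?_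
  filter_upwards [e, e'] with t ht ht'
  simp only [Function.comp_apply] at ht'
  rw [ht, ht']
  ring

/-- The operator `f ↦ f ∘ σ - f`. -/
noncomputable def compSub {α : Type*} (σ : α → α) : Module.End ℂ (α → ℂ) :=
  LinearMap.funLeft ℂ ℂ σ - 1

@[simp] theorem compSub_apply {α : Type*} (σ : α → α) (f : α → ℂ) (z : α) :
    compSub σ f z = f (σ z) - f z := rfl

theorem compSub_one_add_pow {α : Type*} (σ : α → α) (n : ℕ) (f : α → ℂ) :
    ((compSub σ + 1) ^ n) f = f ∘ σ^[n] := by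
  induction n generalizing f with
  | zero => rfl
  | succ n ih =>
    rw [pow_succ, Module.End.mul_apply, ih]
    funext z
    simp only [Function.comp_apply, LinearMap.add_apply, Pi.add_apply, compSub_apply,
      Module.End.one_apply, Function.iterate_succ_apply']
    ring

/-- The coefficients of the series of `log (1 + x)`. -/
noncomputable def logCoeff (i : ℕ) : ℂ := (-1) ^ (i + 1) / i

/-- The truncation of the logarithm of the substitution operator `f ↦ f ∘ σ`. -/
noncomputable def logOp (K : ℕ) {α : Type*} (σ : α → α) : Module.End ℂ (α → ℂ) :=
  ∑ i ∈ Finset.range (K + 1), logCoeff i • (compSub σ) ^ i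

theorem logOp_apply (K : ℕ) {α : Type*} (σ : α → α) (f : α → ℂ) (z : α) :
    logOp K σ f z = ∑ i ∈ Finset.range (K + 1), logCoeff i * ((compSub σ) ^ i) f z := by
  simp [logOp, LinearMap.sum_apply, Finset.sum_apply]

theorem Tangent.van_compSub {ρ u : ℂ → ℂ} (h : Tangent ρ) {n : ℕ} (hu : Van n u) :
    Van (n + 1) (compSub ρ u) := h.comp_sub hu

theorem Tangent.van_compSub_pow {ρ u : ℂ → ℂ} (h : Tangent ρ) {n : ℕ} (hu : Van n u) (i : ℕ) :
    Van (n + i) (((compSub ρ) ^ i) u) := by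
  induction i with
  | zero => exact hu
  | succ i ih =>
    rw [pow_succ', Module.End.mul_apply]
    exact h.van_compSub ih

theorem Tangent.van_logOp {ρ u : ℂ → ℂ} (h : Tangent ρ) (K : ℕ) {n : ℕ} (hu : Van n u) :
    Van (n + 1) (logOp K ρ u) := by
  have : logOp K ρ u = fun t => ∑ i ∈ Finset.range (K + 1), logCoeff i * ((compSub ρ) ^ i) u t :=
    funext fun t => logOp_apply K ρ u t
  rw [this]
  refine van_sum _ fun i _ => ?_
  rcases Nat.eq_zero_or_pos i with rfl | hi
  -- The term of index 0 is absent from the logarithm: `logCoeff 0` is −1/0, which is 0.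
  · simpa [logCoeff] using van_const_zero (n + 1)
  · exact ((h.van_compSub_pow hu i).mono (by omega)).const_mul _

/-- The binomial coefficient `X (X - 1) ⋯ (X - i + 1) / i!`. -/
noncomputable def binomPoly (i : ℕ) : Polynomial ℂ :=
  Polynomial.C ((i.factorial : ℂ)⁻¹) * descPochhammer ℂ i

theorem binomPoly_eval (i n : ℕ) : (binomPoly i).eval (n : ℂ) = n.choose i := by
  rw [binomPoly, Polynomial.eval_mul, Polynomial.eval_C, descPochhammer_eval_eq_descFactorial,
    Nat.descFactorial_eq_factorial_mul_choose]
  have := Nat.factorial_ne_zero i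
  push_cast
  field_simp

theorem descPochhammer_eval_neg_one (i : ℕ) :
    (descPochhammer ℂ i).eval (-1) = (-1) ^ i * i.factorial := by
  induction i with
  | zero => simp
  | succ i ih =>
    rw [descPochhammer_succ_right, Polynomial.eval_mul, ih, Nat.factorial_succ]
    simp only [Polynomial.eval_sub, Polynomial.eval_X, Polynomial.eval_natCast]
    push_cast
    ring

/-- The logarithm of 1 + x is the derivative at n = 0 of (1 + x)^n, whose coefficients are the
binomial polynomials. After splitting off the factor X, only the value of the remaining factor at 0
survives, a falling factorial at −1. -/
theorem binomPoly_derivative_eval (i : ℕ) :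
    (Polynomial.derivative (binomPoly i)).eval 0 = logCoeff i := by
  cases i with
  | zero => simp [binomPoly, logCoeff]
  | succ i =>
    rw [binomPoly, Polynomial.derivative_C_mul, descPochhammer_succ_left, Polynomial.derivative_mul]
    simp only [Polynomial.derivative_X, one_mul, Polynomial.eval_mul, Polynomial.eval_C,
      Polynomial.eval_add, Polynomial.eval_comp, Polynomial.eval_sub, Polynomial.eval_X,
      Polynomial.eval_one, zero_mul, add_zero, zero_sub, descPochhammer_eval_neg_one, logCoeff,
      Nat.factorial_succ]
    have := Nat.factorial_ne_zero i
    have h2 : ((i : ℂ) + 1) ≠ 0 := by exact_mod_cast Nat.succ_ne_zero i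
    push_cast
    field_simp
    ring

/-- The polynomial in `n` that gives the coefficient of `t ^ j` in `u ∘ ρ^[n]`. -/
noncomputable def iterPoly (K : ℕ) (ρ u : ℂ → ℂ) (j : ℕ) : Polynomial ℂ :=
  ∑ i ∈ Finset.range (K + 1), Polynomial.C (tcoeff (((compSub ρ) ^ i) u) j) * binomPoly i

/-- The i-th power of `compSub ρ` gains i orders, so only i ≤ j reaches the coefficient of t^j. The
binomial expansion of u ∘ ρ^n is therefore polynomial in n, coefficient by coefficient. -/
theorem Tangent.iterPoly_eval {ρ u : ℂ → ℂ} (h : Tangent ρ) (hu : AnalyticAt ℂ u 0) {K j : ℕ}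
    (hj : j ≤ K) (n : ℕ) : (iterPoly K ρ u j).eval (n : ℂ) = tcoeff (u ∘ ρ^[n]) j := by
  have hN : ∀ i, AnalyticAt ℂ (((compSub ρ) ^ i) u) 0 := fun i =>
    (h.van_compSub_pow (van_zero_iff.2 hu) i).1
  have hexp : u ∘ ρ^[n] = fun t => ∑ i ∈ Finset.range (n + 1),
      (n.choose i : ℂ) * ((compSub ρ) ^ i) u t := by
    rw [← compSub_one_add_pow, (Commute.one_right (compSub ρ)).add_pow]
    funext t
    simp only [LinearMap.sum_apply, Finset.sum_apply, one_pow, mul_one]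
    refine Finset.sum_congr rfl fun i _ => ?_
    rw [Module.End.mul_apply, ← nsmul_one, ← Nat.cast_smul_eq_nsmul ℂ]
    simp
  rw [hexp, tcoeff_sum _ fun i _ => (by have := hN i; fun_prop)]
  simp only [tcoeff_const_mul, iterPoly, Polynomial.eval_finsetSum, Polynomial.eval_mul,
    Polynomial.eval_C, binomPoly_eval]
  -- Both sums are extended to a common range: beyond K the Taylor coefficient vanishes, beyond n
  -- the binomial coefficient does.
  have e1 : ∀ L, K ≤ L → n ≤ L → ∑ i ∈ Finset.range (K + 1),
      tcoeff (((compSub ρ) ^ i) u) j * (n.choose i : ℂ) =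
      ∑ i ∈ Finset.range (L + 1), tcoeff (((compSub ρ) ^ i) u) j * (n.choose i : ℂ) := by
    intro L hL _
    refine Finset.sum_subset (Finset.range_mono (by omega)) fun i _ hi => ?_
    have : K < i := by simpa using hi
    rw [(h.van_compSub_pow (van_zero_iff.2 hu) i).tcoeff_eq (by omega), zero_mul]
  have e2 : ∀ L, K ≤ L → n ≤ L → ∑ i ∈ Finset.range (n + 1),
      (n.choose i : ℂ) * tcoeff (((compSub ρ) ^ i) u) j =
      ∑ i ∈ Finset.range (L + 1), tcoeff (((compSub ρ) ^ i) u) j * (n.choose i : ℂ) := by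
    intro L _ hL
    simp only [mul_comm ((n.choose _ : ℕ) : ℂ)]
    refine Finset.sum_subset (Finset.range_mono (by omega)) fun i _ hi => ?_
    have : n < i := by simpa using hi
    simp [Nat.choose_eq_zero_of_lt this]
  rw [e1 (max K n) (le_max_left _ _) (le_max_right _ _),
    e2 (max K n) (le_max_left _ _) (le_max_right _ _)]

theorem Tangent.iterPoly_derivative_eval {ρ u : ℂ → ℂ} (h : Tangent ρ) (hu : AnalyticAt ℂ u 0)
    (K j : ℕ) :
    (Polynomial.derivative (iterPoly K ρ u j)).eval 0 = tcoeff (logOp K ρ u) j := by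
  have hN : ∀ i, AnalyticAt ℂ (((compSub ρ) ^ i) u) 0 := fun i =>
    (h.van_compSub_pow (van_zero_iff.2 hu) i).1
  have : logOp K ρ u = fun t => ∑ i ∈ Finset.range (K + 1), logCoeff i * ((compSub ρ) ^ i) u t :=
    funext fun t => logOp_apply K ρ u t
  rw [this, tcoeff_sum _ fun i _ => (by have := hN i; fun_prop)]
  simp [iterPoly, Polynomial.eval_finsetSum, binomPoly_derivative_eval,
    tcoeff_const_mul, mul_comm]

/-- The logarithm of a substitution is a derivation up to high order. -/
theorem Tangent.logOp_mul {ρ u v : ℂ → ℂ} (h : Tangent ρ) (hu : AnalyticAt ℂ u 0)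
    (hv : AnalyticAt ℂ v 0) (K : ℕ) :
    Van (K + 1) (fun t => logOp K ρ (fun t => u t * v t) t -
      (logOp K ρ u t * v t + u t * logOp K ρ v t)) := by
  have hDu := (h.van_logOp K (van_zero_iff.2 hu)).1
  have hDv := (h.van_logOp K (van_zero_iff.2 hv)).1
  have huv : AnalyticAt ℂ (fun t => u t * v t) 0 := hu.mul hv
  have hDuv := (h.van_logOp K (van_zero_iff.2 huv)).1
  rw [van_sub_iff hDuv (by fun_prop)]
  intro j hj
  have hj' : j ≤ K := Nat.lt_succ_iff.1 hj
  have hit : ∀ (w : ℂ → ℂ), AnalyticAt ℂ w 0 → ∀ n : ℕ, AnalyticAt ℂ (w ∘ ρ^[n]) 0 := by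
    intro w hw n
    rw [← compSub_one_add_pow]
    induction n generalizing w with
    | zero => simpa using hw
    | succ n ih =>
      rw [pow_succ, Module.End.mul_apply]
      refine ih _ ?_
      rw [LinearMap.add_apply]
      exact (h.van_compSub (van_zero_iff.2 hw)).1.add hw
  -- Composition with an iterate is multiplicative. As coefficients are polynomial in the number of
  -- iterations, the Cauchy product holds as an identity of polynomials, and its derivative at 0 is
  -- the Leibniz rule.
  have hpoly : iterPoly K ρ (fun t => u t * v t) j =
      ∑ p ∈ Finset.HasAntidiagonal.antidiagonal j, iterPoly K ρ u p.1 * iterPoly K ρ v p.2 := by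
    refine Polynomial.eq_of_infinite_eval_eq _ _
      (Set.Infinite.mono ?_ (Set.infinite_range_of_injective (Nat.cast_injective (R := ℂ))))
    rintro _ ⟨n, rfl⟩
    change Polynomial.eval _ _ = Polynomial.eval _ _
    rw [h.iterPoly_eval huv hj', Polynomial.eval_finsetSum]
    have e : (fun t => u t * v t) ∘ ρ^[n] = fun t => (u ∘ ρ^[n]) t * (v ∘ ρ^[n]) t := rfl
    rw [e, tcoeff_mul (hit u hu n) (hit v hv n)]
    refine Finset.sum_congr rfl fun p hp => ?_
    have := Finset.HasAntidiagonal.mem_antidiagonal.1 hp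
    rw [Polynomial.eval_mul, h.iterPoly_eval hu (by omega), h.iterPoly_eval hv (by omega)]
  have hd := congrArg (fun P => (Polynomial.derivative P).eval 0) hpoly
  simp only [Polynomial.derivative_sum, Polynomial.derivative_mul, Polynomial.eval_finsetSum,
    Polynomial.eval_add, Polynomial.eval_mul, h.iterPoly_derivative_eval huv,
    h.iterPoly_derivative_eval hu, h.iterPoly_derivative_eval hv] at hd
  rw [hd, tcoeff_add (hDu.fun_mul hv) (hu.fun_mul hDv), tcoeff_mul hDu hv, tcoeff_mul hu hDv,
    ← Finset.sum_add_distrib]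
  refine Finset.sum_congr rfl fun p hp => ?_
  have := Finset.HasAntidiagonal.mem_antidiagonal.1 hp
  have h1 := h.iterPoly_eval hu (K := K) (j := p.1) (by omega) 0
  have h2 := h.iterPoly_eval hv (K := K) (j := p.2) (by omega) 0
  simp only [Nat.cast_zero, Function.iterate_zero, Function.comp_id] at h1 h2
  rw [h1, h2]

theorem Tangent.logOp_pow {ρ : ℂ → ℂ} (h : Tangent ρ) (K l : ℕ) :
    Van (K + 1) (fun t => logOp K ρ (fun t => t ^ l) t -
      deriv (fun t => t ^ l) t * logOp K ρ (fun t => t) t) := by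
  have hD := (h.van_logOp K van_id).1
  induction l with
  | zero =>
    have h1 : ∀ i, 0 < i → ((compSub ρ) ^ i) (fun _ => (1 : ℂ)) = 0 := by
      intro i hi
      obtain ⟨i, rfl⟩ := Nat.exists_eq_succ_of_ne_zero hi.ne'
      rw [pow_succ, Module.End.mul_apply]
      have : compSub ρ (fun _ => (1 : ℂ)) = 0 := by funext t; simp
      rw [this, map_zero]
    refine (van_const_zero (K + 1)).congr (Eventually.of_forall fun t => ?_)
    simp only [pow_zero, deriv_const', zero_mul, sub_zero, logOp_apply]
    refine (Finset.sum_eq_zero fun i _ => ?_).symm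
    rcases Nat.eq_zero_or_pos i with rfl | hi
    · simp [logCoeff]
    · simp [h1 i hi]
  | succ l ih =>
    have h1 := h.logOp_mul (u := fun t => t ^ l) (v := fun t => t) (by fun_prop) (by fun_prop) K
    have h2 := ih.mul_right (g := fun t => t) (by fun_prop)
    refine (h1.add h2).congr (Eventually.of_forall fun t => ?_)
    have e : deriv (fun t : ℂ => t ^ (l + 1)) t = deriv (fun t => t ^ l) t * t + t ^ l := by
      simp only [pow_succ]
      rw [deriv_fun_mul (by fun_prop) (by fun_prop)]
      simp
    beta_reduce
    rw [e]
    simp only [pow_succ]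
    ring

/-- A derivation is determined by its value on t, so modulo t^(K+1) the logarithm is a vector field
in t. It suffices to treat powers of t; the Taylor remainder has order K + 1 and is negligible on
both sides. -/
theorem Tangent.logOp_eq {ρ u : ℂ → ℂ} (h : Tangent ρ) (hu : AnalyticAt ℂ u 0) (K : ℕ) :
    Van (K + 1) (fun t => logOp K ρ u t - deriv u t * logOp K ρ (fun t => t) t) := by
  have hD := h.van_logOp K van_id
  have h0 := van_sub_taylorPoly hu K
  have h1 := (h.van_logOp K h0).mono (Nat.le_succ _)
  have h2 : Van (K + 1) (fun t => ∑ l ∈ Finset.range (K + 1),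
      tcoeff u l * (logOp K ρ (fun t => t ^ l) t -
      deriv (fun t => t ^ l) t * logOp K ρ (fun t => t) t)) :=
    van_sum _ fun l _ => (h.logOp_pow K l).const_mul _
  have h3 := (h0.deriv.mul hD).mono (show K + 1 ≤ K + (1 + 1) by omega)
  refine ((h1.add h2).sub h3).congr ?_
  filter_upwards [hu.eventually_analyticAt] with t ht
  have e1 : logOp K ρ (fun t => u t - taylorPoly K u t) t =
      logOp K ρ u t - ∑ l ∈ Finset.range (K + 1), tcoeff u l * logOp K ρ (fun t => t ^ l) t := by
    have : (fun t => u t - taylorPoly K u t) =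
        u - ∑ l ∈ Finset.range (K + 1), tcoeff u l • (fun t : ℂ => t ^ l) := by
      funext t
      simp [taylorPoly, Finset.sum_apply]
    rw [this, map_sub, map_sum]
    simp [Finset.sum_apply]
  have e2 : deriv (fun t => u t - taylorPoly K u t) t =
      deriv u t - ∑ l ∈ Finset.range (K + 1), tcoeff u l * deriv (fun t => t ^ l) t := by
    have hp : DifferentiableAt ℂ (taylorPoly K u) t := by unfold taylorPoly; fun_prop
    rw [deriv_fun_sub ht.differentiableAt hp]
    congr 1
    unfold taylorPoly
    rw [deriv_fun_sum fun l _ => by fun_prop]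
    refine Finset.sum_congr rfl fun l _ => ?_
    rw [deriv_const_mul _ (by fun_prop)]
  rw [e1, e2]
  simp only [mul_sub, Finset.sum_sub_distrib, sub_mul, Finset.sum_mul]
  simp only [mul_assoc]
  ring

/-! ### Exponentials of vector fields of one variable -/

/-- The vector field `ε d/dt`. -/
noncomputable def lieD (ε u : ℂ → ℂ) : ℂ → ℂ := fun t => ε t * deriv u t

theorem Van.lieD {ε u : ℂ → ℂ} (hε : Van 2 ε) {n : ℕ} (hu : Van n u) : Van (n + 1) (lieD ε u) := by
  cases n with
  | zero => exact (hε.mul_right hu.1.deriv).mono one_le_two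
  | succ n => exact (hε.mul hu.deriv).mono (by omega)

theorem Van.lieD_iterate {ε u : ℂ → ℂ} (hε : Van 2 ε) {n : ℕ} (hu : Van n u) (i : ℕ) :
    Van (n + i) ((TwoBranches.lieD ε)^[i] u) := by
  induction i with
  | zero => exact hu
  | succ i ih =>
    rw [Function.iterate_succ_apply']
    exact hε.lieD ih

theorem lieD_congr {ε u v : ℂ → ℂ} (h : u =ᶠ[𝓝 0] v) : lieD ε u =ᶠ[𝓝 0] lieD ε v := by
  filter_upwards [h.deriv] with t ht
  simp [lieD, ht]

theorem lieD_iterate_congr {ε u v : ℂ → ℂ} (h : u =ᶠ[𝓝 0] v) (i : ℕ) :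
    (lieD ε)^[i] u =ᶠ[𝓝 0] (lieD ε)^[i] v := by
  induction i with
  | zero => exact h
  | succ i ih =>
    rw [Function.iterate_succ_apply', Function.iterate_succ_apply']
    exact lieD_congr ih

theorem lieD_iterate_add {ε u v : ℂ → ℂ} (hε : Van 2 ε) (hu : AnalyticAt ℂ u 0)
    (hv : AnalyticAt ℂ v 0) (i : ℕ) :
    (lieD ε)^[i] (fun t => u t + v t) =ᶠ[𝓝 0] fun t => (lieD ε)^[i] u t + (lieD ε)^[i] v t := by
  induction i with
  | zero => rfl
  | succ i ih =>
    simp only [Function.iterate_succ_apply']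
    refine (lieD_congr ih).trans ?_
    have h1 := (hε.lieD_iterate (van_zero_iff.2 hu) i).1
    have h2 := (hε.lieD_iterate (van_zero_iff.2 hv) i).1
    filter_upwards [h1.eventually_analyticAt, h2.eventually_analyticAt] with t h1 h2
    simp only [lieD]
    rw [deriv_fun_add h1.differentiableAt h2.differentiableAt, mul_add]

theorem lieD_iterate_const_mul (ε u : ℂ → ℂ) (c : ℂ) (i : ℕ) :
    (lieD ε)^[i] (fun t => c * u t) = fun t => c * (lieD ε)^[i] u t := by
  induction i with
  | zero => rfl
  | succ i ih =>
    simp only [Function.iterate_succ_apply', ih]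
    funext t
    simp only [lieD, deriv_const_mul_field]
    ring

/-- The Leibniz rule for divided powers of a derivation. The identity is only claimed near the
origin, because the product rule for `deriv` needs differentiability. -/
theorem lieD_iterate_mul {ε u v : ℂ → ℂ} (hε : Van 2 ε) (hu : AnalyticAt ℂ u 0)
    (hv : AnalyticAt ℂ v 0) (n : ℕ) :
    (fun t => (n.factorial : ℂ)⁻¹ * (lieD ε)^[n] (fun t => u t * v t) t) =ᶠ[𝓝 0]
      fun t => ∑ p ∈ Finset.HasAntidiagonal.antidiagonal n,
        (((p.1.factorial : ℂ)⁻¹ * (lieD ε)^[p.1] u t) *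
          ((p.2.factorial : ℂ)⁻¹ * (lieD ε)^[p.2] v t)) := by
  have hA : ∀ w, AnalyticAt ℂ w 0 → ∀ i : ℕ,
      AnalyticAt ℂ (fun t => (i.factorial : ℂ)⁻¹ * (lieD ε)^[i] w t) 0 :=
    fun w hw i => ((hε.lieD_iterate (van_zero_iff.2 hw) i).const_mul _).1
  have hstep : ∀ w : ℂ → ℂ, ∀ (i : ℕ) (t : ℂ),
      ε t * deriv (fun t => (i.factorial : ℂ)⁻¹ * (lieD ε)^[i] w t) t =
        ((i + 1 : ℕ) : ℂ) * (((i + 1).factorial : ℂ)⁻¹ * (lieD ε)^[i + 1] w t) := by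
    intro w i t
    rw [deriv_const_mul_field, Function.iterate_succ_apply', Nat.factorial_succ]
    have h1 : ((i.factorial : ℕ) : ℂ) ≠ 0 := by exact_mod_cast Nat.factorial_ne_zero i
    have h2 : ((i : ℂ) + 1) ≠ 0 := by exact_mod_cast Nat.succ_ne_zero i
    simp only [lieD]
    push_cast
    field_simp
  induction n with
  | zero => simp
  | succ n ih =>
    have hall : ∀ᶠ t in 𝓝 (0 : ℂ), ∀ p ∈ Finset.HasAntidiagonal.antidiagonal n,
        AnalyticAt ℂ (fun t => ((p.1.factorial : ℂ)⁻¹ * (lieD ε)^[p.1] u t)) t ∧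
        AnalyticAt ℂ (fun t => ((p.2.factorial : ℂ)⁻¹ * (lieD ε)^[p.2] v t)) t := by
      rw [Filter.eventually_all_finset]
      intro p _
      exact (hA u hu p.1).eventually_analyticAt.and (hA v hv p.2).eventually_analyticAt
    filter_upwards [ih.deriv, hall] with t ht han
    have hn : ((n + 1 : ℕ) : ℂ) ≠ 0 := by exact_mod_cast Nat.succ_ne_zero n
    refine mul_left_cancel₀ hn ?_
    rw [← hstep, ht, deriv_fun_sum fun p hp =>
      ((han p hp).1.differentiableAt.fun_mul (han p hp).2.differentiableAt), Finset.mul_sum]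
    have e1 : ∀ p ∈ Finset.HasAntidiagonal.antidiagonal n, ε t * deriv (fun t =>
        ((p.1.factorial : ℂ)⁻¹ * (lieD ε)^[p.1] u t) *
          ((p.2.factorial : ℂ)⁻¹ * (lieD ε)^[p.2] v t)) t =
        ((p.1 + 1 : ℕ) : ℂ) * (((p.1 + 1).factorial : ℂ)⁻¹ * (lieD ε)^[p.1 + 1] u t) *
          ((p.2.factorial : ℂ)⁻¹ * (lieD ε)^[p.2] v t) +
        ((p.1.factorial : ℂ)⁻¹ * (lieD ε)^[p.1] u t) *
        (((p.2 + 1 : ℕ) : ℂ) * (((p.2 + 1).factorial : ℂ)⁻¹ * (lieD ε)^[p.2 + 1] v t)) := by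
      intro p hp
      rw [deriv_fun_mul (han p hp).1.differentiableAt (han p hp).2.differentiableAt, ← hstep,
        ← hstep]
      ring
    rw [Finset.sum_congr rfl e1, Finset.sum_add_distrib]
    have e2 := Finset.Nat.sum_antidiagonal_succ (n := n) (f := fun p : ℕ × ℕ =>
      (p.1 : ℂ) * ((p.1.factorial : ℂ)⁻¹ * (lieD ε)^[p.1] u t) *
        ((p.2.factorial : ℂ)⁻¹ * (lieD ε)^[p.2] v t))
    have e3 := Finset.Nat.sum_antidiagonal_succ' (n := n) (f := fun p : ℕ × ℕ =>
      ((p.1.factorial : ℂ)⁻¹ * (lieD ε)^[p.1] u t) *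
        ((p.2 : ℂ) * ((p.2.factorial : ℂ)⁻¹ * (lieD ε)^[p.2] v t)))
    simp only [Nat.cast_zero, zero_mul, mul_zero, zero_add] at e2 e3
    rw [← e2, ← e3, ← Finset.sum_add_distrib, Finset.mul_sum]
    refine Finset.sum_congr rfl fun p hp => ?_
    have hp' := Finset.HasAntidiagonal.mem_antidiagonal.1 hp
    rw [← hp']
    push_cast
    ring

/-- The truncated exponential of `ε d/dt`. -/
noncomputable def expD (K : ℕ) (ε u : ℂ → ℂ) : ℂ → ℂ :=
  fun t => ∑ i ∈ Finset.range (K + 1), (i.factorial : ℂ)⁻¹ * (lieD ε)^[i] u t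

theorem Van.expD {ε u : ℂ → ℂ} (hε : Van 2 ε) {n : ℕ} (hu : Van n u) (K : ℕ) :
    Van n (expD K ε u) :=
  van_sum _ fun i _ => ((hε.lieD_iterate hu i).mono (by omega)).const_mul _

theorem expD_tangent {ε : ℂ → ℂ} (hε : Van 2 ε) (K : ℕ) : Tangent (expD K ε fun t => t) := by
  unfold Tangent
  have h : Van 2 (fun t => ∑ i ∈ Finset.range K, ((i + 1).factorial : ℂ)⁻¹ *
      (lieD ε)^[i + 1] (fun t => t) t) :=
    van_sum _ fun i _ => ((hε.lieD_iterate van_id (i + 1)).mono (by omega)).const_mul _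
  refine h.congr (Eventually.of_forall fun t => ?_)
  simp [expD, Finset.sum_range_succ']

/-- The products of terms of indices i and j with i + j ≤ K match by the Leibniz rule; every other
product has order at least i + j > K. -/
theorem expD_mul {ε u v : ℂ → ℂ} (hε : Van 2 ε) (hu : AnalyticAt ℂ u 0)
    (hv : AnalyticAt ℂ v 0) (K : ℕ) :
    Van (K + 1) (fun t => expD K ε (fun t => u t * v t) t - expD K ε u t * expD K ε v t) := by
  set A : ℕ → ℂ → ℂ := fun i t => (i.factorial : ℂ)⁻¹ * (lieD ε)^[i] u t with hAdef
  set B : ℕ → ℂ → ℂ := fun i t => (i.factorial : ℂ)⁻¹ * (lieD ε)^[i] v t with hBdef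
  have hA : ∀ i, Van i (A i) := fun i => by
    simpa using (hε.lieD_iterate (van_zero_iff.2 hu) i).const_mul ((i.factorial : ℂ)⁻¹)
  have hB : ∀ i, Van i (B i) := fun i => by
    simpa using (hε.lieD_iterate (van_zero_iff.2 hv) i).const_mul ((i.factorial : ℂ)⁻¹)
  set S := Finset.range (K + 1) ×ˢ Finset.range (K + 1)
  have h1 : Van (K + 1) (fun t => ∑ p ∈ S.filter (fun p => ¬ p.1 + p.2 ≤ K),
      A p.1 t * B p.2 t) := by
    refine van_sum _ fun p hp => ((hA p.1).mul (hB p.2)).mono ?_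
    have := (Finset.mem_filter.1 hp).2
    omega
  refine h1.neg.congr ?_
  have hall : ∀ᶠ t in 𝓝 (0 : ℂ), ∀ n ∈ Finset.range (K + 1),
      (n.factorial : ℂ)⁻¹ * (lieD ε)^[n] (fun t => u t * v t) t =
        ∑ p ∈ Finset.HasAntidiagonal.antidiagonal n, A p.1 t * B p.2 t := by
    rw [Filter.eventually_all_finset]
    intro n _
    exact lieD_iterate_mul hε hu hv n
  filter_upwards [hall] with t ht
  have e1 : expD K ε (fun t => u t * v t) t =
      ∑ p ∈ S.filter (fun p => p.1 + p.2 ≤ K), A p.1 t * B p.2 t := by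
    rw [expD, Finset.sum_congr rfl ht, ← Finset.sum_fiberwise_of_maps_to
      (s := S.filter (fun p => p.1 + p.2 ≤ K)) (t := Finset.range (K + 1)) (g := fun p => p.1 + p.2)]
    · refine Finset.sum_congr rfl fun n hn => Finset.sum_congr ?_ fun _ _ => rfl
      ext p
      simp only [Finset.HasAntidiagonal.mem_antidiagonal, Finset.mem_filter, S, Finset.mem_product,
        Finset.mem_range] at hn ⊢
      omega
    · intro p hp
      have := (Finset.mem_filter.1 hp).2
      simp only [Finset.mem_range]
      omega
  have e2 : expD K ε u t * expD K ε v t = ∑ p ∈ S, A p.1 t * B p.2 t := by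
    rw [expD, expD, Finset.sum_mul_sum, Finset.sum_product]
  rw [e1, e2, ← Finset.sum_filter_add_sum_filter_not S (fun p => p.1 + p.2 ≤ K)]
  ring

theorem expD_pow {ε : ℂ → ℂ} (hε : Van 2 ε) (K l : ℕ) :
    Van (K + 1) (fun t => expD K ε (fun t => t ^ l) t - expD K ε (fun t => t) t ^ l) := by
  induction l with
  | zero =>
    refine (van_const_zero (K + 1)).congr (Eventually.of_forall fun t => ?_)
    have h1 : ∀ i, (lieD ε)^[i + 1] (fun _ => (1 : ℂ)) = fun _ => 0 := by
      intro i
      induction i with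
      | zero => funext t; simp [lieD]
      | succ i ih => rw [Function.iterate_succ_apply', ih]; funext t; simp [lieD]
    simp [expD, Finset.sum_range_succ', h1]
  | succ l ih =>
    have h1 := expD_mul hε (u := fun t => t ^ l) (v := fun t => t) (by fun_prop) (by fun_prop) K
    have h2 := ih.mul_right (expD_tangent hε K).van.1
    refine (h1.add h2).congr (Eventually.of_forall fun t => ?_)
    simp only [pow_succ]
    ring

theorem expD_add {ε u v : ℂ → ℂ} (hε : Van 2 ε) (hu : AnalyticAt ℂ u 0)
    (hv : AnalyticAt ℂ v 0) (K : ℕ) :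
    expD K ε (fun t => u t + v t) =ᶠ[𝓝 0] fun t => expD K ε u t + expD K ε v t := by
  have hall : ∀ᶠ t in 𝓝 (0 : ℂ), ∀ i ∈ Finset.range (K + 1),
      (lieD ε)^[i] (fun t => u t + v t) t = (lieD ε)^[i] u t + (lieD ε)^[i] v t := by
    rw [Filter.eventually_all_finset]
    exact fun i _ => lieD_iterate_add hε hu hv i
  filter_upwards [hall] with t ht
  simp only [expD]
  rw [← Finset.sum_add_distrib]
  exact Finset.sum_congr rfl fun i hi => by rw [ht i hi, mul_add]

theorem expD_const_mul (ε u : ℂ → ℂ) (c : ℂ) (K : ℕ) :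
    expD K ε (fun t => c * u t) = fun t => c * expD K ε u t := by
  funext t
  simp only [expD, lieD_iterate_const_mul, Finset.mul_sum]
  exact Finset.sum_congr rfl fun i _ => by ring

theorem expD_zero (ε : ℂ → ℂ) (K : ℕ) : expD K ε (fun _ => 0) = fun _ => 0 := by
  simpa using expD_const_mul ε (fun _ => 0) 0 K

theorem expD_sum {ι : Type*} {ε : ℂ → ℂ} (hε : Van 2 ε) (s : Finset ι) {f : ι → ℂ → ℂ}
    (hf : ∀ i ∈ s, AnalyticAt ℂ (f i) 0) (K : ℕ) :
    expD K ε (fun t => ∑ i ∈ s, f i t) =ᶠ[𝓝 0] fun t => ∑ i ∈ s, expD K ε (f i) t := by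
  classical
  induction s using Finset.induction_on with
  | empty => simp [expD_zero]
  | insert a s ha ih =>
    simp only [Finset.sum_insert ha]
    have h1 : AnalyticAt ℂ (fun t => ∑ i ∈ s, f i t) 0 :=
      Finset.analyticAt_fun_sum _ fun i hi => hf i (by simp [hi])
    refine (expD_add hε (hf a (by simp)) h1 K).trans ?_
    filter_upwards [ih fun i hi => hf i (by simp [hi])] with t ht
    rw [ht]

/-- The truncated exponential of a vector field is a substitution up to high order. -/
theorem expD_eq_comp {ε u : ℂ → ℂ} (hε : Van 2 ε) (hu : AnalyticAt ℂ u 0) (K : ℕ) :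
    Van (K + 1) (fun t => expD K ε u t - u (expD K ε (fun t => t) t)) := by
  have hρ := expD_tangent hε K
  -- As for the logarithm, multiplicativity settles powers of t, and the Taylor remainder keeps
  -- order K + 1 on both sides.
  have h0 := van_sub_taylorPoly hu K
  have h1 := hε.expD h0 K
  have h2 := h0.comp hρ.van
  have h3 : Van (K + 1) (fun t => ∑ l ∈ Finset.range (K + 1), tcoeff u l *
      (expD K ε (fun t => t ^ l) t - expD K ε (fun t => t) t ^ l)) :=
    van_sum _ fun l _ => (expD_pow hε K l).const_mul _
  refine ((h1.add h3).sub h2).congr ?_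
  have e1 := expD_add hε h0.1 (analyticAt_taylorPoly K u) K
  have e2 := expD_sum hε (Finset.range (K + 1)) (f := fun l t => tcoeff u l * t ^ l)
    (fun l _ => by fun_prop) K
  filter_upwards [e1, e2] with t e1 e2
  simp only [sub_add_cancel] at e1
  rw [e1]
  have e3 : expD K ε (taylorPoly K u) t =
      ∑ l ∈ Finset.range (K + 1), tcoeff u l * expD K ε (fun t => t ^ l) t := by
    refine Eq.trans e2 (Finset.sum_congr rfl fun l _ => ?_)
    rw [expD_const_mul]
  rw [e3]
  simp only [mul_sub, Finset.sum_sub_distrib, taylorPoly]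
  ring

/-! ### Coordinates adapted to a branch -/

/-- The coordinate that is a power of the parameter in Puiseux form. -/
noncomputable def coordX : TangentCase → (ℂ × ℂ →L[ℂ] ℂ)
  | .distinct => ContinuousLinearMap.snd ℂ ℂ ℂ
  | .same => ContinuousLinearMap.fst ℂ ℂ ℂ

/-- The other coordinate. -/
noncomputable def coordY : TangentCase → (ℂ × ℂ →L[ℂ] ℂ)
  | .distinct => ContinuousLinearMap.fst ℂ ℂ ℂ
  | .same => ContinuousLinearMap.snd ℂ ℂ ℂ

/-- The vector dual to `coordX`. -/
def vecX : TangentCase → ℂ × ℂ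
  | .distinct => (0, 1)
  | .same => (1, 0)

/-- The vector dual to `coordY`. -/
def vecY : TangentCase → ℂ × ℂ
  | .distinct => (1, 0)
  | .same => (0, 1)

@[simp] theorem coordX_vecY (δ : TangentCase) : coordX δ (vecY δ) = 0 := by cases δ <;> rfl
@[simp] theorem coordY_vecY (δ : TangentCase) : coordY δ (vecY δ) = 1 := by cases δ <;> rfl

theorem coord_decomp (δ : TangentCase) (v : ℂ × ℂ) :
    v = coordX δ v • vecX δ + coordY δ v • vecY δ := by
  cases δ <;> ext <;> simp [coordX, coordY, vecX, vecY]

theorem map_coord_decomp (δ : TangentCase) (ℓ : ℂ × ℂ →L[ℂ] ℂ) (v : ℂ × ℂ) :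
    ℓ v = coordX δ v * ℓ (vecX δ) + coordY δ v * ℓ (vecY δ) := by
  conv_lhs => rw [coord_decomp δ v]
  simp

/-- All components of `a` are analytic and vanish to order at least `n`. -/
def VVan (n : ℕ) (a : ℂ → ℂ × ℂ) : Prop := ∀ ℓ : ℂ × ℂ →L[ℂ] ℂ, Van n (fun t => ℓ (a t))

theorem VVan.of_coord {n : ℕ} {a : ℂ → ℂ × ℂ} (δ : TangentCase)
    (hX : Van n (fun t => coordX δ (a t))) (hY : Van n (fun t => coordY δ (a t))) : VVan n a := by
  intro ℓ
  have e : (fun t => ℓ (a t)) = fun t => coordX δ (a t) * ℓ (vecX δ) +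
      coordY δ (a t) * ℓ (vecY δ) := funext fun t => map_coord_decomp δ ℓ (a t)
  rw [e]
  exact (hX.mul_right analyticAt_const).add (hY.mul_right analyticAt_const)

theorem VVan.mono {n k : ℕ} {a : ℂ → ℂ × ℂ} (h : VVan n a) (hk : k ≤ n) : VVan k a :=
  fun ℓ => (h ℓ).mono hk

theorem VVan.analytic {n : ℕ} {a : ℂ → ℂ × ℂ} (h : VVan n a) : AnalyticAt ℂ a 0 :=
  (h (ContinuousLinearMap.fst ℂ ℂ ℂ)).1.prod (h (ContinuousLinearMap.snd ℂ ℂ ℂ)).1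

theorem VVan.congr {n : ℕ} {a b : ℂ → ℂ × ℂ} (h : VVan n a) (e : a =ᶠ[𝓝 0] b) : VVan n b :=
  fun ℓ => (h ℓ).congr (by filter_upwards [e] with t ht; rw [ht])

theorem VVan.add {n : ℕ} {a b : ℂ → ℂ × ℂ} (ha : VVan n a) (hb : VVan n b) :
    VVan n (fun t => a t + b t) := fun ℓ => by simpa using (ha ℓ).add (hb ℓ)

theorem VVan.sub {n : ℕ} {a b : ℂ → ℂ × ℂ} (ha : VVan n a) (hb : VVan n b) :
    VVan n (fun t => a t - b t) := fun ℓ => by simpa using (ha ℓ).sub (hb ℓ)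

theorem VVan.comp {n : ℕ} {a : ℂ → ℂ × ℂ} {ρ : ℂ → ℂ} (h : VVan n a) (hρ : Van 1 ρ) :
    VVan n (fun t => a (ρ t)) := fun ℓ => (h ℓ).comp hρ

theorem Van.smul_vec {n : ℕ} {f : ℂ → ℂ} (h : Van n f) (w : ℂ × ℂ) :
    VVan n (fun t => f t • w) := fun ℓ => by
  simpa using h.mul_right (analyticAt_const (v := ℓ w))

theorem VVan.apply_zero {n : ℕ} {a : ℂ → ℂ × ℂ} (h : VVan n a) (hn : 0 < n) : a 0 = 0 :=
  Prod.ext ((h (ContinuousLinearMap.fst ℂ ℂ ℂ)).apply_zero hn)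
    ((h (ContinuousLinearMap.snd ℂ ℂ ℂ)).apply_zero hn)

theorem vvan_one {a : ℂ → ℂ × ℂ} (ha : AnalyticAt ℂ a 0) (h0 : a 0 = 0) : VVan 1 a := by
  intro ℓ
  rw [van_one_iff ((ℓ.analyticAt _).fun_comp ha)]
  simp [h0]

theorem VVan.isBigO {n : ℕ} {a : ℂ → ℂ × ℂ} (h : VVan n a) :
    a =O[𝓝 0] fun t : ℂ => t ^ n :=
  ((h (ContinuousLinearMap.fst ℂ ℂ ℂ)).isBigO).prod_left
    ((h (ContinuousLinearMap.snd ℂ ℂ ℂ)).isBigO)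

/-- First order expansion of the difference of the values of a function on two curves. -/
theorem van_sub_sub_fderiv {f : ℂ × ℂ → ℂ} (hf : AnalyticAt ℂ f 0) {a b : ℂ → ℂ × ℂ}
    (ha : VVan 1 a) (hb : VVan 1 b) {k : ℕ} (hab : VVan k (fun t => a t - b t)) :
    Van (k + 1) (fun t => f (a t) - f (b t) - fderiv ℂ f 0 (a t - b t)) := by
  have ha0 := ha.apply_zero one_pos
  have hb0 := hb.apply_zero one_pos
  refine van_of_isLittleO (((AnalyticAt.comp_zero hf ha.analytic ha0).sub
    (AnalyticAt.comp_zero hf hb.analytic hb0)).sub (hab _).1) ?_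
  have hs := (hf.hasStrictFDerivAt).isLittleO
  have ht : Tendsto (fun t => (a t, b t)) (𝓝 0) (𝓝 ((0 : ℂ × ℂ), (0 : ℂ × ℂ))) :=
    (tendsto_zero_of_analytic ha.analytic ha0).prodMk_nhds
      (tendsto_zero_of_analytic hb.analytic hb0)
  exact (hs.comp_tendsto ht).trans_isBigO hab.isBigO

theorem van_sub_fderiv {f : ℂ × ℂ → ℂ} (hf : AnalyticAt ℂ f 0) (h0 : f 0 = 0) {a : ℂ → ℂ × ℂ}
    {k : ℕ} (hk : 0 < k) (ha : VVan k a) :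
    Van (k + 1) (fun t => f (a t) - fderiv ℂ f 0 (a t)) := by
  have h : VVan k (fun t => a t - (fun _ => 0) t) := by simpa using ha
  have hz : VVan 1 (fun _ : ℂ => (0 : ℂ × ℂ)) := vvan_one analyticAt_const rfl
  simpa [h0] using van_sub_sub_fderiv hf (ha.mono hk) hz h

/-- `γ` is a branch in Puiseux form with respect to the coordinates `coordX δ`, `coordY δ`;
`q` is the slope `dY / dX` along the branch. -/
structure PBranch (δ : TangentCase) (γ : ℂ → ℂ × ℂ) (m : ℕ) (q : ℂ → ℂ) : Prop where
  m_pos : 0 < m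
  X_eq : (fun t => coordX δ (γ t)) =ᶠ[𝓝 0] fun t => t ^ m
  Y_van : Van (m + 1) (fun t => coordY δ (γ t))
  q_van : Van 1 q
  slope : deriv (fun t => coordY δ (γ t)) =ᶠ[𝓝 0]
    fun t => q t * deriv (fun t => coordX δ (γ t)) t

theorem PBranch.X_van {δ : TangentCase} {γ : ℂ → ℂ × ℂ} {m : ℕ} {q : ℂ → ℂ}
    (h : PBranch δ γ m q) : Van m (fun t => coordX δ (γ t)) := (van_pow m).congr h.X_eq.symm

theorem PBranch.vvan {δ : TangentCase} {γ : ℂ → ℂ × ℂ} {m : ℕ} {q : ℂ → ℂ}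
    (h : PBranch δ γ m q) : VVan m γ :=
  VVan.of_coord δ h.X_van (h.Y_van.mono (Nat.le_succ m))

theorem PBranch.vvan_one {δ : TangentCase} {γ : ℂ → ℂ × ℂ} {m : ℕ} {q : ℂ → ℂ}
    (h : PBranch δ γ m q) : VVan 1 γ := h.vvan.mono h.m_pos

/-- Y has order above m, so Y′ is divisible by t^m, while X′ = m t^(m−1); the quotient is analytic
and vanishes at 0. -/
theorem exists_pBranch {δ : TangentCase} {γ : ℂ → ℂ × ℂ} {m : ℕ} (hm : 0 < m)
    (hX : (fun t => coordX δ (γ t)) =ᶠ[𝓝 0] fun t => t ^ m)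
    (hY : Van (m + 1) (fun t => coordY δ (γ t))) : ∃ q, PBranch δ γ m q := by
  obtain ⟨g, hg, e⟩ := hY.deriv.exists_eq
  refine ⟨fun t => t * g t * (m : ℂ)⁻¹, hm, hX, hY, ?_, ?_⟩
  · exact (van_id.mul_right hg).mul_right analyticAt_const
  · filter_upwards [e, hX.deriv] with t h1 h2
    rw [h1, h2, deriv_pow_field]
    obtain ⟨m, rfl⟩ := Nat.exists_eq_succ_of_ne_zero hm.ne'
    have : ((m : ℂ) + 1) ≠ 0 := by exact_mod_cast Nat.succ_ne_zero m
    push_cast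
    field_simp
    simp only [Nat.succ_eq_add_one]
    ring

/-- The tangent vector `(0, h)` to the space of Puiseux forms induced by the vector field `η`. -/
noncomputable def normalPart (δ : TangentCase) (γ : ℂ → ℂ × ℂ) (q : ℂ → ℂ) (η : ℂ × ℂ → ℂ × ℂ) :
    ℂ → ℂ :=
  fun t => coordY δ (η (γ t)) - coordX δ (η (γ t)) * q t

/-! ### From automorphisms to vector fields -/

/-- The (truncated) logarithm of a self-map of the plane. -/
noncomputable def logField (K : ℕ) (σ : ℂ × ℂ → ℂ × ℂ) : ℂ × ℂ → ℂ × ℂ :=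
  fun z => (logOp K σ Prod.fst z, logOp K σ Prod.snd z)

theorem coordX_logField (δ : TangentCase) (K : ℕ) (σ : ℂ × ℂ → ℂ × ℂ) (z : ℂ × ℂ) :
    coordX δ (logField K σ z) = logOp K σ (coordX δ) z := by cases δ <;> rfl

theorem coordY_logField (δ : TangentCase) (K : ℕ) (σ : ℂ × ℂ → ℂ × ℂ) (z : ℂ × ℂ) :
    coordY δ (logField K σ z) = logOp K σ (coordY δ) z := by cases δ <;> rfl

theorem analyticAt_compSub {σ : ℂ × ℂ → ℂ × ℂ} (hσ : AnalyticAt ℂ σ 0) (h0 : σ 0 = 0)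
    {f : ℂ × ℂ → ℂ} (hf : AnalyticAt ℂ f 0) : AnalyticAt ℂ (compSub σ f) 0 :=
  (AnalyticAt.comp_zero hf hσ h0).sub hf

theorem analyticAt_compSub_pow {σ : ℂ × ℂ → ℂ × ℂ} (hσ : AnalyticAt ℂ σ 0) (h0 : σ 0 = 0)
    {f : ℂ × ℂ → ℂ} (hf : AnalyticAt ℂ f 0) (i : ℕ) : AnalyticAt ℂ ((compSub σ ^ i) f) 0 := by
  induction i with
  | zero => exact hf
  | succ i ih =>
    rw [pow_succ', Module.End.mul_apply]
    exact analyticAt_compSub hσ h0 ih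

theorem fderiv_compSub {σ : ℂ × ℂ → ℂ × ℂ} (hσ : AnalyticAt ℂ σ 0) (h0 : σ 0 = 0)
    {f : ℂ × ℂ → ℂ} (hf : AnalyticAt ℂ f 0) (v : ℂ × ℂ) :
    fderiv ℂ (compSub σ f) 0 v = fderiv ℂ f 0 (fderiv ℂ σ 0 v - v) := by
  have h1 : HasFDerivAt f (fderiv ℂ f 0) (σ 0) := by
    rw [h0]; exact hf.differentiableAt.hasFDerivAt
  have h2 := (h1.comp 0 hσ.differentiableAt.hasFDerivAt).sub hf.differentiableAt.hasFDerivAt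
  have h3 : HasFDerivAt (compSub σ f) ((fderiv ℂ f 0).comp (fderiv ℂ σ 0) - fderiv ℂ f 0) 0 := h2
  rw [h3.fderiv]
  simp

/-- If ℓ is invariant under the linear part of `σ`, then `compSub σ ℓ` has zero differential, and
further applications preserve this. For `coordY` only the first term of the logarithm then has a
nonzero linear contribution. -/
theorem fderiv_compSub_pow {σ : ℂ × ℂ → ℂ × ℂ} (hσ : AnalyticAt ℂ σ 0) (h0 : σ 0 = 0)
    (ℓ : ℂ × ℂ →L[ℂ] ℂ) (hℓ : ∀ v, ℓ (fderiv ℂ σ 0 v) = ℓ v) (i : ℕ) (v : ℂ × ℂ) :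
    fderiv ℂ ((compSub σ ^ (i + 1)) ℓ) 0 v = 0 := by
  induction i generalizing v with
  | zero =>
    rw [zero_add, pow_one, fderiv_compSub hσ h0 (ℓ.analyticAt 0), ContinuousLinearMap.fderiv,
      map_sub, hℓ, sub_self]
  | succ i ih =>
    rw [pow_succ', Module.End.mul_apply,
      fderiv_compSub hσ h0 (analyticAt_compSub_pow hσ h0 (ℓ.analyticAt 0) _), ih]

section LogStep

variable {δ : TangentCase} {σ : ℂ × ℂ → ℂ × ℂ} {γ γ' : ℂ → ℂ × ℂ} {ρ : ℂ → ℂ} {k : ℕ} {d : ℂ}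

/-- Replaces γ′ by γ: the two differ by d t^k in the direction of Y, and ρ^k = t^k modulo t^(k+1).
-/
theorem vvan_comp_sub_comp (hρ : Tangent ρ)
    (h : VVan (k + 1) (fun t => σ (γ t) - γ' (ρ t)))
    (hX : Van (k + 1) (fun t => coordX δ (γ' t) - coordX δ (γ t)))
    (hY : Van (k + 1) (fun t => coordY δ (γ' t) - coordY δ (γ t) - d * t ^ k)) :
    VVan (k + 1) (fun t => σ (γ t) - γ (ρ t) - (d * t ^ k) • vecY δ) := by
  have h1 : VVan (k + 1) (fun t => γ' t - γ t - (d * t ^ k) • vecY δ) :=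
    VVan.of_coord δ (hX.congr (Eventually.of_forall fun t => by simp))
      (hY.congr (Eventually.of_forall fun t => by simp))
  have h2 : VVan (k + 1) (fun t => (d * (ρ t ^ k - t ^ k)) • vecY δ) :=
    Van.smul_vec ((hρ.pow_sub k).const_mul d) _
  refine ((h.add (h1.comp hρ.van)).add h2).congr (Eventually.of_forall fun t => ?_)
  simp only [mul_sub, sub_smul]
  abel

theorem van_comp_error (hσ : AnalyticAt ℂ σ 0) (h0 : σ 0 = 0) (hγ : VVan 1 γ) (hρ : Tangent ρ)
    (h : VVan (k + 1) (fun t => σ (γ t) - γ (ρ t) - (d * t ^ k) • vecY δ))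
    {f : ℂ × ℂ → ℂ} (hf : AnalyticAt ℂ f 0) :
    Van (k + 1) (fun t => f (σ (γ t)) - f (γ (ρ t)) - fderiv ℂ f 0 (vecY δ) * (d * t ^ k)) := by
  have hγ0 := hγ.apply_zero one_pos
  have ha : VVan 1 (fun t => σ (γ t)) :=
    TwoBranches.vvan_one (AnalyticAt.comp_zero hσ hγ.analytic hγ0) (by simp [hγ0, h0])
  have hk : VVan k (fun t => σ (γ t) - γ (ρ t)) := by
    refine ((h.mono (Nat.le_succ k)).add
      (Van.smul_vec ((van_pow k).const_mul d) (vecY δ))).congr (Eventually.of_forall fun t => ?_)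
    simp
  refine ((van_sub_sub_fderiv hf ha (hγ.comp hρ.van) hk).add (h (fderiv ℂ f 0))).congr
    (Eventually.of_forall fun t => ?_)
  simp only [map_sub, map_smul, smul_eq_mul]
  ring

/-- γ intertwines `compSub σ` and `compSub ρ` up to an error of order k. Each further application of
`compSub ρ` to this error gains an order, so modulo t^(k+1) only the outermost application of
`compSub σ` contributes. -/
theorem van_compSub_pow_comp (hσ : AnalyticAt ℂ σ 0) (h0 : σ 0 = 0) (hγ : VVan 1 γ)
    (hρ : Tangent ρ) (h : VVan (k + 1) (fun t => σ (γ t) - γ (ρ t) - (d * t ^ k) • vecY δ))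
    (i : ℕ) {f : ℂ × ℂ → ℂ} (hf : AnalyticAt ℂ f 0) :
    Van (k + 1) (fun t => (compSub σ ^ (i + 1)) f (γ t) -
      (compSub ρ ^ (i + 1)) (fun t => f (γ t)) t -
      fderiv ℂ ((compSub σ ^ i) f) 0 (vecY δ) * (d * t ^ k)) := by
  induction i generalizing f with
  | zero =>
    refine (van_comp_error hσ h0 hγ hρ h hf).congr (Eventually.of_forall fun t => ?_)
    simp
  | succ i ih =>
    have hE := van_comp_error hσ h0 hγ hρ h hf
    have hE' : Van k (fun t => f (σ (γ t)) - f (γ (ρ t))) := by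
      refine ((hE.mono (Nat.le_succ k)).add ((van_pow k).const_mul
        (fderiv ℂ f 0 (vecY δ) * d))).congr (Eventually.of_forall fun t => ?_)
      ring
    have h1 := (hρ.van_compSub_pow hE' (i + 1)).mono (show k + 1 ≤ k + (i + 1) by omega)
    refine ((ih (analyticAt_compSub hσ h0 hf)).add h1).congr (Eventually.of_forall fun t => ?_)
    have e : (fun t => compSub σ f (γ t)) =
        compSub ρ (fun t => f (γ t)) + fun t => f (σ (γ t)) - f (γ (ρ t)) := by
      funext t; simp
    rw [pow_succ (compSub σ) (i + 1), pow_succ (compSub σ) i, pow_succ (compSub ρ) (i + 1)]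
    simp only [Module.End.mul_apply]
    rw [e, map_add]
    simp only [Pi.add_apply]
    ring

/-- If `(ρ, σ)` moves the branch `γ` to a branch `γ'` in Puiseux form that agrees with `γ` up to
order `k`, then the difference in degree `k` is the normal part of the logarithm of `σ`. -/
theorem log_step {m : ℕ} {q : ℂ → ℂ} (hk : 0 < k) (hσ : AnalyticAt ℂ σ 0) (h0 : σ 0 = 0)
    (hlin : ∀ v, coordY δ (fderiv ℂ σ 0 v) = coordY δ v) (hγ : PBranch δ γ m q)
    (hρ : Tangent ρ) (h : VVan (k + 1) (fun t => σ (γ t) - γ' (ρ t)))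
    (hX : Van (k + 1) (fun t => coordX δ (γ' t) - coordX δ (γ t)))
    (hY : Van (k + 1) (fun t => coordY δ (γ' t) - coordY δ (γ t) - d * t ^ k)) :
    Van (k + 1) (fun t => normalPart δ γ q (logField k σ) t - d * t ^ k) := by
  have hΔ := vvan_comp_sub_comp hρ h hX hY
  have hpow := fun (ℓ : ℂ × ℂ →L[ℂ] ℂ) i =>
    van_compSub_pow_comp hσ h0 hγ.vvan_one hρ hΔ i (f := ℓ) (ℓ.analyticAt 0)
  have hlog : ∀ {α : Type} (τ : α → α) (f : α → ℂ) (z : α), logOp k τ f z =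
      ∑ i ∈ Finset.range k, logCoeff (i + 1) * ((compSub τ) ^ (i + 1)) f z := by
    intro α τ f z
    rw [logOp_apply, Finset.sum_range_succ']
    simp [logCoeff]
  have hYlog : Van (k + 1) (fun t => logOp k σ (coordY δ) (γ t) -
      logOp k ρ (fun t => coordY δ (γ t)) t - d * t ^ k) := by
    have := van_sum (Finset.range k) fun i _ => (hpow (coordY δ) i).const_mul (logCoeff (i + 1))
    refine this.congr (Eventually.of_forall fun t => ?_)
    -- Only i = 0 survives, with logarithmic coefficient 1, because `σ` preserves Y to first order.
    have e : ∑ i ∈ Finset.range k, logCoeff (i + 1) *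
        (fderiv ℂ ((compSub σ ^ i) (coordY δ)) 0 (vecY δ) * (d * t ^ k)) = d * t ^ k := by
      obtain ⟨n, rfl⟩ := Nat.exists_eq_succ_of_ne_zero hk.ne'
      rw [Finset.sum_range_succ']
      simp only [fderiv_compSub_pow hσ h0 (coordY δ) hlin]
      simp [logCoeff]
    simp only [hlog, mul_sub, Finset.sum_sub_distrib, e]
  -- Order k + 1 may fail here, since X need not be preserved by the linear part of `σ`. The missing
  -- order comes from the factor q, which vanishes at 0.
  have hXlog : Van k (fun t => logOp k σ (coordX δ) (γ t) -
      logOp k ρ (fun t => coordX δ (γ t)) t) := by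
    have h1 := (van_sum (Finset.range k) fun i _ =>
      (hpow (coordX δ) i).const_mul (logCoeff (i + 1))).mono (Nat.le_succ k)
    have h2 : Van k (fun t => ∑ i ∈ Finset.range k, logCoeff (i + 1) *
        (fderiv ℂ ((compSub σ ^ i) (coordX δ)) 0 (vecY δ) * (d * t ^ k))) :=
      van_sum _ fun i _ => (((van_pow k).const_mul d).const_mul _).const_mul _
    refine (h1.add h2).congr (Eventually.of_forall fun t => ?_)
    simp only [hlog, mul_sub, Finset.sum_sub_distrib]
    ring
  -- On the branch, the logarithm of `ρ` acts on X and Y as one and the same vector field in t, so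
  -- these contributions cancel in Y − q X by the definition of the slope.
  have hDX := hρ.logOp_eq hγ.X_van.1 k
  have hDY := hρ.logOp_eq hγ.Y_van.1 k
  have hqX := hγ.q_van.mul hXlog
  rw [add_comm 1 k] at hqX
  have hqD := hDX.mul_left hγ.q_van.1
  refine (((hYlog.add hDY).sub hqX).sub hqD).congr ?_
  filter_upwards [hγ.slope] with t ht
  simp only [normalPart, coordX_logField, coordY_logField]
  rw [ht]
  ring

end LogStep

/-! ### Local inverses and Puiseux parametrizations -/

theorem exists_germAut {E : Type} [NormedAddCommGroup E] [NormedSpace ℂ E] [CompleteSpace E]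
    {f : E → E} (hf : AnalyticAt ℂ f 0) (h0 : f 0 = 0) (i : E ≃L[ℂ] E)
    (hi : fderiv ℂ f 0 = i) : ∃ g : GermAut E, g.toFun = f := by
  have hs : HasStrictFDerivAt f (i : E →L[ℂ] E) 0 := hi ▸ hf.hasStrictFDerivAt
  set R := hs.toOpenPartialHomeomorph f with hR
  have hsrc : (0 : E) ∈ R.source := hs.mem_toOpenPartialHomeomorph_source
  have hcoe : (R : E → E) = f := hs.toOpenPartialHomeomorph_coe
  have hR0 : R 0 = 0 := by rw [hcoe, h0]
  have hsymm : AnalyticAt ℂ R.symm 0 := by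
    have := R.analyticAt_symm' hsrc (by rw [hcoe]; exact hf) (by rw [hcoe]; exact hi)
    rwa [hR0] at this
  have htgt : (0 : E) ∈ R.target := by have := R.map_source hsrc; rwa [hR0] at this
  refine ⟨⟨f, R.symm, hf, hsymm, h0, ?_, ?_, ?_⟩, rfl⟩
  · have := R.left_inv hsrc; rwa [hR0] at this
  · filter_upwards [R.open_source.mem_nhds hsrc] with z hz
    have := R.left_inv hz; rwa [hcoe] at this
  · filter_upwards [R.open_target.mem_nhds htgt] with z hz
    have := R.right_inv hz; rwa [hcoe] at this

theorem GermAut.tendsto_toFun {E : Type} [NormedAddCommGroup E] [NormedSpace ℂ E]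
    (g : GermAut E) : Tendsto g.toFun (𝓝 0) (𝓝 0) :=
  tendsto_zero_of_analytic g.analytic_toFun g.toFun_zero

theorem GermAut.tendsto_invFun {E : Type} [NormedAddCommGroup E] [NormedSpace ℂ E]
    (g : GermAut E) : Tendsto g.invFun (𝓝 0) (𝓝 0) :=
  tendsto_zero_of_analytic g.analytic_invFun g.invFun_zero

theorem GermAut.fderiv_comp_inv {E : Type} [NormedAddCommGroup E] [NormedSpace ℂ E]
    (g : GermAut E) (v : E) : fderiv ℂ g.toFun 0 (fderiv ℂ g.invFun 0 v) = v := by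
  have h1 : HasFDerivAt g.toFun (fderiv ℂ g.toFun 0) (g.invFun 0) := by
    rw [g.invFun_zero]; exact g.analytic_toFun.differentiableAt.hasFDerivAt
  have h2 := h1.comp 0 g.analytic_invFun.differentiableAt.hasFDerivAt
  have h3 : HasFDerivAt (g.toFun ∘ g.invFun) (ContinuousLinearMap.id ℂ E) 0 :=
    (hasFDerivAt_id 0).congr_of_eventuallyEq g.right_inv
  exact congrArg (fun L : E →L[ℂ] E => L v) (h2.unique h3)

theorem GermAut.tangent_inv (g : GermAut ℂ) (h : Tangent g.toFun) : Tangent g.invFun := by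
  refine tangent_of_deriv g.analytic_invFun g.invFun_zero ?_
  have := g.fderiv_comp_inv 1
  rw [fderiv_apply_one_eq_deriv, fderiv_eq_smul_deriv, h.deriv_eq] at this
  simpa using this

theorem Tangent.exists_germAut {ρ : ℂ → ℂ} (h : Tangent ρ) : ∃ g : GermAut ℂ, g.toFun = ρ := by
  refine TwoBranches.exists_germAut h.van.1 (h.van.apply_zero one_pos)
    (ContinuousLinearEquiv.refl ℂ ℂ) ?_
  ext
  rw [fderiv_apply_one_eq_deriv, h.deriv_eq]
  rfl

/-- A = t^m (1 + t g), and the second factor has the m-th root exp(log(1 + t g) / m), equal to 1 at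
the origin. -/
theorem exists_root {m : ℕ} (hm : 0 < m) {A : ℂ → ℂ} (hA : Van (m + 1) (fun t => A t - t ^ m)) :
    ∃ ρ, Tangent ρ ∧ A =ᶠ[𝓝 0] fun t => ρ t ^ m := by
  obtain ⟨g, hg, e⟩ := hA.exists_eq
  have hw : AnalyticAt ℂ (fun t => 1 + t * g t) 0 := by fun_prop
  have hlog : AnalyticAt ℂ (fun t => Complex.log (1 + t * g t)) 0 :=
    hw.clog (by simp)
  have hroot : AnalyticAt ℂ (fun t => Complex.exp (Complex.log (1 + t * g t) * (m : ℂ)⁻¹)) 0 :=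
    (hlog.mul analyticAt_const).cexp
  refine ⟨fun t => t * Complex.exp (Complex.log (1 + t * g t) * (m : ℂ)⁻¹), ?_, ?_⟩
  · have h1 : Van 1 (fun t => Complex.exp (Complex.log (1 + t * g t) * (m : ℂ)⁻¹) - 1) := by
      rw [van_one_iff (hroot.fun_sub analyticAt_const)]
      simp
    exact (van_id.mul h1).congr (Eventually.of_forall fun t => by ring)
  · have hne : ∀ᶠ t in 𝓝 (0 : ℂ), 1 + t * g t ≠ 0 :=
      hw.continuousAt.eventually_ne (by simp)
    filter_upwards [e, hne] with t ht hne
    have hm' : (m : ℂ) ≠ 0 := by exact_mod_cast hm.ne'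
    rw [mul_pow, ← Complex.exp_nat_mul,
      show (m : ℂ) * (Complex.log (1 + t * g t) * (m : ℂ)⁻¹) = Complex.log (1 + t * g t) by
        field_simp, Complex.exp_log hne]
    linear_combination ht

theorem van_comp_sub_comp {v a b : ℂ → ℂ} (hv : AnalyticAt ℂ v 0) (ha : Van 1 a) (hb : Van 1 b)
    {n : ℕ} (hab : Van n (fun t => a t - b t)) : Van n (fun t => v (a t) - v (b t)) := by
  have ha0 := ha.apply_zero one_pos
  have hb0 := hb.apply_zero one_pos
  refine van_of_isBigO ((AnalyticAt.comp_zero hv ha.1 ha0).sub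
    (AnalyticAt.comp_zero hv hb.1 hb0)) ?_
  have ht : Tendsto (fun t => (a t, b t)) (𝓝 0) (𝓝 ((0 : ℂ), (0 : ℂ))) :=
    (tendsto_zero_of_analytic ha.1 ha0).prodMk_nhds (tendsto_zero_of_analytic hb.1 hb0)
  have hs := (hv.hasStrictFDerivAt).isBigO_sub.comp_tendsto ht
  exact hs.trans hab.isBigO

/-- A function of high order changes little if the parameter is changed little. -/
theorem van_comp_sub_of_pow {m k : ℕ} (hm : 0 < m) {ρ ρ' g : ℂ → ℂ} (hρ : Tangent ρ)
    (hρ' : Tangent ρ') (h : Van k (fun t => ρ' t ^ m - ρ t ^ m)) (hg : Van (m + 1) g) :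
    Van (k + 1) (fun t => g (ρ' t) - g (ρ t)) := by
  have hs : AnalyticAt ℂ (fun t => ρ' t - ρ t) 0 := hρ'.van.1.sub hρ.van.1
  -- The quotient of ρ′^m − ρ^m by ρ′ − ρ is m t^(m−1) to leading order, so ρ′ − ρ vanishes to order
  -- at least k − (m − 1).
  have hS : Van (m - 1 + 1) (fun t => ∑ i ∈ Finset.range m, ρ' t ^ i * ρ t ^ (m - 1 - i) -
      (m : ℂ) * t ^ (m - 1)) := by
    have : Van m (fun t => ∑ i ∈ Finset.range m, (ρ' t ^ i * ρ t ^ (m - 1 - i) - t ^ (m - 1))) := by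
      refine van_sum _ fun i hi => ?_
      have hi' : i < m := Finset.mem_range.1 hi
      have h1 := (hρ'.pow_sub i).mul (hρ.van.pow (m - 1 - i))
      have h2 := (van_pow i).mul (hρ.pow_sub (m - 1 - i))
      refine ((h1.mono (show m ≤ _ by omega)).add (h2.mono (by omega))).congr
        (Eventually.of_forall fun t => ?_)
      have : t ^ (m - 1) = t ^ i * t ^ (m - 1 - i) := by rw [← pow_add]; congr 1; omega
      simp only [this]
      ring
    rw [Nat.sub_add_cancel hm]
    exact this.congr (Eventually.of_forall fun t => by simp [Finset.sum_sub_distrib])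
  have hordS := ord_eq_of_van_sub hS (by exact_mod_cast hm.ne')
  have hSa : AnalyticAt ℂ (fun t => ∑ i ∈ Finset.range m, ρ' t ^ i * ρ t ^ (m - 1 - i)) 0 :=
    Finset.analyticAt_fun_sum _ fun i _ => (hρ'.van.1.pow i).mul (hρ.van.1.pow _)
  have hprod : ord (fun t => (∑ i ∈ Finset.range m, ρ' t ^ i * ρ t ^ (m - 1 - i)) *
      (ρ' t - ρ t)) = (m - 1 : ℕ) + ord (fun t => ρ' t - ρ t) := by
    rw [ord_mul hSa hs, hordS]
  simp only [geom_sum₂_mul] at hprod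
  have hk := h.2
  rw [hprod] at hk
  -- If the two germs agree, the order is infinite and n = k serves.
  obtain ⟨n, hn, hkn⟩ : ∃ n, Van n (fun t => ρ' t - ρ t) ∧ k ≤ (m - 1) + n := by
    by_cases htop : ord (fun t => ρ' t - ρ t) = ⊤
    · exact ⟨k, ⟨hs, by rw [htop]; exact le_top⟩, by omega⟩
    · obtain ⟨n, hn⟩ := ENat.ne_top_iff_exists.1 htop
      rw [← hn] at hk
      exact ⟨n, ⟨hs, hn.le⟩, by exact_mod_cast hk⟩
  obtain ⟨v, hv, e⟩ := hg.exists_eq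
  have hρ0 := hρ.van.apply_zero one_pos
  have hρ0' := hρ'.van.apply_zero one_pos
  -- Here m + n ≥ k + 1: the order m + 1 of g, one more than m, yields the extra order in the
  -- conclusion.
  have h1 : Van (m + n) (fun t => ρ' t ^ (m + 1) - ρ t ^ (m + 1)) := by
    have : Van m (fun t => ∑ i ∈ Finset.range (m + 1), ρ' t ^ i * ρ t ^ (m + 1 - 1 - i)) := by
      refine van_sum _ fun i hi => ?_
      have hi' : i < m + 1 := Finset.mem_range.1 hi
      exact ((hρ'.van.pow i).mul (hρ.van.pow (m + 1 - 1 - i))).mono (by omega)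
    exact (this.mul hn).congr (Eventually.of_forall fun t => geom_sum₂_mul _ _ _)
  have h2 := (hρ.van.pow (m + 1)).mul (van_comp_sub_comp hv hρ'.van hρ.van hn)
  have h3 := h1.mul_right (AnalyticAt.comp_zero hv hρ'.van.1 hρ0')
  refine ((h3.mono (by omega)).add (h2.mono (by omega))).congr ?_
  filter_upwards [e.comp_tendsto (tendsto_zero_of_analytic hρ.van.1 hρ0),
    e.comp_tendsto (tendsto_zero_of_analytic hρ'.van.1 hρ0')] with t ht ht'
  simp only [Function.comp_apply] at ht ht'
  rw [ht, ht']
  ring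

/-! ### From vector fields to automorphisms -/

/-- The derivative of `f` along the vector field `η`. -/
noncomputable def vecD (η : ℂ × ℂ → ℂ × ℂ) (f : ℂ × ℂ → ℂ) : ℂ × ℂ → ℂ :=
  fun z => fderiv ℂ f z (η z)

/-- The (truncated) exponential of a vector field of the plane. -/
noncomputable def expField (K : ℕ) (η : ℂ × ℂ → ℂ × ℂ) : ℂ × ℂ → ℂ × ℂ := fun z =>
  (∑ i ∈ Finset.range (K + 1), (i.factorial : ℂ)⁻¹ * (vecD η)^[i] Prod.fst z,
    ∑ i ∈ Finset.range (K + 1), (i.factorial : ℂ)⁻¹ * (vecD η)^[i] Prod.snd z)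

theorem coordX_expField (δ : TangentCase) (K : ℕ) (η : ℂ × ℂ → ℂ × ℂ) (z : ℂ × ℂ) :
    coordX δ (expField K η z) =
      ∑ i ∈ Finset.range (K + 1), (i.factorial : ℂ)⁻¹ * (vecD η)^[i] (coordX δ) z := by
  cases δ <;> rfl

theorem coordY_expField (δ : TangentCase) (K : ℕ) (η : ℂ × ℂ → ℂ × ℂ) (z : ℂ × ℂ) :
    coordY δ (expField K η z) =
      ∑ i ∈ Finset.range (K + 1), (i.factorial : ℂ)⁻¹ * (vecD η)^[i] (coordY δ) z := by
  cases δ <;> rfl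

theorem analyticAt_clm_apply {E F G : Type*} [NormedAddCommGroup E] [NormedSpace ℂ E]
    [NormedAddCommGroup F] [NormedSpace ℂ F] [NormedAddCommGroup G] [NormedSpace ℂ G]
    {L : E → F →L[ℂ] G} {v : E → F} {x : E} (hL : AnalyticAt ℂ L x) (hv : AnalyticAt ℂ v x) :
    AnalyticAt ℂ (fun z => L z (v z)) x :=
  ((ContinuousLinearMap.id ℂ (F →L[ℂ] G)).analyticAt_bilinear (L x, v x)).comp₂ hL hv

section VecD

variable {η : ℂ × ℂ → ℂ × ℂ} {f : ℂ × ℂ → ℂ}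

theorem analyticAt_vecD (hη : AnalyticAt ℂ η 0) (hf : AnalyticAt ℂ f 0) :
    AnalyticAt ℂ (vecD η f) 0 := analyticAt_clm_apply hf.fderiv hη

theorem analyticAt_vecD_iterate (hη : AnalyticAt ℂ η 0) (hf : AnalyticAt ℂ f 0) (i : ℕ) :
    AnalyticAt ℂ ((vecD η)^[i] f) 0 := by
  induction i with
  | zero => exact hf
  | succ i ih =>
    rw [Function.iterate_succ_apply']
    exact analyticAt_vecD hη ih

theorem fderiv_vecD (hη : AnalyticAt ℂ η 0) (h0 : η 0 = 0) (hf : AnalyticAt ℂ f 0) (v : ℂ × ℂ) :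
    fderiv ℂ (vecD η f) 0 v = fderiv ℂ f 0 (fderiv ℂ η 0 v) := by
  have := (hf.fderiv.differentiableAt.hasFDerivAt).clm_apply hη.differentiableAt.hasFDerivAt
  have h2 : fderiv ℂ (vecD η f) 0 = _ := this.fderiv
  rw [h2]
  simp [h0]

theorem fderiv_vecD_iterate (hη : AnalyticAt ℂ η 0) (h0 : η 0 = 0) (ℓ : ℂ × ℂ →L[ℂ] ℂ) (i : ℕ)
    (v : ℂ × ℂ) : fderiv ℂ ((vecD η)^[i] ℓ) 0 v = ℓ ((fderiv ℂ η 0)^[i] v) := by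
  induction i generalizing v with
  | zero => simp
  | succ i ih =>
    rw [Function.iterate_succ_apply', fderiv_vecD hη h0
      (analyticAt_vecD_iterate hη (ℓ.analyticAt 0) i), ih, Function.iterate_succ_apply]

theorem vecD_iterate_zero (h0 : η 0 = 0) (ℓ : ℂ × ℂ →L[ℂ] ℂ) (i : ℕ) :
    (vecD η)^[i] ℓ 0 = 0 := by
  cases i with
  | zero => simp
  | succ i => rw [Function.iterate_succ_apply']; simp [vecD, h0]

end VecD

section ExpStep

variable {δ : TangentCase} {η : ℂ × ℂ → ℂ × ℂ} {γ : ℂ → ℂ × ℂ} {q : ℂ → ℂ} {m k : ℕ} {d b : ℂ}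

/-- The vector field of the parameter that keeps the branch in Puiseux form. -/
theorem exists_reparam_field (hη : AnalyticAt ℂ η 0) (h0 : η 0 = 0)
    (hX : ∀ v, coordX δ (fderiv ℂ η 0 v) = b * coordY δ v) (hγ : PBranch δ γ m q) :
    ∃ ε, Van 2 ε ∧ (fun t => coordX δ (η (γ t))) =ᶠ[𝓝 0]
      fun t => ε t * deriv (fun t => coordX δ (γ t)) t := by
  have hXη : AnalyticAt ℂ (fun z => coordX δ (η z)) 0 :=
    ((coordX δ).analyticAt _).fun_comp hη
  have hfd : ∀ v, fderiv ℂ (fun z => coordX δ (η z)) 0 v = b * coordY δ v := by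
    intro v
    have := (coordX δ).hasFDerivAt.comp (0 : ℂ × ℂ) hη.differentiableAt.hasFDerivAt
    have h2 : fderiv ℂ (fun z => coordX δ (η z)) 0 = _ := this.fderiv
    rw [h2]
    simpa using hX v
  have h1 := van_sub_fderiv hXη (by simp [h0]) hγ.m_pos hγ.vvan
  -- The linear part of X(η) is b Y, and Y has order above m along the branch. Division by X′ = m
  -- t^(m−1) then leaves a field of order at least 2.
  have h2 : Van (m + 1) (fun t => coordX δ (η (γ t))) := by
    refine (h1.add (hγ.Y_van.const_mul b)).congr (Eventually.of_forall fun t => ?_)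
    simp [hfd]
  obtain ⟨g, hg, e⟩ := h2.exists_eq
  refine ⟨fun t => t ^ 2 * (g t * (m : ℂ)⁻¹), (van_pow 2).mul_right (hg.mul analyticAt_const), ?_⟩
  filter_upwards [e, hγ.X_eq.deriv] with t ht ht'
  rw [ht, ht', deriv_pow_field]
  obtain ⟨m, rfl⟩ := Nat.exists_eq_succ_of_ne_zero hγ.m_pos.ne'
  have : ((m : ℂ) + 1) ≠ 0 := by exact_mod_cast Nat.succ_ne_zero m
  push_cast
  field_simp
  simp only [Nat.succ_eq_add_one]
  ring

/-- Along the branch η is ε times the velocity plus the normal part times `vecY δ`: the X components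
agree by the choice of ε, and the slope accounts for the Y components. -/
theorem vecD_comp {ε : ℂ → ℂ} (hγ : PBranch δ γ m q)
    (hε : (fun t => coordX δ (η (γ t))) =ᶠ[𝓝 0]
      fun t => ε t * deriv (fun t => coordX δ (γ t)) t)
    {f : ℂ × ℂ → ℂ} (hf : AnalyticAt ℂ f 0) :
    (fun t => vecD η f (γ t)) =ᶠ[𝓝 0] fun t => lieD ε (fun t => f (γ t)) t +
      fderiv ℂ f (γ t) (vecY δ) * normalPart δ γ q η t := by
  have hγ0 := hγ.vvan_one.apply_zero one_pos
  have ht : Tendsto γ (𝓝 0) (𝓝 0) := tendsto_zero_of_analytic hγ.vvan_one.analytic hγ0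
  filter_upwards [hε, hγ.slope, ht.eventually hf.eventually_analyticAt,
    hγ.vvan_one.analytic.eventually_analyticAt] with t h1 h2 h3 h4
  have hd : HasDerivAt (fun t => f (γ t)) (fderiv ℂ f (γ t) (deriv γ t)) t :=
    h3.differentiableAt.hasFDerivAt.comp_hasDerivAt t h4.differentiableAt.hasDerivAt
  have hXd : deriv (fun t => coordX δ (γ t)) t = coordX δ (deriv γ t) :=
    ((coordX δ).hasFDerivAt.comp_hasDerivAt t h4.differentiableAt.hasDerivAt).deriv
  have hYd : deriv (fun t => coordY δ (γ t)) t = coordY δ (deriv γ t) :=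
    ((coordY δ).hasFDerivAt.comp_hasDerivAt t h4.differentiableAt.hasDerivAt).deriv
  rw [hXd] at h1 h2
  rw [hYd] at h2
  simp only [vecD, lieD, hd.deriv, normalPart]
  rw [map_coord_decomp δ _ (η (γ t)), map_coord_decomp δ _ (deriv γ t), h2, h1]
  ring

/-- Infinitesimal counterpart of `van_compSub_pow_comp`: the discrepancy between `vecD η` and `lieD
ε` along γ has order k, and every further `lieD ε` pushes it beyond degree k. -/
theorem van_vecD_iterate_comp {ε : ℂ → ℂ} (hη : AnalyticAt ℂ η 0) (hγ : PBranch δ γ m q)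
    (hε2 : Van 2 ε) (hε : (fun t => coordX δ (η (γ t))) =ᶠ[𝓝 0]
      fun t => ε t * deriv (fun t => coordX δ (γ t)) t)
    (h : Van (k + 1) (fun t => normalPart δ γ q η t - d * t ^ k)) (i : ℕ)
    {f : ℂ × ℂ → ℂ} (hf : AnalyticAt ℂ f 0) :
    Van (k + 1) (fun t => (vecD η)^[i + 1] f (γ t) -
      (lieD ε)^[i + 1] (fun t => f (γ t)) t -
      fderiv ℂ ((vecD η)^[i] f) 0 (vecY δ) * (d * t ^ k)) := by
  have hγ0 := hγ.vvan_one.apply_zero one_pos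
  have hγa := hγ.vvan_one.analytic
  have hEf : ∀ f : ℂ × ℂ → ℂ, AnalyticAt ℂ f 0 → Van (k + 1) (fun t =>
      fderiv ℂ f (γ t) (vecY δ) * normalPart δ γ q η t -
      fderiv ℂ f 0 (vecY δ) * (d * t ^ k)) := by
    intro f hf
    have ha : AnalyticAt ℂ (fun t => fderiv ℂ f (γ t) (vecY δ)) 0 :=
      analyticAt_clm_apply (AnalyticAt.comp_zero hf.fderiv hγa hγ0) analyticAt_const
    have h1 : Van 1 (fun t => fderiv ℂ f (γ t) (vecY δ) - fderiv ℂ f 0 (vecY δ)) := by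
      rw [van_one_iff (ha.fun_sub analyticAt_const)]
      simp [hγ0]
    have h2 := h1.mul ((van_pow k).const_mul d)
    rw [add_comm 1 k] at h2
    exact ((h.mul_left ha).add h2).congr (Eventually.of_forall fun t => by ring)
  induction i generalizing f with
  | zero =>
    refine (hEf f hf).congr ?_
    filter_upwards [vecD_comp hγ hε hf] with t ht
    simp [ht]
  | succ i ih =>
    have hE := hEf f hf
    have hEa : AnalyticAt ℂ (fun t => fderiv ℂ f (γ t) (vecY δ) * normalPart δ γ q η t) 0 := by
      have := hE.1.add (g := fun t => fderiv ℂ f 0 (vecY δ) * (d * t ^ k)) (by fun_prop)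
      exact this.congr (Eventually.of_forall fun t => by simp)
    have hE' : Van k (fun t => fderiv ℂ f (γ t) (vecY δ) * normalPart δ γ q η t) := by
      refine ((hE.mono (Nat.le_succ k)).add ((van_pow k).const_mul
        (fderiv ℂ f 0 (vecY δ) * d))).congr (Eventually.of_forall fun t => ?_)
      ring
    have h1 := (hε2.lieD_iterate hE' (i + 1)).mono (show k + 1 ≤ k + (i + 1) by omega)
    have hih := ih (analyticAt_vecD hη hf)
    have hfγ : AnalyticAt ℂ (fun t => f (γ t)) 0 := AnalyticAt.comp_zero hf hγa hγ0
    have hlie : AnalyticAt ℂ (lieD ε (fun t => f (γ t))) 0 :=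
      (hε2.lieD (van_zero_iff.2 hfγ)).1
    refine (hih.add h1).congr ?_
    filter_upwards [lieD_iterate_congr (vecD_comp hγ hε hf) (ε := ε) (i + 1),
      lieD_iterate_add hε2 hlie hEa (i + 1)] with t e1 e2
    rw [Function.iterate_succ_apply (vecD η) (i + 1), Function.iterate_succ_apply (vecD η) i f,
      Function.iterate_succ_apply (lieD ε) (i + 1)]
    rw [e1, e2]
    ring

/-- The exponential of a vector field moves a branch, up to reparametrization, by the normal part
of the vector field. -/
theorem exp_step_aux (hk : 0 < k) (hη : AnalyticAt ℂ η 0) (h0 : η 0 = 0)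
    (hX : ∀ v, coordX δ (fderiv ℂ η 0 v) = b * coordY δ v)
    (hY : ∀ v, coordY δ (fderiv ℂ η 0 v) = 0) (hγ : PBranch δ γ m q)
    (h : Van (k + 1) (fun t => normalPart δ γ q η t - d * t ^ k)) :
    ∃ ρ, Tangent ρ ∧
      Van k (fun t => coordX δ (expField k η (γ t)) - coordX δ (γ (ρ t))) ∧
      Van (k + 1) (fun t => coordY δ (expField k η (γ t)) - coordY δ (γ (ρ t)) - d * t ^ k) := by
  obtain ⟨ε, hε2, hε⟩ := exists_reparam_field hη h0 hX hγ
  refine ⟨expD k ε fun t => t, expD_tangent hε2 k, ?_, ?_⟩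
  · have h1 := van_sum (Finset.range k) fun i _ => (van_vecD_iterate_comp hη hγ hε2 hε h i
      (f := coordX δ) ((coordX δ).analyticAt 0)).const_mul (((i + 1).factorial : ℂ)⁻¹)
    have h2 : Van k (fun t => ∑ i ∈ Finset.range k, (((i + 1).factorial : ℂ)⁻¹) *
        (fderiv ℂ ((vecD η)^[i] (coordX δ)) 0 (vecY δ) * (d * t ^ k))) :=
      van_sum _ fun i _ => (((van_pow k).const_mul d).const_mul _).const_mul _
    have h3 := (expD_eq_comp hε2 hγ.X_van.1 k).mono (Nat.le_succ k)
    refine (((h1.mono (Nat.le_succ k)).add h2).add h3).congr (Eventually.of_forall fun t => ?_)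
    have e : ∀ u : ℂ → ℂ, expD k ε u t = ∑ i ∈ Finset.range k,
        ((i + 1).factorial : ℂ)⁻¹ * (lieD ε)^[i + 1] u t + u t := by
      intro u
      simp [expD, Finset.sum_range_succ']
    beta_reduce
    rw [e fun t => coordX δ (γ t)]
    simp only [coordX_expField, mul_sub, Finset.sum_sub_distrib]
    rw [Finset.sum_range_succ' _ k]
    simp only [Nat.factorial_zero, Nat.cast_one, inv_one, Function.iterate_zero, id, one_mul]
    ring
  · have h1 := van_sum (Finset.range k) fun i _ => (van_vecD_iterate_comp hη hγ hε2 hε h i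
      (f := coordY δ) ((coordY δ).analyticAt 0)).const_mul (((i + 1).factorial : ℂ)⁻¹)
    have h3 := expD_eq_comp hε2 hγ.Y_van.1 k
    refine (h1.add h3).congr (Eventually.of_forall fun t => ?_)
    have e : ∑ i ∈ Finset.range k, ((i + 1).factorial : ℂ)⁻¹ *
        (fderiv ℂ ((vecD η)^[i] (coordY δ)) 0 (vecY δ) * (d * t ^ k)) = d * t ^ k := by
      obtain ⟨n, rfl⟩ := Nat.exists_eq_succ_of_ne_zero hk.ne'
      rw [Finset.sum_range_succ']
      have : ∀ i, fderiv ℂ ((vecD η)^[i + 1] (coordY δ)) 0 (vecY δ) = 0 := by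
        intro i
        rw [fderiv_vecD_iterate hη h0, Function.iterate_succ_apply', hY]
      simp only [this]
      simp
    simp only [coordY_expField, mul_sub, Finset.sum_sub_distrib, e]
    rw [Finset.sum_range_succ' _ k]
    have : expD k ε (fun t => coordY δ (γ t)) t = ∑ i ∈ Finset.range k,
        ((i + 1).factorial : ℂ)⁻¹ * (lieD ε)^[i + 1] (fun t => coordY δ (γ t)) t +
        coordY δ (γ t) := by
      simp [expD, Finset.sum_range_succ']
    rw [this]
    simp only [Nat.factorial_zero, Nat.cast_one, inv_one, Function.iterate_zero, id, one_mul]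
    ring

end ExpStep

/-- After a change of coordinates, a branch has a Puiseux parametrization again. -/
theorem exists_puiseux_param {δ : TangentCase} {σ : ℂ × ℂ → ℂ × ℂ} {γ : ℂ → ℂ × ℂ} {m : ℕ}
    {q : ℂ → ℂ} {b : ℂ} (hσ : AnalyticAt ℂ σ 0) (h0 : σ 0 = 0)
    (hX : ∀ v, coordX δ (fderiv ℂ σ 0 v) = coordX δ v + b * coordY δ v)
    (hY : ∀ v, coordY δ (fderiv ℂ σ 0 v) = coordY δ v) (hγ : PBranch δ γ m q) :
    ∃ r : GermAut ℂ, Tangent r.toFun ∧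
      (fun t => coordX δ (σ (γ t))) =ᶠ[𝓝 0] (fun t => r.toFun t ^ m) ∧
      (fun t => coordX δ (σ (γ (r.invFun t)))) =ᶠ[𝓝 0] (fun t => t ^ m) ∧
      Van (m + 1) (fun t => coordY δ (σ (γ (r.invFun t)))) := by
  have hcomp : ∀ ℓ : ℂ × ℂ →L[ℂ] ℂ, AnalyticAt ℂ (fun z => ℓ (σ z)) 0 ∧
      ∀ v, fderiv ℂ (fun z => ℓ (σ z)) 0 v = ℓ (fderiv ℂ σ 0 v) := by
    intro ℓ
    refine ⟨(ℓ.analyticAt _).fun_comp hσ, fun v => ?_⟩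
    have := ℓ.hasFDerivAt.comp (0 : ℂ × ℂ) hσ.differentiableAt.hasFDerivAt
    have h2 : fderiv ℂ (fun z => ℓ (σ z)) 0 = _ := this.fderiv
    rw [h2]
    rfl
  have h1 := van_sub_fderiv (hcomp (coordX δ)).1 (by simp [h0]) hγ.m_pos hγ.vvan
  have h2 := van_sub_fderiv (hcomp (coordY δ)).1 (by simp [h0]) hγ.m_pos hγ.vvan
  simp only [(hcomp _).2, hX, hY] at h1 h2
  have hA : Van (m + 1) (fun t => coordX δ (σ (γ t)) - t ^ m) := by
    refine (h1.add (hγ.Y_van.const_mul b)).congr ?_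
    filter_upwards [hγ.X_eq] with t ht
    rw [ht]; ring
  have hB : Van (m + 1) (fun t => coordY δ (σ (γ t))) :=
    (h2.add hγ.Y_van).congr (Eventually.of_forall fun t => by ring)
  obtain ⟨ρ, hρ, e⟩ := exists_root hγ.m_pos hA
  obtain ⟨r, rfl⟩ := hρ.exists_germAut
  refine ⟨r, hρ, e, ?_, hB.comp (r.tangent_inv hρ).van⟩
  filter_upwards [r.tendsto_invFun.eventually e, r.right_inv] with t ht ht'
  rw [ht, ht']

/-- `exp_step_aux` gives an approximate reparametrization ρ, while r normalizes X exactly. Their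
m-th powers agree to order k, and as Y has order above m along γ, replacing ρ by r changes Y only in
order k + 1. -/
theorem exp_step {δ : TangentCase} {η : ℂ × ℂ → ℂ × ℂ} {γ : ℂ → ℂ × ℂ} {q : ℂ → ℂ} {m k : ℕ}
    {d b : ℂ} (hk : 0 < k) (hη : AnalyticAt ℂ η 0) (h0 : η 0 = 0)
    (hX : ∀ v, coordX δ (fderiv ℂ η 0 v) = b * coordY δ v)
    (hY : ∀ v, coordY δ (fderiv ℂ η 0 v) = 0) (hγ : PBranch δ γ m q)
    (h : Van (k + 1) (fun t => normalPart δ γ q η t - d * t ^ k)) {r : GermAut ℂ}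
    (hr : Tangent r.toFun)
    (hrX : (fun t => coordX δ (expField k η (γ t))) =ᶠ[𝓝 0] (fun t => r.toFun t ^ m)) :
    Van (k + 1) (fun t => coordY δ (expField k η (γ (r.invFun t))) -
      (coordY δ (γ t) + d * t ^ k)) := by
  obtain ⟨ρ, hρ, h1, h2⟩ := exp_step_aux hk hη h0 hX hY hγ h
  have h3 : Van k (fun t => r.toFun t ^ m - ρ t ^ m) := by
    refine h1.congr ?_
    filter_upwards [hrX, hγ.X_eq.comp_tendsto (tendsto_zero_of_analytic hρ.van.1
      (hρ.van.apply_zero one_pos))] with t e1 e2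
    rw [e1, show coordX δ (γ (ρ t)) = ρ t ^ m from e2]
  have h4 := van_comp_sub_of_pow hγ.m_pos hρ hr h3 hγ.Y_van
  have h5 := (hr.pow_sub k).const_mul d
  have h6 : Van (k + 1) (fun t => coordY δ (expField k η (γ t)) -
      (coordY δ (γ (r.toFun t)) + d * r.toFun t ^ k)) :=
    ((h2.sub h4).sub h5).congr (Eventually.of_forall fun t => by ring)
  refine (h6.comp (r.tangent_inv hr).van).congr ?_
  filter_upwards [r.right_inv] with t ht
  rw [ht]

/-! ### The groups -/

section Group

variable {E : Type} [NormedAddCommGroup E] [NormedSpace ℂ E]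

/-- The identity germ. -/
def GermAut.refl : GermAut E where
  toFun := id
  invFun := id
  analytic_toFun := analyticAt_id
  analytic_invFun := analyticAt_id
  toFun_zero := rfl
  invFun_zero := rfl
  left_inv := Eventually.of_forall fun _ => rfl
  right_inv := Eventually.of_forall fun _ => rfl

/-- The inverse germ. -/
def GermAut.symm (g : GermAut E) : GermAut E where
  toFun := g.invFun
  invFun := g.toFun
  analytic_toFun := g.analytic_invFun
  analytic_invFun := g.analytic_toFun
  toFun_zero := g.invFun_zero
  invFun_zero := g.toFun_zero
  left_inv := g.right_inv
  right_inv := g.left_inv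

/-- The composition `g ∘ h` of germs. -/
def GermAut.comp (g h : GermAut E) : GermAut E where
  toFun := g.toFun ∘ h.toFun
  invFun := h.invFun ∘ g.invFun
  analytic_toFun := AnalyticAt.comp_zero (g := g.toFun)
    g.analytic_toFun h.analytic_toFun h.toFun_zero
  analytic_invFun := AnalyticAt.comp_zero (g := h.invFun)
    h.analytic_invFun g.analytic_invFun g.invFun_zero
  toFun_zero := by simp [g.toFun_zero, h.toFun_zero]
  invFun_zero := by simp [g.invFun_zero, h.invFun_zero]
  left_inv := by
    filter_upwards [h.left_inv, h.tendsto_toFun.eventually g.left_inv] with z h1 h2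
    simp [h1, h2]
  right_inv := by
    filter_upwards [g.right_inv, g.tendsto_invFun.eventually h.right_inv] with z h1 h2
    simp [h1, h2]

theorem GermAut.fderiv_comp (g h : GermAut E) (v : E) :
    fderiv ℂ (g.comp h).toFun 0 v = fderiv ℂ g.toFun 0 (fderiv ℂ h.toFun 0 v) := by
  have h1 : HasFDerivAt g.toFun (fderiv ℂ g.toFun 0) (h.toFun 0) := by
    rw [h.toFun_zero]; exact g.analytic_toFun.differentiableAt.hasFDerivAt
  have h2 := (h1.comp 0 h.analytic_toFun.differentiableAt.hasFDerivAt).fderiv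
  exact congrArg (fun L : E →L[ℂ] E => L v) h2

end Group

theorem GermAut.deriv_comp (g h : GermAut ℂ) :
    deriv (g.comp h).toFun 0 = deriv g.toFun 0 * deriv h.toFun 0 := by
  have := g.fderiv_comp h 1
  rw [fderiv_apply_one_eq_deriv, fderiv_apply_one_eq_deriv, fderiv_eq_smul_deriv] at this
  rw [this, smul_eq_mul, mul_comm]

theorem GermAut.tangent (g : GermAut ℂ) (h : deriv g.toFun 0 = 1) : Tangent g.toFun :=
  tangent_of_deriv g.analytic_toFun g.toFun_zero h

/-- The product in `𝒜`. -/
noncomputable def AGroup.mul (g h : AGroup) : AGroup := ⟨g.ρ₁.comp h.ρ₁, g.ρ₂.comp h.ρ₂, g.σ.comp h.σ⟩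

/-- The inverse in `𝒜`. -/
noncomputable def AGroup.inv (g : AGroup) : AGroup := ⟨g.ρ₁.symm, g.ρ₂.symm, g.σ.symm⟩

/-- The unit of `𝒜`. -/
noncomputable def AGroup.one : AGroup := ⟨GermAut.refl, GermAut.refl, GermAut.refl⟩

theorem AGroup.act_one (φ : MapPair) : AGroup.one.act φ = φ := rfl

theorem one_mem_ASub (δ : TangentCase) : AGroup.one ∈ ASub δ := by
  refine ⟨?_, ?_, 0, fun _ => rfl, fun v => ?_⟩
  · exact deriv_id 0
  · exact deriv_id 0
  · change fderiv ℂ id 0 v = _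
    simp

theorem mul_mem_ASub {δ : TangentCase} {g h : AGroup} (hg : g ∈ ASub δ) (hh : h ∈ ASub δ) :
    g.mul h ∈ ASub δ := by
  obtain ⟨g1, g2, b, hb, hb'⟩ := hg
  obtain ⟨h1, h2, c, hc, hc'⟩ := hh
  refine ⟨?_, ?_, b + c, fun e => by rw [hb e, hc e, add_zero], fun v => ?_⟩
  · exact (g.ρ₁.deriv_comp h.ρ₁).trans (by rw [g1, h1, one_mul])
  · exact (g.ρ₂.deriv_comp h.ρ₂).trans (by rw [g2, h2, one_mul])
  · refine (g.σ.fderiv_comp h.σ v).trans ?_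
    rw [hc', hb']
    ext <;> simp
    ring

theorem inv_mem_ASub {δ : TangentCase} {g : AGroup} (hg : g ∈ ASub δ) : g.inv ∈ ASub δ := by
  obtain ⟨g1, g2, b, hb, hb'⟩ := hg
  refine ⟨?_, ?_, -b, fun e => by rw [hb e, neg_zero], fun v => ?_⟩
  · exact (g.ρ₁.tangent_inv (g.ρ₁.tangent g1)).deriv_eq
  · exact (g.ρ₂.tangent_inv (g.ρ₂.tangent g2)).deriv_eq
  · have := g.σ.fderiv_comp_inv v
    rw [hb'] at this
    change fderiv ℂ g.σ.invFun 0 v = _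
    rw [Prod.ext_iff] at this
    obtain ⟨e1, e2⟩ := this
    simp only at e1 e2
    ext
    · simp only; linear_combination e1 - b * e2
    · exact e2

theorem GermEq.refl (φ : MapPair) : GermEq φ φ := ⟨EventuallyEq.rfl, EventuallyEq.rfl⟩

theorem GermEq.symm {φ ψ : MapPair} (h : GermEq φ ψ) : GermEq ψ φ :=
  ⟨EventuallyEq.symm h.1, EventuallyEq.symm h.2⟩

theorem GermEq.trans {φ ψ χ : MapPair} (h : GermEq φ ψ) (h' : GermEq ψ χ) : GermEq φ χ :=
  ⟨EventuallyEq.trans h.1 h'.1, EventuallyEq.trans h.2 h'.2⟩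

theorem GermEq.act {φ ψ : MapPair} (h : GermEq φ ψ) (g : AGroup) : GermEq (g.act φ) (g.act ψ) :=
  ⟨(h.1.comp_tendsto g.ρ₁.tendsto_invFun).fun_comp g.σ.toFun,
    (h.2.comp_tendsto g.ρ₂.tendsto_invFun).fun_comp g.σ.toFun⟩

theorem AGroup.inv_act_act (g : AGroup) {φ : MapPair} (h1 : Tendsto φ.fst (𝓝 0) (𝓝 0))
    (h2 : Tendsto φ.snd (𝓝 0) (𝓝 0)) : GermEq φ (g.inv.act (g.act φ)) := by
  constructor
  · filter_upwards [g.ρ₁.left_inv, h1.eventually g.σ.left_inv] with t e1 e2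
    simp [AGroup.act, AGroup.inv, GermAut.symm, e1, e2]
  · filter_upwards [g.ρ₂.left_inv, h2.eventually g.σ.left_inv] with t e1 e2
    simp [AGroup.act, AGroup.inv, GermAut.symm, e1, e2]

theorem IsBigerm.tendsto_fst {φ : MapPair} (h : IsBigerm φ) : Tendsto φ.fst (𝓝 0) (𝓝 0) :=
  tendsto_zero_of_analytic h.analytic_fst h.fst_zero

theorem IsBigerm.tendsto_snd {φ : MapPair} (h : IsBigerm φ) : Tendsto φ.snd (𝓝 0) (𝓝 0) :=
  tendsto_zero_of_analytic h.analytic_snd h.snd_zero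

theorem AEquiv.refl (δ : TangentCase) (φ : MapPair) : AEquiv δ φ φ :=
  ⟨AGroup.one, one_mem_ASub δ, GermEq.refl φ⟩

theorem AEquiv.trans {δ : TangentCase} {φ ψ χ : MapPair} (h : AEquiv δ φ ψ) (h' : AEquiv δ ψ χ) :
    AEquiv δ φ χ := by
  obtain ⟨g, hg, e⟩ := h
  obtain ⟨g', hg', e'⟩ := h'
  exact ⟨g'.mul g, mul_mem_ASub hg' hg, e'.trans (e.act g')⟩

theorem AEquiv.symm {δ : TangentCase} {φ ψ : MapPair} (hφ : IsBigerm φ) (h : AEquiv δ φ ψ) :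
    AEquiv δ ψ φ := by
  obtain ⟨g, hg, e⟩ := h
  exact ⟨g.inv, inv_mem_ASub hg,
    (g.inv_act_act hφ.tendsto_fst hφ.tendsto_snd).trans (e.act g.inv).symm⟩

/-! ### Invariants -/

theorem AEquiv.isBigerm {δ : TangentCase} {φ ψ : MapPair} (hφ : IsBigerm φ) (h : AEquiv δ φ ψ) :
    IsBigerm ψ := by
  obtain ⟨g, -, e1, e2⟩ := h
  have a1 : AnalyticAt ℂ (g.act φ).fst 0 := AnalyticAt.comp_zero
    (g := g.σ.toFun) (f := fun t => φ.fst (g.ρ₁.invFun t)) g.σ.analytic_toFun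
    (AnalyticAt.comp_zero hφ.analytic_fst g.ρ₁.analytic_invFun g.ρ₁.invFun_zero)
    (by simp [g.ρ₁.invFun_zero, hφ.fst_zero])
  have a2 : AnalyticAt ℂ (g.act φ).snd 0 := AnalyticAt.comp_zero
    (g := g.σ.toFun) (f := fun t => φ.snd (g.ρ₂.invFun t)) g.σ.analytic_toFun
    (AnalyticAt.comp_zero hφ.analytic_snd g.ρ₂.analytic_invFun g.ρ₂.invFun_zero)
    (by simp [g.ρ₂.invFun_zero, hφ.snd_zero])
  refine ⟨a1.congr e1.symm, a2.congr e2.symm, ?_, ?_, ?_⟩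
  · rw [e1.self_of_nhds]
    simp [AGroup.act, g.ρ₁.invFun_zero, hφ.fst_zero, g.σ.toFun_zero]
  · rw [e2.self_of_nhds]
    simp [AGroup.act, g.ρ₂.invFun_zero, hφ.snd_zero, g.σ.toFun_zero]
  obtain ⟨U, hU, i1, i2, i3⟩ := hφ.reduced
  refine ⟨{t | (g.ρ₁.invFun t ∈ U ∧ g.σ.invFun (g.σ.toFun (φ.fst (g.ρ₁.invFun t))) =
      φ.fst (g.ρ₁.invFun t) ∧ g.ρ₁.toFun (g.ρ₁.invFun t) = t ∧ ψ.fst t = (g.act φ).fst t) ∧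
    (g.ρ₂.invFun t ∈ U ∧ g.σ.invFun (g.σ.toFun (φ.snd (g.ρ₂.invFun t))) =
      φ.snd (g.ρ₂.invFun t) ∧ g.ρ₂.toFun (g.ρ₂.invFun t) = t ∧ ψ.snd t = (g.act φ).snd t)},
      ?_, ?_, ?_, ?_⟩
  · refine Filter.inter_mem ?_ ?_
    · filter_upwards [g.ρ₁.tendsto_invFun.eventually hU, (hφ.tendsto_fst.comp
        g.ρ₁.tendsto_invFun).eventually g.σ.left_inv, g.ρ₁.right_inv, e1] with t h1 h2 h3 h4
      exact ⟨h1, h2, h3, h4⟩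
    · filter_upwards [g.ρ₂.tendsto_invFun.eventually hU, (hφ.tendsto_snd.comp
        g.ρ₂.tendsto_invFun).eventually g.σ.left_inv, g.ρ₂.right_inv, e2] with t h1 h2 h3 h4
      exact ⟨h1, h2, h3, h4⟩
  · rintro s ⟨⟨s1, s2, s3, s4⟩, -⟩ t ⟨⟨t1, t2, t3, t4⟩, -⟩ hst
    rw [s4, t4] at hst
    have := congrArg g.σ.invFun hst
    simp only [AGroup.act, Function.comp_apply] at this
    rw [s2, t2] at this
    rw [← s3, ← t3, i1 s1 t1 this]
  · rintro s ⟨-, s1, s2, s3, s4⟩ t ⟨-, t1, t2, t3, t4⟩ hst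
    rw [s4, t4] at hst
    have := congrArg g.σ.invFun hst
    simp only [AGroup.act, Function.comp_apply] at this
    rw [s2, t2] at this
    rw [← s3, ← t3, i2 s1 t1 this]
  · rintro s ⟨⟨s1, s2, s3, s4⟩, -⟩ t ⟨-, t1, t2, t3, t4⟩ hst
    rw [s4, t4] at hst
    have := congrArg g.σ.invFun hst
    simp only [AGroup.act, Function.comp_apply] at this
    rw [s2, t2] at this
    obtain ⟨h1, h2⟩ := i3 _ s1 _ t1 this
    rw [← s3, ← t3, h1, h2]
    exact ⟨g.ρ₁.toFun_zero, g.ρ₂.toFun_zero⟩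

theorem AEquiv.semigroup_subset {δ : TangentCase} {φ ψ : MapPair} (h : AEquiv δ φ ψ) :
    semigroup ψ ⊆ semigroup φ := by
  obtain ⟨g, ⟨h1, h2, -⟩, e1, e2⟩ := h
  have t1 := g.ρ₁.tangent_inv (g.ρ₁.tangent h1)
  have t2 := g.ρ₂.tangent_inv (g.ρ₂.tangent h2)
  rintro _ ⟨η, hη, rfl⟩
  refine ⟨fun z => η (g.σ.toFun z), AnalyticAt.comp_zero hη g.σ.analytic_toFun g.σ.toFun_zero,
    Prod.ext ?_ ?_⟩
  · have := ord_comp (f := fun t => η (g.σ.toFun (φ.fst t))) g.ρ₁.analytic_invFun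
      g.ρ₁.invFun_zero (by rw [t1.deriv_eq]; exact one_ne_zero)
    simp only [valFun]
    rw [← this]
    exact ord_congr (e1.fun_comp η)
  · have := ord_comp (f := fun t => η (g.σ.toFun (φ.snd t))) g.ρ₂.analytic_invFun
      g.ρ₂.invFun_zero (by rw [t2.deriv_eq]; exact one_ne_zero)
    simp only [valFun]
    rw [← this]
    exact ord_congr (e2.fun_comp η)

theorem AEquiv.semigroup_eq {δ : TangentCase} {φ ψ : MapPair} (hφ : IsBigerm φ)
    (h : AEquiv δ φ ψ) : semigroup ψ = semigroup φ :=
  h.semigroup_subset.antisymm (h.symm hφ).semigroup_subset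

/-- Membership depends only on the 1-jets of the two coefficients; in this form it can be checked
for pull-backs and for forms built from vector fields. -/
theorem mem_Omega_iff {δ : TangentCase} {ω : (ℂ × ℂ → ℂ) × (ℂ × ℂ → ℂ)} :
    ω ∈ Omega δ ↔ InMaxSq ω.1 ∧ AnalyticAt ℂ ω.2 0 ∧ ω.2 0 = 0 ∧
      ∃ β : ℂ, (δ = TangentCase.distinct → β = 0) ∧ ∀ v, fderiv ℂ ω.2 0 v = β * v.2 := by
  constructor
  · rintro ⟨η₁, η₂, β, h1, ⟨a2, z2, d2⟩, hβ, rfl⟩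
    refine ⟨h1, (analyticAt_const.mul analyticAt_snd).add a2, by simp [z2], β, hβ, fun v => ?_⟩
    have := (((hasFDerivAt_snd (𝕜 := ℂ) (p := (0 : ℂ × ℂ))).const_mul β).add
      a2.differentiableAt.hasFDerivAt).fderiv
    have e : fderiv ℂ (fun p : ℂ × ℂ => β * p.2 + η₂ p) 0 = _ := this
    simp [e, d2]
  · obtain ⟨A, B⟩ := ω
    rintro ⟨h1, a2, z2, β, hβ, d2⟩
    refine ⟨A, fun p => B p - β * p.2, β, h1, ⟨?_, ?_, ?_⟩, hβ, ?_⟩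
    · exact a2.sub (analyticAt_const.mul analyticAt_snd)
    · have : B 0 = 0 := z2
      simp [this]
    · have := (a2.differentiableAt.hasFDerivAt.sub
        ((hasFDerivAt_snd (𝕜 := ℂ) (p := (0 : ℂ × ℂ))).const_mul β)).fderiv
      have e : fderiv ℂ (fun p : ℂ × ℂ => B p - β * p.2) 0 = _ := this
      rw [e]
      apply ContinuousLinearMap.ext
      intro v
      have := d2 v
      simp only at this
      simp only [_root_.sub_apply, this]
      simp
    · refine Prod.ext rfl ?_
      funext p
      simp

/-- The components of the pull-back of a differential form. -/
noncomputable def pullForm (σ : ℂ × ℂ → ℂ × ℂ) (ω : (ℂ × ℂ → ℂ) × (ℂ × ℂ → ℂ)) :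
    (ℂ × ℂ → ℂ) × (ℂ × ℂ → ℂ) :=
  (fun z => ω.1 (σ z) * (fderiv ℂ σ z (1, 0)).1 + ω.2 (σ z) * (fderiv ℂ σ z (1, 0)).2,
    fun z => ω.1 (σ z) * (fderiv ℂ σ z (0, 1)).1 + ω.2 (σ z) * (fderiv ℂ σ z (0, 1)).2)

/-- The coefficients of `ω` vanish at the origin, so the linear part of the pull-back involves only
the differential of `σ` there. That differential preserves y, hence also β y dy. -/
theorem pullForm_mem {δ : TangentCase} {σ : ℂ × ℂ → ℂ × ℂ} (hσ : AnalyticAt ℂ σ 0) (h0 : σ 0 = 0)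
    {b : ℂ} (hb : ∀ v : ℂ × ℂ, fderiv ℂ σ 0 v = (v.1 + b * v.2, v.2))
    {ω : (ℂ × ℂ → ℂ) × (ℂ × ℂ → ℂ)} (hω : ω ∈ Omega δ) : pullForm σ ω ∈ Omega δ := by
  obtain ⟨A, B⟩ := ω
  rw [mem_Omega_iff] at hω ⊢
  obtain ⟨⟨a1, z1, d1⟩, a2, z2, β, hβ, d2⟩ := hω
  simp only at a1 z1 d1 a2 z2 d2
  have s : ∀ v, AnalyticAt ℂ (fun z => fderiv ℂ σ z v) 0 :=
    fun v => analyticAt_clm_apply hσ.fderiv analyticAt_const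
  have s1 : ∀ v, AnalyticAt ℂ (fun z => (fderiv ℂ σ z v).1) 0 := fun v =>
    ((ContinuousLinearMap.fst ℂ ℂ ℂ).analyticAt _).fun_comp (s v)
  have s2 : ∀ v, AnalyticAt ℂ (fun z => (fderiv ℂ σ z v).2) 0 := fun v =>
    ((ContinuousLinearMap.snd ℂ ℂ ℂ).analyticAt _).fun_comp (s v)
  have aA := AnalyticAt.comp_zero a1 hσ h0
  have aB := AnalyticAt.comp_zero a2 hσ h0
  have dcomp : ∀ f : ℂ × ℂ → ℂ, AnalyticAt ℂ f 0 → ∀ v,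
      fderiv ℂ (fun z => f (σ z)) 0 v = fderiv ℂ f 0 (fderiv ℂ σ 0 v) := by
    intro f hf v
    have h1 : HasFDerivAt f (fderiv ℂ f 0) (σ 0) := by
      rw [h0]; exact hf.differentiableAt.hasFDerivAt
    have h2 : fderiv ℂ (fun z => f (σ z)) 0 = _ :=
      (h1.comp 0 hσ.differentiableAt.hasFDerivAt).fderiv
    rw [h2]; rfl
  have dprod : ∀ f g : ℂ × ℂ → ℂ, AnalyticAt ℂ f 0 → f 0 = 0 → AnalyticAt ℂ g 0 → ∀ v,
      fderiv ℂ (fun z => f (σ z) * g z) 0 v = g 0 * fderiv ℂ f 0 (fderiv ℂ σ 0 v) := by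
    intro f g hf hf0 hg v
    have h2 : fderiv ℂ (fun z => f (σ z) * g z) 0 = _ :=
      ((AnalyticAt.comp_zero hf hσ h0).differentiableAt.hasFDerivAt.mul
        hg.differentiableAt.hasFDerivAt).fderiv
    rw [h2]
    simp [h0, hf0, dcomp f hf]
  have dsum : ∀ u v, fderiv ℂ (fun z => A (σ z) * (fderiv ℂ σ z u).1 +
      B (σ z) * (fderiv ℂ σ z u).2) 0 v = u.2 * (β * v.2) := by
    intro u v
    have h2 : fderiv ℂ (fun z => A (σ z) * (fderiv ℂ σ z u).1 +
      B (σ z) * (fderiv ℂ σ z u).2) 0 = _ :=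
      (((aA.mul (s1 u)).differentiableAt.hasFDerivAt).add
        ((aB.mul (s2 u)).differentiableAt.hasFDerivAt)).fderiv
    rw [h2, _root_.add_apply]
    refine (congrArg₂ (· + ·) (dprod A _ a1 z1 (s1 u) v) (dprod B _ a2 z2 (s2 u) v)).trans ?_
    rw [d1, d2, hb v, hb u]
    simp
  refine ⟨⟨(aA.mul (s1 _)).add (aB.mul (s2 _)), ?_, ?_⟩, (aA.mul (s1 _)).add (aB.mul (s2 _)),
    ?_, β, hβ, fun v => ?_⟩
  · simp [pullForm, h0, z1, z2]
  · apply ContinuousLinearMap.ext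
    intro v
    refine (dsum (1, 0) v).trans ?_
    simp
  · simp [pullForm, h0, z1, z2]
  · refine (dsum (0, 1) v).trans ?_
    simp

/-- By the chain rule the pull-back along γ′ is the pull-back of σ^*ω along γ, composed with θ and
multiplied by θ′. Neither the substitution nor the unit θ′ changes the order. -/
theorem valForm_act {σ : ℂ × ℂ → ℂ × ℂ} (hσ : AnalyticAt ℂ σ 0) {γ γ' : ℂ → ℂ × ℂ}
    (hγ : AnalyticAt ℂ γ 0) (h0 : γ 0 = 0) {θ : ℂ → ℂ} (hθ : Tangent θ)
    (e : γ' =ᶠ[𝓝 0] fun t => σ (γ (θ t))) (ω : (ℂ × ℂ → ℂ) × (ℂ × ℂ → ℂ))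
    (hω1 : AnalyticAt ℂ (pullForm σ ω).1 0) (hω2 : AnalyticAt ℂ (pullForm σ ω).2 0) :
    valForm γ' ω.1 ω.2 = valForm γ (pullForm σ ω).1 (pullForm σ ω).2 := by
  have hθ0 := hθ.van.apply_zero one_pos
  have htθ := tendsto_zero_of_analytic hθ.van.1 hθ0
  have hγt : Tendsto (fun t => γ (θ t)) (𝓝 0) (𝓝 0) :=
    (tendsto_zero_of_analytic hγ h0).comp htθ
  set F : ℂ → ℂ := fun t => (pullForm σ ω).1 (γ t) * deriv (fun s => (γ s).1) t +
    (pullForm σ ω).2 (γ t) * deriv (fun s => (γ s).2) t with hF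
  have hg1 : AnalyticAt ℂ (fun s => (γ s).1) 0 :=
    ((ContinuousLinearMap.fst ℂ ℂ ℂ).analyticAt _).fun_comp hγ
  have hg2 : AnalyticAt ℂ (fun s => (γ s).2) 0 :=
    ((ContinuousLinearMap.snd ℂ ℂ ℂ).analyticAt _).fun_comp hγ
  have hFa : AnalyticAt ℂ F 0 :=
    ((AnalyticAt.comp_zero hω1 hγ h0).mul hg1.deriv).add
      ((AnalyticAt.comp_zero hω2 hγ h0).mul hg2.deriv)
  have hFθ : AnalyticAt ℂ (fun t => F (θ t)) 0 := AnalyticAt.comp_zero hFa hθ.van.1 hθ0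
  have hord : ord (fun t => F (θ t) * deriv θ t) = ord F := by
    rw [ord_mul hFθ hθ.van.1.deriv,
      ord_comp hθ.van.1 hθ0 (by rw [hθ.deriv_eq]; exact one_ne_zero)]
    have : ord (deriv θ) = 0 :=
      (hθ.van.1.deriv.analyticOrderAt_eq_zero).2 (by rw [hθ.deriv_eq]; exact one_ne_zero)
    rw [this, add_zero]
  unfold valForm
  rw [show ord (fun t => (pullForm σ ω).1 (γ t) * deriv (fun s => (γ s).1) t +
    (pullForm σ ω).2 (γ t) * deriv (fun s => (γ s).2) t) = ord F from rfl, ← hord]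
  congr 1
  refine ord_congr ?_
  filter_upwards [e, (e.fun_comp Prod.fst).deriv, (e.fun_comp Prod.snd).deriv,
    hγt.eventually hσ.eventually_analyticAt, htθ.eventually hγ.eventually_analyticAt,
    hθ.van.1.eventually_analyticAt] with t e0 e1 e2 a1 a2 a3
  have hd : HasDerivAt (fun t => σ (γ (θ t)))
      (fderiv ℂ σ (γ (θ t)) (deriv θ t • deriv γ (θ t))) t :=
    a1.differentiableAt.hasFDerivAt.comp_hasDerivAt t
      (a2.differentiableAt.hasDerivAt.scomp t a3.differentiableAt.hasDerivAt)
  have d1 : deriv (fun s => (γ' s).1) t =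
      (fderiv ℂ σ (γ (θ t)) (deriv θ t • deriv γ (θ t))).1 :=
    e1.trans (((ContinuousLinearMap.fst ℂ ℂ ℂ).hasFDerivAt.comp_hasDerivAt t hd).deriv)
  have d2 : deriv (fun s => (γ' s).2) t =
      (fderiv ℂ σ (γ (θ t)) (deriv θ t • deriv γ (θ t))).2 :=
    e2.trans (((ContinuousLinearMap.snd ℂ ℂ ℂ).hasFDerivAt.comp_hasDerivAt t hd).deriv)
  have d3 : deriv (fun s => (γ s).1) (θ t) = (deriv γ (θ t)).1 :=
    ((ContinuousLinearMap.fst ℂ ℂ ℂ).hasFDerivAt.comp_hasDerivAt (θ t)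
      a2.differentiableAt.hasDerivAt).deriv
  have d4 : deriv (fun s => (γ s).2) (θ t) = (deriv γ (θ t)).2 :=
    ((ContinuousLinearMap.snd ℂ ℂ ℂ).hasFDerivAt.comp_hasDerivAt (θ t)
      a2.differentiableAt.hasDerivAt).deriv
  have hv : deriv γ (θ t) = (deriv γ (θ t)).1 • ((1 : ℂ), (0 : ℂ)) +
      (deriv γ (θ t)).2 • ((0 : ℂ), (1 : ℂ)) := by ext <;> simp
  rw [d1, d2, e0]
  simp only [hF, d3, d4, pullForm]
  rw [hv]
  simp only [map_smul, map_add, Prod.smul_fst, Prod.smul_snd, Prod.fst_add, Prod.snd_add,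
    smul_eq_mul]
  simp
  ring

theorem AEquiv.lambdaSet_subset {δ : TangentCase} {φ ψ : MapPair} (hφ : IsBigerm φ)
    (h : AEquiv δ φ ψ) (hm1 : mult ψ.fst = mult φ.fst) (hm2 : mult ψ.snd = mult φ.snd) :
    LambdaSet δ ψ ⊆ LambdaSet δ φ := by
  obtain ⟨g, ⟨h1, h2, b, -, hb⟩, e1, e2⟩ := h
  have t1 := g.ρ₁.tangent_inv (g.ρ₁.tangent h1)
  have t2 := g.ρ₂.tangent_inv (g.ρ₂.tangent h2)
  rintro _ ⟨ω, hω, rfl⟩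
  have hp := pullForm_mem g.σ.analytic_toFun g.σ.toFun_zero hb hω
  have hp' := mem_Omega_iff.1 hp
  refine ⟨pullForm g.σ.toFun ω, hp, ?_⟩
  rw [hm1, hm2, valForm_act g.σ.analytic_toFun hφ.analytic_fst hφ.fst_zero t1 e1 ω hp'.1.1 hp'.2.1,
    valForm_act g.σ.analytic_toFun hφ.analytic_snd hφ.snd_zero t2 e2 ω hp'.1.1 hp'.2.1]

theorem AEquiv.lambdaSet_eq {δ : TangentCase} {φ ψ : MapPair} (hφ : IsBigerm φ)
    (h : AEquiv δ φ ψ) (hm1 : mult ψ.fst = mult φ.fst) (hm2 : mult ψ.snd = mult φ.snd) :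
    LambdaSet δ ψ = LambdaSet δ φ :=
  (h.lambdaSet_subset hφ hm1 hm2).antisymm
    ((h.symm hφ).lambdaSet_subset (h.isBigerm hφ) hm1.symm hm2.symm)

/-! ### Puiseux forms -/

theorem PBranch.mult_eq {δ : TangentCase} {γ : ℂ → ℂ × ℂ} {m : ℕ} {q : ℂ → ℂ}
    (h : PBranch δ γ m q) : mult γ = m := by
  have hX : ord (fun t => coordX δ (γ t)) = m := by rw [ord_congr h.X_eq, ord_pow]
  have hY : (m : ℕ∞) ≤ ord (fun t => coordY δ (γ t)) :=
    le_trans (by exact_mod_cast Nat.le_succ m) h.Y_van.2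
  cases δ
  · have e : min (ord fun t => (γ t).1) (ord fun t => (γ t).2) = m :=
      (min_eq_right (hY.trans' hX.le)).trans hX
    rw [mult, e]; rfl
  · have e : min (ord fun t => (γ t).1) (ord fun t => (γ t).2) = m :=
      (min_eq_left (hY.trans' hX.le)).trans hX
    rw [mult, e]; rfl

theorem base₂_eq_coordX (δ : TangentCase) (φ : MapPair) :
    base₂ δ φ = fun t => coordX δ (φ.snd t) := by cases δ <;> rfl

theorem graph₂_eq_coordY (δ : TangentCase) (φ : MapPair) :
    graph₂ δ φ = fun t => coordY δ (φ.snd t) := by cases δ <;> rfl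

theorem graph₁_eq_coordY (φ : MapPair) : graph₁ φ = fun t => coordY .same (φ.fst t) := rfl

theorem analyticAt_coordX {γ : ℂ → ℂ × ℂ} (δ : TangentCase) (h : AnalyticAt ℂ γ 0) :
    AnalyticAt ℂ (fun t => coordX δ (γ t)) 0 := ((coordX δ).analyticAt _).fun_comp h

theorem analyticAt_coordY {γ : ℂ → ℂ × ℂ} (δ : TangentCase) (h : AnalyticAt ℂ γ 0) :
    AnalyticAt ℂ (fun t => coordY δ (γ t)) 0 := ((coordY δ).analyticAt _).fun_comp h

theorem exists_pBranch_of_puiseux {δ : TangentCase} {γ : ℂ → ℂ × ℂ} (ha : AnalyticAt ℂ γ 0)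
    (h0 : γ 0 = 0) (hX : (fun t => coordX δ (γ t)) =ᶠ[𝓝 0] fun t => t ^ mult γ)
    (hY : (mult γ : ℕ∞) < ord (fun t => coordY δ (γ t))) : ∃ q, PBranch δ γ (mult γ) q := by
  refine exists_pBranch (Nat.pos_of_ne_zero fun h => ?_) hX ⟨analyticAt_coordY δ ha, ?_⟩
  · have := hX.self_of_nhds
    simp [h0, h] at this
  · exact_mod_cast Order.add_one_le_of_lt hY

theorem IsPuiseux.exists_pBranch {δ : TangentCase} {φ : MapPair} (h : IsPuiseux δ φ) :
    ∃ q₁ q₂, PBranch .same φ.fst (mult φ.fst) q₁ ∧ PBranch δ φ.snd (mult φ.snd) q₂ := by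
  obtain ⟨q₁, h1⟩ := exists_pBranch_of_puiseux (δ := .same) h.isBigerm.analytic_fst
    h.isBigerm.fst_zero h.base₁_eq h.lt_graph₁
  obtain ⟨q₂, h2⟩ := exists_pBranch_of_puiseux (δ := δ) h.isBigerm.analytic_snd
    h.isBigerm.snd_zero (base₂_eq_coordX δ φ ▸ h.base₂_eq) (graph₂_eq_coordY δ φ ▸ h.lt_graph₂)
  exact ⟨q₁, q₂, h1, h2⟩

theorem isPuiseux_of_pBranch {δ : TangentCase} {φ : MapPair} (h : IsBigerm φ) {m₁ m₂ : ℕ}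
    {q₁ q₂ : ℂ → ℂ} (h1 : PBranch .same φ.fst m₁ q₁) (h2 : PBranch δ φ.snd m₂ q₂) :
    IsPuiseux δ φ := by
  refine ⟨h, ?_, ?_, ?_, ?_⟩
  · rw [h1.mult_eq]; exact h1.X_eq
  · rw [h1.mult_eq]; exact lt_of_lt_of_le (by exact_mod_cast Nat.lt_succ_self m₁) h1.Y_van.2
  · rw [h2.mult_eq, base₂_eq_coordX]; exact h2.X_eq
  · rw [h2.mult_eq, graph₂_eq_coordY]
    exact lt_of_lt_of_le (by exact_mod_cast Nat.lt_succ_self m₂) h2.Y_van.2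

/-! ### Tangent vector fields and values of differentials -/

/-- The vector fields tangent to the group `𝒜[δ]`. -/
def VField (δ : TangentCase) (η : ℂ × ℂ → ℂ × ℂ) : Prop :=
  AnalyticAt ℂ η 0 ∧ η 0 = 0 ∧ ∃ b : ℂ, (δ = TangentCase.distinct → b = 0) ∧
    ∀ v : ℂ × ℂ, fderiv ℂ η 0 v = (b * v.2, 0)

theorem analyticAt_fst_comp {E : Type*} [NormedAddCommGroup E] [NormedSpace ℂ E]
    {η : E → ℂ × ℂ} {x : E} (h : AnalyticAt ℂ η x) : AnalyticAt ℂ (fun z => (η z).1) x :=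
  ((ContinuousLinearMap.fst ℂ ℂ ℂ).analyticAt _).fun_comp h

theorem analyticAt_snd_comp {E : Type*} [NormedAddCommGroup E] [NormedSpace ℂ E]
    {η : E → ℂ × ℂ} {x : E} (h : AnalyticAt ℂ η x) : AnalyticAt ℂ (fun z => (η z).2) x :=
  ((ContinuousLinearMap.snd ℂ ℂ ℂ).analyticAt _).fun_comp h

/-- Up to sign this form is the contraction of dx ∧ dy with η; `vField_of_mem_Omega` goes back. -/
theorem VField.mem_Omega {δ : TangentCase} {η : ℂ × ℂ → ℂ × ℂ} (h : VField δ η) :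
    ((fun z => (η z).2, fun z => -(η z).1) : (ℂ × ℂ → ℂ) × (ℂ × ℂ → ℂ)) ∈ Omega δ := by
  obtain ⟨ha, h0, b, hb, hd⟩ := h
  rw [mem_Omega_iff]
  refine ⟨⟨analyticAt_snd_comp ha, by simp [h0], ?_⟩, (analyticAt_fst_comp ha).neg, by simp [h0],
    -b, fun e => by rw [hb e, neg_zero], fun v => ?_⟩
  · have := (ha.differentiableAt.hasFDerivAt.snd).fderiv
    apply ContinuousLinearMap.ext
    intro v
    simp [this, hd]
  · have : fderiv ℂ (fun z => -(η z).1) 0 = _ := (ha.differentiableAt.hasFDerivAt.fst.neg).fderiv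
    simp only [this]
    simp [hd]

theorem vField_of_mem_Omega {δ : TangentCase} {ω : (ℂ × ℂ → ℂ) × (ℂ × ℂ → ℂ)} (h : ω ∈ Omega δ) :
    VField δ (fun z => (-ω.2 z, ω.1 z)) := by
  obtain ⟨⟨a1, z1, d1⟩, a2, z2, β, hβ, d2⟩ := mem_Omega_iff.1 h
  refine ⟨a2.neg.prod a1, by simp [z1, z2], -β, fun e => by rw [hβ e, neg_zero], fun v => ?_⟩
  have : fderiv ℂ (fun z => (-ω.2 z, ω.1 z)) 0 = _ :=
    ((a2.differentiableAt.hasFDerivAt.neg).prodMk a1.differentiableAt.hasFDerivAt).fderiv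
  rw [this]
  simp [d1, d2]

/-- Since dY = q dX on the branch, the form pulls back to ± X′ times the normal part, and X′ has
order m − 1. The shift by 1 in `valForm` and the subtraction of m cancel this exactly. -/
theorem valForm_sub_mult {δ : TangentCase} {γ : ℂ → ℂ × ℂ} {m : ℕ} {q : ℂ → ℂ}
    (h : PBranch δ γ m q) {η : ℂ × ℂ → ℂ × ℂ} (hη : AnalyticAt ℂ η 0) :
    valForm γ (fun z => (η z).2) (fun z => -(η z).1) - (mult γ : ℕ∞) =
      ord (normalPart δ γ q η) := by
  have hγ0 := h.vvan_one.apply_zero one_pos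
  have hηγ := AnalyticAt.comp_zero hη h.vvan_one.analytic hγ0
  have hn : AnalyticAt ℂ (normalPart δ γ q η) 0 :=
    (analyticAt_coordY δ hηγ).sub ((analyticAt_coordX δ hηγ).mul h.q_van.1)
  have hd : ord (deriv fun t => coordX δ (γ t)) = (m - 1 : ℕ) := by
    have : (deriv fun t => coordX δ (γ t)) =ᶠ[𝓝 0] fun t => (m : ℂ) * t ^ (m - 1) := by
      filter_upwards [h.X_eq.deriv] with t ht
      rw [ht, deriv_pow_field]
    rw [ord_congr this]
    exact ord_eq_of_van_sub (k := m - 1) (d := m)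
      ((van_const_zero _).congr (Eventually.of_forall fun t => by simp))
      (by exact_mod_cast h.m_pos.ne')
  have key : ord (fun t => (η (γ t)).2 * deriv (fun s => (γ s).1) t +
      -(η (γ t)).1 * deriv (fun s => (γ s).2) t) =
      (m - 1 : ℕ) + ord (normalPart δ γ q η) := by
    rw [← hd, ← ord_mul h.X_van.1.deriv hn]
    cases δ
    · rw [show ord (fun t => (deriv fun t => coordX .distinct (γ t)) t *
        normalPart .distinct γ q η t) = ord (fun t => -((deriv fun t => coordX .distinct (γ t)) t *
        normalPart .distinct γ q η t)) from (analyticOrderAt_neg).symm]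
      refine ord_congr ?_
      filter_upwards [h.slope] with t ht
      have ht' : deriv (fun s => (γ s).1) t = q t * deriv (fun s => (γ s).2) t := ht
      rw [ht']
      change _ = -(deriv (fun s => (γ s).2) t * ((η (γ t)).1 - (η (γ t)).2 * q t))
      ring
    · refine ord_congr ?_
      filter_upwards [h.slope] with t ht
      have ht' : deriv (fun s => (γ s).2) t = q t * deriv (fun s => (γ s).1) t := ht
      rw [ht']
      change _ = (deriv (fun s => (γ s).1) t * ((η (γ t)).2 - (η (γ t)).1 * q t))
      ring
  rw [valForm, h.mult_eq, key]
  have hm := h.m_pos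
  rcases eq_or_ne (ord (normalPart δ γ q η)) ⊤ with htop | hne
  · rw [htop]; simp
  · obtain ⟨n, hn⟩ := ENat.ne_top_iff_exists.1 hne
    rw [← hn]
    norm_cast
    omega

/-- `Λ[δ]` consists of the orders of the normal parts of the vector fields tangent to `𝒜[δ]`. -/
theorem lambdaSet_eq_normalPart {δ : TangentCase} {φ : MapPair} {m₁ m₂ : ℕ}
    {q₁ q₂ : ℂ → ℂ} (h1 : PBranch .same φ.fst m₁ q₁) (h2 : PBranch δ φ.snd m₂ q₂) :
    LambdaSet δ φ = {v | ∃ η, VField δ η ∧ v = (ord (normalPart .same φ.fst q₁ η),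
      ord (normalPart δ φ.snd q₂ η))} := by
  ext v
  constructor
  · rintro ⟨ω, hω, rfl⟩
    refine ⟨_, vField_of_mem_Omega hω, ?_⟩
    have ha := (vField_of_mem_Omega hω).1
    rw [← valForm_sub_mult h1 ha, ← valForm_sub_mult h2 ha]
    simp only [neg_neg]
  · rintro ⟨η, hη, rfl⟩
    refine ⟨_, hη.mem_Omega, ?_⟩
    rw [← valForm_sub_mult h1 hη.1, ← valForm_sub_mult h2 hη.1]

/-! ### Functions invariant under roots of unity -/

theorem exists_root_nhds {m : ℕ} {V : Set ℂ} (hV : V ∈ 𝓝 (0 : ℂ)) :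
    ∀ᶠ x in 𝓝 (0 : ℂ), ∀ s : ℂ, s ^ m = x → s ∈ V := by
  obtain ⟨ε, hε, hball⟩ := Metric.mem_nhds_iff.1 hV
  have : Metric.ball (0 : ℂ) (ε ^ m) ∈ 𝓝 (0 : ℂ) := Metric.ball_mem_nhds _ (pow_pos hε m)
  filter_upwards [this] with x hx s hs
  refine hball ?_
  rw [mem_ball_zero_iff] at hx ⊢
  rw [← hs, norm_pow] at hx
  exact lt_of_pow_lt_pow_left₀ m hε.le hx

/-- An analytic function invariant under the `m`-th roots of unity is a function of `t ^ m`. -/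
theorem exists_descent {m : ℕ} (hm : 0 < m) {c : ℂ → ℂ} (hc : AnalyticAt ℂ c 0)
    (hinv : ∀ ζ : ℂ, ζ ^ m = 1 → ∀ t, c (ζ * t) = c t) :
    ∃ C : ℂ → ℂ, AnalyticAt ℂ C 0 ∧ ∀ t, C (t ^ m) = c t := by
  -- R is an arbitrary, possibly discontinuous, choice of roots; invariance makes c ∘ R independent
  -- of it.
  choose R hR using fun x : ℂ => IsAlgClosed.exists_pow_nat_eq x hm
  have key : ∀ t, c (R (t ^ m)) = c t := by
    intro t
    rcases eq_or_ne t 0 with rfl | ht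
    · have : R (0 ^ m) = 0 := by
        have := hR (0 ^ m)
        rw [zero_pow hm.ne'] at this ⊢
        exact pow_eq_zero_iff hm.ne' |>.1 this
      rw [this]
    · have h1 : (R (t ^ m) / t) ^ m = 1 := by
        rw [div_pow, hR, div_self (pow_ne_zero m ht)]
      have := hinv _ h1 t
      rwa [div_mul_cancel₀ _ ht] at this
  refine ⟨fun x => c (R x), ?_, key⟩
  have hR0 : Tendsto R (𝓝 0) (𝓝 0) := by
    intro V hV
    refine Filter.mem_map.2 ?_
    filter_upwards [exists_root_nhds (m := m) hV] with x hx
    exact hx _ (hR x)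
  have hRz : R 0 = 0 := pow_eq_zero_iff hm.ne' |>.1 (hR 0)
  -- Away from 0 a local inverse of t ↦ t^m replaces R; at 0 continuity suffices, by removability of
  -- the singularity.
  refine Complex.analyticAt_of_differentiable_on_punctured_nhds_of_continuousAt ?_ ?_
  · have h1 := hR0.eventually hc.eventually_analyticAt
    filter_upwards [h1.filter_mono nhdsWithin_le_nhds, self_mem_nhdsWithin] with x hx hx0
    have ht0 : R x ≠ 0 := fun h => hx0 (by rw [← hR x, h, zero_pow hm.ne']; rfl)
    have hp : HasStrictDerivAt (fun t : ℂ => t ^ m) (m * R x ^ (m - 1)) (R x) :=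
      hasStrictDerivAt_pow m (R x)
    have hne : (m : ℂ) * R x ^ (m - 1) ≠ 0 :=
      mul_ne_zero (by exact_mod_cast hm.ne') (pow_ne_zero _ ht0)
    have hright := hp.eventually_right_inverse hne
    have hderiv := hp.to_localInverse hne
    rw [hR x] at hright hderiv
    set L := hp.localInverse (fun t : ℂ => t ^ m) _ (R x) hne with hL
    have hLx : L x = R x := by
      have := HasStrictFDerivAt.localInverse_apply_image
        (hp.hasStrictFDerivAt_equiv hne)
      rwa [hR x] at this
    have hdiff : DifferentiableAt ℂ (fun y => c (L y)) x :=
      DifferentiableAt.comp x (g := c) (by rw [hLx]; exact hx.differentiableAt)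
        hderiv.hasDerivAt.differentiableAt
    refine hdiff.congr_of_eventuallyEq ?_
    filter_upwards [hright] with y hy
    rw [← key (L y), hy]
  · have : Tendsto (fun x => c (R x)) (𝓝 0) (𝓝 (c 0)) := hc.continuousAt.tendsto.comp hR0
    simpa [ContinuousAt, hRz] using this

/-- A family of polynomials with analytic coefficients and bounded degree. -/
def PolyFam (Q : ℂ → Polynomial ℂ) : Prop :=
  (∀ j, AnalyticAt ℂ (fun t => (Q t).coeff j) 0) ∧ ∃ N, ∀ t, (Q t).natDegree ≤ N

theorem polyFam_C {c : ℂ → ℂ} (hc : AnalyticAt ℂ c 0) : PolyFam fun t => Polynomial.C (c t) := by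
  refine ⟨fun j => ?_, 0, fun t => by simp⟩
  simp only [Polynomial.coeff_C]
  split_ifs
  · exact hc
  · exact analyticAt_const

theorem polyFam_X_sub_C {c : ℂ → ℂ} (hc : AnalyticAt ℂ c 0) :
    PolyFam fun t => Polynomial.X - Polynomial.C (c t) := by
  refine ⟨fun j => ?_, 1, fun t => (Polynomial.natDegree_X_sub_C _).le⟩
  simp only [Polynomial.coeff_sub]
  exact analyticAt_const.sub ((polyFam_C hc).1 j)

theorem PolyFam.mul {P Q : ℂ → Polynomial ℂ} (hP : PolyFam P) (hQ : PolyFam Q) :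
    PolyFam fun t => P t * Q t := by
  obtain ⟨hP, N, hN⟩ := hP
  obtain ⟨hQ, M, hM⟩ := hQ
  refine ⟨fun j => ?_, N + M, fun t =>
    Polynomial.natDegree_mul_le.trans (add_le_add (hN t) (hM t))⟩
  simp only [Polynomial.coeff_mul]
  exact Finset.analyticAt_fun_sum _ fun p _ => (hP p.1).mul (hQ p.2)

theorem PolyFam.prod {ι : Type*} (s : Finset ι) {P : ι → ℂ → Polynomial ℂ}
    (h : ∀ i ∈ s, PolyFam (P i)) : PolyFam fun t => ∏ i ∈ s, P i t := by
  classical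
  induction s using Finset.induction_on with
  | empty => simpa using polyFam_C (c := fun _ => 1) analyticAt_const
  | insert a s ha ih =>
    simp only [Finset.prod_insert ha]
    exact (h a (by simp)).mul (ih fun i hi => h i (by simp [hi]))

theorem PolyFam.sum {ι : Type*} (s : Finset ι) {P : ι → ℂ → Polynomial ℂ}
    (h : ∀ i ∈ s, PolyFam (P i)) : PolyFam fun t => ∑ i ∈ s, P i t := by
  classical
  induction s using Finset.induction_on with
  | empty => simpa using polyFam_C (c := fun _ => 0) analyticAt_const
  | insert a s ha ih =>
    simp only [Finset.sum_insert ha]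
    obtain ⟨h1, N, hN⟩ := h a (by simp)
    obtain ⟨h2, M, hM⟩ := ih fun i hi => h i (by simp [hi])
    refine ⟨fun j => ?_, max N M, fun t => (Polynomial.natDegree_add_le _ _).trans
      (max_le_max (hN t) (hM t))⟩
    simp only [Polynomial.coeff_add]
    exact (h1 j).add (h2 j)

/-- Each coefficient descends to an analytic function of X = t^m, and the bounded degree keeps the
sum finite. -/
theorem PolyFam.exists_descent {m : ℕ} (hm : 0 < m) {Q : ℂ → Polynomial ℂ} (hQ : PolyFam Q)
    (hinv : ∀ ζ : ℂ, ζ ^ m = 1 → ∀ t, Q (ζ * t) = Q t) (δ : TangentCase) :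
    ∃ F : ℂ × ℂ → ℂ, AnalyticAt ℂ F 0 ∧
      ∀ t z, coordX δ z = t ^ m → F z = (Q t).eval (coordY δ z) := by
  obtain ⟨hQ, N, hN⟩ := hQ
  choose C hC hC' using fun j => TwoBranches.exists_descent hm (hQ j)
    (fun ζ hζ t => by rw [hinv ζ hζ t])
  refine ⟨fun z => ∑ j ∈ Finset.range (N + 1), C j (coordX δ z) * coordY δ z ^ j, ?_, ?_⟩
  · refine Finset.analyticAt_fun_sum _ fun j _ => ?_
    exact (AnalyticAt.comp_zero (hC j) ((coordX δ).analyticAt 0) (by simp)).mul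
      (((coordY δ).analyticAt 0).pow j)
  · intro t z hz
    rw [Polynomial.eval_eq_sum_range' (Nat.lt_succ_of_le (hN t))]
    exact Finset.sum_congr rfl fun j _ => by rw [hz, hC']

/-! ### Equations and conductors of branches -/

section Branch

variable {δ : TangentCase} {γ : ℂ → ℂ × ℂ} {m : ℕ} {q : ℂ → ℂ}

theorem coord_ext {v w : ℂ × ℂ} (hX : coordX δ v = coordX δ w) (hY : coordY δ v = coordY δ w) :
    v = w := by
  rw [coord_decomp δ v, coord_decomp δ w, hX, hY]

theorem analyticAt_coordY_mul (h : PBranch δ γ m q) (ξ : ℂ) :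
    AnalyticAt ℂ (fun t => coordY δ (γ (ξ * t))) 0 :=
  AnalyticAt.comp_zero (g := fun t => coordY δ (γ t)) (f := fun t => ξ * t) h.Y_van.1
    (by fun_prop) (by simp)

/-- A branch has an equation that vanishes only on the branch. -/
theorem PBranch.exists_equation (h : PBranch δ γ m q) :
    ∃ F : ℂ × ℂ → ℂ, AnalyticAt ℂ F 0 ∧ (fun t => F (γ t)) =ᶠ[𝓝 0] (fun _ => 0) ∧
      ∀ U ∈ 𝓝 (0 : ℂ), ∀ᶠ z in 𝓝 (0 : ℂ × ℂ), F z = 0 → ∃ s ∈ U, γ s = z := by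
  have hm := h.m_pos
  have : NeZero m := ⟨hm.ne'⟩
  have := Fintype.ofFinite (rootsOfUnity m ℂ)
  -- The equation is the product of Y − y(ξ t) over the m-th roots of unity ξ, with X = t^m;
  -- rotating t only permutes the factors.
  obtain ⟨F, hF, hFQ⟩ := PolyFam.exists_descent hm
    (Q := fun t => ∏ ξ : rootsOfUnity m ℂ,
      (Polynomial.X - Polynomial.C (coordY δ (γ (((ξ : ℂˣ) : ℂ) * t)))))
    (PolyFam.prod _ fun ξ _ => polyFam_X_sub_C (analyticAt_coordY_mul h _))
    (fun ζ hζ t => by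
      set z : rootsOfUnity m ℂ := rootsOfUnity.mkOfPowEq ζ hζ
      refine Fintype.prod_equiv (Equiv.mulRight z) _ _ fun ξ => ?_
      simp [z, mul_assoc]) δ
  simp only [Polynomial.eval_prod, Polynomial.eval_sub, Polynomial.eval_X, Polynomial.eval_C] at hFQ
  refine ⟨F, hF, ?_, fun U hU => ?_⟩
  · filter_upwards [h.X_eq] with t ht
    rw [hFQ t (γ t) ht]
    refine Finset.prod_eq_zero (Finset.mem_univ 1) ?_
    simp
  · obtain ⟨ε, hε, hball⟩ := Metric.mem_nhds_iff.1 (Filter.inter_mem hU h.X_eq)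
    have hV := exists_root_nhds (m := m) (Metric.ball_mem_nhds (0 : ℂ) hε)
    have hX : Tendsto (coordX δ) (𝓝 0) (𝓝 0) := by
      simpa using (coordX δ).continuous.tendsto 0
    filter_upwards [hX.eventually hV] with z hz hFz
    obtain ⟨s, hs⟩ := IsAlgClosed.exists_pow_nat_eq (coordX δ z) hm
    rw [hFQ s z hs.symm, Finset.prod_eq_zero_iff] at hFz
    obtain ⟨ξ, -, hξ⟩ := hFz
    have hξm : (((ξ : ℂˣ) : ℂ) * s) ^ m = coordX δ z := by
      have : ((ξ : ℂˣ) : ℂ) ^ m = 1 := by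
        have := (mem_rootsOfUnity m (ξ : ℂˣ)).1 ξ.2
        rw [← Units.val_pow_eq_pow_val, this, Units.val_one]
      rw [mul_pow, this, one_mul, hs]
    obtain ⟨h1, h2⟩ := hball (hz _ hξm)
    refine ⟨_, h1, coord_ext (δ := δ) ?_ (sub_eq_zero.1 hξ).symm⟩
    rw [← hξm]
    exact h2

/-- Up to a fixed nonzero factor, every function of the parameter of a branch is induced by a
function on the plane. -/
theorem PBranch.exists_conductor (h : PBranch δ γ m q) {U : Set ℂ} (hU : U ∈ 𝓝 (0 : ℂ))
    (hinj : Set.InjOn γ U) :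
    ∃ D : ℂ → ℂ, AnalyticAt ℂ D 0 ∧ (∀ᶠ t in 𝓝 0, D t = 0 → t = 0) ∧
      ∀ u, AnalyticAt ℂ u 0 → ∃ P : ℂ × ℂ → ℂ, AnalyticAt ℂ P 0 ∧
        (fun t => P (γ t)) =ᶠ[𝓝 0] fun t => u t * D t := by
  classical
  have hm := h.m_pos
  have : NeZero m := ⟨hm.ne'⟩
  have := Fintype.ofFinite (rootsOfUnity m ℂ)
  have hpow : ∀ ξ : rootsOfUnity m ℂ, ((ξ : ℂˣ) : ℂ) ^ m = 1 := fun ξ => by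
    have := (mem_rootsOfUnity m (ξ : ℂˣ)).1 ξ.2
    rw [← Units.val_pow_eq_pow_val, this, Units.val_one]
  -- The fixed factor is the Y-derivative along the branch of the product equation. Injectivity of
  -- the parametrization leaves it no zero near the origin other than the origin.
  refine ⟨fun t => ∏ ξ : rootsOfUnity m ℂ, if ξ = 1 then 1 else
    (coordY δ (γ t) - coordY δ (γ (((ξ : ℂˣ) : ℂ) * t))), ?_, ?_, fun u hu => ?_⟩
  · refine Finset.analyticAt_fun_prod _ fun ξ _ => ?_
    split_ifs
    · exact analyticAt_const
    · exact h.Y_van.1.sub (analyticAt_coordY_mul h _)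
  · obtain ⟨ε, hε, hball⟩ := Metric.mem_nhds_iff.1 (Filter.inter_mem hU h.X_eq)
    filter_upwards [Metric.ball_mem_nhds (0 : ℂ) hε] with t ht hD
    rw [Finset.prod_eq_zero_iff] at hD
    obtain ⟨ξ, -, hξ⟩ := hD
    split_ifs at hξ with h1
    · exact absurd hξ one_ne_zero
    have hnorm : ‖((ξ : ℂˣ) : ℂ)‖ = 1 := Complex.norm_eq_one_of_pow_eq_one (hpow ξ) hm.ne'
    have ht' : ((ξ : ℂˣ) : ℂ) * t ∈ Metric.ball (0 : ℂ) ε := by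
      rw [mem_ball_zero_iff] at ht ⊢
      rwa [norm_mul, hnorm, one_mul]
    obtain ⟨a1, a2⟩ := hball ht
    obtain ⟨b1, b2⟩ := hball ht'
    have e : γ t = γ (((ξ : ℂˣ) : ℂ) * t) := by
      refine coord_ext (δ := δ) ?_ (sub_eq_zero.1 hξ)
      rw [show coordX δ (γ t) = t ^ m from a2,
        show coordX δ (γ (((ξ : ℂˣ) : ℂ) * t)) = (((ξ : ℂˣ) : ℂ) * t) ^ m from b2, mul_pow, hpow,
        one_mul]
    have := hinj a1 b1 e
    by_contra hne
    refine h1 (Subtype.ext (Units.ext ?_))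
    exact (mul_right_cancel₀ hne ((one_mul t).trans this)).symm
  -- Lagrange interpolation over the conjugate points: on the branch only the summand ξ = 1
  -- survives, and it equals u times the fixed factor.
  · obtain ⟨P, hP, hPQ⟩ := PolyFam.exists_descent hm
      (Q := fun t => ∑ ξ : rootsOfUnity m ℂ, Polynomial.C (u (((ξ : ℂˣ) : ℂ) * t)) *
        ∏ ξ' : rootsOfUnity m ℂ, if ξ' = ξ then 1 else
        (Polynomial.X - Polynomial.C (coordY δ (γ (((ξ' : ℂˣ) : ℂ) * t)))))
      (PolyFam.sum _ fun ξ _ => (polyFam_C (AnalyticAt.comp_zero (g := u) hu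
        (f := fun t => ((ξ : ℂˣ) : ℂ) * t) (by fun_prop) (by simp))).mul
        (PolyFam.prod _ fun ξ' _ => by
          split_ifs
          · simpa using polyFam_C (c := fun _ => 1) analyticAt_const
          · exact polyFam_X_sub_C (analyticAt_coordY_mul h _)))
      (fun ζ hζ t => by
        set z : rootsOfUnity m ℂ := rootsOfUnity.mkOfPowEq ζ hζ
        refine Fintype.sum_equiv (Equiv.mulRight z) _ _ fun ξ => ?_
        congr 1
        · simp [z, mul_assoc]
        · refine Fintype.prod_equiv (Equiv.mulRight z) _ _ fun ξ' => ?_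
          simp [z, mul_assoc]) δ
    refine ⟨P, hP, ?_⟩
    filter_upwards [h.X_eq] with t ht
    rw [hPQ t (γ t) ht, Polynomial.eval_finsetSum, Finset.sum_eq_single 1]
    · rw [Polynomial.eval_mul, Polynomial.eval_C, Polynomial.eval_prod]
      simp only [OneMemClass.coe_one, Units.val_one, one_mul]
      congr 1
      refine Finset.prod_congr rfl fun ξ _ => ?_
      split_ifs <;> simp
    · intro ξ _ hξ
      rw [Polynomial.eval_mul, Polynomial.eval_prod,
        Finset.prod_eq_zero (Finset.mem_univ (1 : rootsOfUnity m ℂ)), mul_zero]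
      rw [if_neg (Ne.symm hξ)]
      simp
    · intro h
      exact absurd (Finset.mem_univ _) h

end Branch

theorem exists_div {h u : ℂ → ℂ} {d n : ℕ} (hh : AnalyticAt ℂ h 0) (hd : ord h = d)
    (hu : Van (d + n) u) : ∃ v, Van n v ∧ u =ᶠ[𝓝 0] fun t => h t * v t := by
  obtain ⟨k, hk, hk0, ek⟩ := (hh.analyticOrderAt_eq_natCast (n := d)).1 hd
  obtain ⟨w, hw, ew⟩ := hu.exists_eq
  refine ⟨fun t => t ^ n * (w t * (k t)⁻¹), (van_pow n).mul_right (hw.mul (hk.inv hk0)), ?_⟩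
  filter_upwards [ek, ew, hk.continuousAt.eventually_ne hk0] with t e1 e2 hne
  rw [e1, e2]
  simp only [sub_zero, smul_eq_mul, pow_add]
  field_simp

theorem ord_ne_top {f : ℂ → ℂ} (h : ∀ᶠ t in 𝓝 0, f t = 0 → t = 0) : ord f ≠ ⊤ := by
  intro htop
  have h1 := (analyticOrderAt_eq_top.1 htop).and h
  have h2 : ∀ᶠ t in 𝓝[≠] (0 : ℂ), False := by
    filter_upwards [h1.filter_mono nhdsWithin_le_nhds, self_mem_nhdsWithin] with t ht hne
    exact hne (ht.2 ht.1)
  rw [Filter.eventually_false_iff_eq_bot] at h2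
  exact (inferInstance : (𝓝[≠] (0 : ℂ)).NeBot).ne h2

/-- All pairs of functions of order at least `D` on the branches are induced by functions on the
plane. -/
def Lifts (φ : MapPair) (D : ℕ) : Prop :=
  ∀ u₁ u₂, Van D u₁ → Van D u₂ → ∃ η : ℂ × ℂ → ℂ, InMaxSq η ∧
    (fun t => η (φ.fst t)) =ᶠ[𝓝 0] u₁ ∧ (fun t => η (φ.snd t)) =ᶠ[𝓝 0] u₂

/-- Pairs of functions of high order on the branches are induced by functions on the plane. -/
theorem IsPuiseux.exists_lifts {δ : TangentCase} {φ : MapPair} (h : IsPuiseux δ φ) :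
    ∃ D, Lifts φ D := by
  obtain ⟨q₁, q₂, h1, h2⟩ := h.exists_pBranch
  obtain ⟨U, hU, i1, i2, i3⟩ := h.isBigerm.reduced
  obtain ⟨F₁, aF₁, zF₁, oF₁⟩ := h1.exists_equation
  obtain ⟨F₂, aF₂, zF₂, oF₂⟩ := h2.exists_equation
  obtain ⟨D₁, aD₁, zD₁, lD₁⟩ := h1.exists_conductor hU i1
  obtain ⟨D₂, aD₂, zD₂, lD₂⟩ := h2.exists_conductor hU i2
  have aE₁ : AnalyticAt ℂ (fun t => F₂ (φ.fst t)) 0 :=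
    AnalyticAt.comp_zero aF₂ h.isBigerm.analytic_fst h.isBigerm.fst_zero
  have aE₂ : AnalyticAt ℂ (fun t => F₁ (φ.snd t)) 0 :=
    AnalyticAt.comp_zero aF₁ h.isBigerm.analytic_snd h.isBigerm.snd_zero
  -- `F₂` vanishes only on the second branch, which meets the first only at the origin, so its
  -- restriction to the first branch has finite order.
  have o1 : ord (fun t => D₁ t * F₂ (φ.fst t)) ≠ ⊤ := by
    refine ord_ne_top ?_
    filter_upwards [zD₁, h.isBigerm.tendsto_fst.eventually (oF₂ U hU), hU] with t a1 a2 a3 ht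
    rcases mul_eq_zero.1 ht with ht | ht
    · exact a1 ht
    · obtain ⟨s, hs, e⟩ := a2 ht
      exact (i3 t a3 s hs e.symm).1
  have o2 : ord (fun t => D₂ t * F₁ (φ.snd t)) ≠ ⊤ := by
    refine ord_ne_top ?_
    filter_upwards [zD₂, h.isBigerm.tendsto_snd.eventually (oF₁ U hU), hU] with t a1 a2 a3 ht
    rcases mul_eq_zero.1 ht with ht | ht
    · exact a1 ht
    · obtain ⟨s, hs, e⟩ := a2 ht
      exact (i3 s hs t a3 e).2
  obtain ⟨d₁, hd₁⟩ := ENat.ne_top_iff_exists.1 o1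
  obtain ⟨d₂, hd₂⟩ := ENat.ne_top_iff_exists.1 o2
  -- The factor x² + y² will put the lift into the square of the maximal ideal. Its order on a
  -- branch is exactly 2m, since X has order m and Y a larger one.
  have hS : ∀ {δ' : TangentCase} {γ : ℂ → ℂ × ℂ} {m : ℕ} {q : ℂ → ℂ}, PBranch δ' γ m q →
      AnalyticAt ℂ (fun t => (γ t).1 ^ 2 + (γ t).2 ^ 2) 0 ∧
      ord (fun t => (γ t).1 ^ 2 + (γ t).2 ^ 2) = (2 * m : ℕ) := by
    intro δ' γ m q hb
    have a1 := analyticAt_fst_comp hb.vvan_one.analytic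
    have a2 := analyticAt_snd_comp hb.vvan_one.analytic
    refine ⟨(a1.pow 2).add (a2.pow 2), ?_⟩
    have e : (fun t => (γ t).1 ^ 2 + (γ t).2 ^ 2) =
        fun t => coordX δ' (γ t) ^ 2 + coordY δ' (γ t) ^ 2 := by
      cases δ'
      · funext t; exact add_comm _ _
      · rfl
    rw [e]
    refine ord_eq_of_van_sub (d := 1) ?_ one_ne_zero
    refine ((hb.Y_van.pow 2).mono (show 2 * m + 1 ≤ _ by omega)).congr ?_
    filter_upwards [hb.X_eq] with t ht
    rw [ht]
    ring
  refine ⟨d₁ + d₂ + 2 * mult φ.fst + 2 * mult φ.snd, fun u₁ u₂ hu₁ hu₂ => ?_⟩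
  obtain ⟨v₁, hv₁, e₁⟩ := exists_div (n := d₁) (hS h1).1 (hS h1).2 (hu₁.mono (by omega))
  obtain ⟨v₂, hv₂, e₂⟩ := exists_div (n := d₂) (hS h2).1 (hS h2).2 (hu₂.mono (by omega))
  obtain ⟨w₁, hw₁, e₃⟩ := exists_div (n := 0) (aD₁.fun_mul aE₁) hd₁.symm hv₁
  obtain ⟨w₂, hw₂, e₄⟩ := exists_div (n := 0) (aD₂.fun_mul aE₂) hd₂.symm hv₂
  obtain ⟨P₁, aP₁, e₅⟩ := lD₁ w₁ hw₁.1
  obtain ⟨P₂, aP₂, e₆⟩ := lD₂ w₂ hw₂.1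
  have aη : AnalyticAt ℂ (fun z => P₁ z * F₂ z + P₂ z * F₁ z) 0 := (aP₁.mul aF₂).add (aP₂.mul aF₁)
  have as : AnalyticAt ℂ (fun z : ℂ × ℂ => z.1 ^ 2 + z.2 ^ 2) 0 :=
    (analyticAt_fst.pow 2).add (analyticAt_snd.pow 2)
  -- `F₁` and `F₂` separate the branches: on each of them one summand vanishes, so the two
  -- restrictions can be prescribed independently.
  refine ⟨fun z => (z.1 ^ 2 + z.2 ^ 2) * (P₁ z * F₂ z + P₂ z * F₁ z),
    ⟨as.mul aη, by simp, ?_⟩, ?_, ?_⟩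
  · have hs : fderiv ℂ (fun z : ℂ × ℂ => z.1 ^ 2 + z.2 ^ 2) 0 = 0 := by
      have := ((hasFDerivAt_fst (𝕜 := ℂ) (p := (0 : ℂ × ℂ))).pow 2).add
        ((hasFDerivAt_snd (𝕜 := ℂ) (p := (0 : ℂ × ℂ))).pow 2)
      refine this.fderiv.trans (ContinuousLinearMap.ext fun v => ?_)
      simp
    refine (as.differentiableAt.hasFDerivAt.mul aη.differentiableAt.hasFDerivAt).fderiv.trans ?_
    rw [hs]
    refine ContinuousLinearMap.ext fun v => ?_
    simp
  · filter_upwards [e₁, e₃, e₅, zF₁] with t e₁ e₃ e₅ z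
    rw [e₁, e₃, e₅, z]
    ring
  · filter_upwards [e₂, e₄, e₆, zF₂] with t e₂ e₄ e₆ z
    rw [e₂, e₄, e₆, z]
    ring

/-! ### Uniqueness of normal forms -/

section LogField

variable {δ : TangentCase} {σ : ℂ × ℂ → ℂ × ℂ} {b : ℂ}

theorem compSub_pow_zero (h0 : σ 0 = 0) {f : ℂ × ℂ → ℂ} (hf : f 0 = 0) (i : ℕ) :
    (compSub σ ^ i) f 0 = 0 := by
  cases i with
  | zero => exact hf
  | succ i => rw [pow_succ', Module.End.mul_apply, compSub_apply, h0, sub_self]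

theorem fderiv_compSub_pow_fst (hσ : AnalyticAt ℂ σ 0) (h0 : σ 0 = 0)
    (hb : ∀ v : ℂ × ℂ, fderiv ℂ σ 0 v = (v.1 + b * v.2, v.2)) (i : ℕ) :
    ∃ c : ℂ, (b = 0 → c = 0) ∧
      ∀ v : ℂ × ℂ, fderiv ℂ ((compSub σ ^ (i + 1)) Prod.fst) 0 v = c * v.2 := by
  induction i with
  | zero =>
    refine ⟨b, id, fun v => ?_⟩
    rw [zero_add, pow_one, fderiv_compSub hσ h0 analyticAt_fst, hb, fderiv_fst]
    simp
  | succ i ih =>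
    obtain ⟨c, -, hc⟩ := ih
    refine ⟨0, fun _ => rfl, fun v => ?_⟩
    rw [pow_succ', Module.End.mul_apply, fderiv_compSub hσ h0
      (analyticAt_compSub_pow hσ h0 analyticAt_fst _), hc, hb]
    simp

theorem analyticAt_logOp (hσ : AnalyticAt ℂ σ 0) (h0 : σ 0 = 0) (K : ℕ) {f : ℂ × ℂ → ℂ}
    (hf : AnalyticAt ℂ f 0) : AnalyticAt ℂ (logOp K σ f) 0 := by
  have : logOp K σ f = fun z => ∑ i ∈ Finset.range (K + 1), logCoeff i * ((compSub σ) ^ i) f z :=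
    funext fun z => logOp_apply K σ f z
  rw [this]
  exact Finset.analyticAt_fun_sum _ fun i _ =>
    analyticAt_const.mul (analyticAt_compSub_pow hσ h0 hf i)

theorem fderiv_sum_const_mul (s : Finset ℕ) (c : ℕ → ℂ) {F : ℕ → ℂ × ℂ → ℂ}
    (h : ∀ i, AnalyticAt ℂ (F i) 0) (v : ℂ × ℂ) :
    fderiv ℂ (fun z => ∑ i ∈ s, c i * F i z) 0 v = ∑ i ∈ s, c i * fderiv ℂ (F i) 0 v := by
  have : HasFDerivAt (fun z => ∑ i ∈ s, c i * F i z) (∑ i ∈ s, c i • fderiv ℂ (F i) 0) 0 :=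
    HasFDerivAt.fun_sum fun i _ => (h i).differentiableAt.hasFDerivAt.const_mul (c i)
  rw [this.fderiv]
  simp

theorem fderiv_logOp (hσ : AnalyticAt ℂ σ 0) (h0 : σ 0 = 0) (K : ℕ) {f : ℂ × ℂ → ℂ}
    (hf : AnalyticAt ℂ f 0) (v : ℂ × ℂ) : fderiv ℂ (logOp K σ f) 0 v =
      ∑ i ∈ Finset.range K, logCoeff (i + 1) * fderiv ℂ ((compSub σ ^ (i + 1)) f) 0 v := by
  have e : logOp K σ f = fun z => ∑ i ∈ Finset.range K,
      logCoeff (i + 1) * ((compSub σ) ^ (i + 1)) f z := by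
    funext z
    rw [logOp_apply, Finset.sum_range_succ']
    simp [logCoeff]
  have ha := fun i => analyticAt_compSub_pow hσ h0 hf i
  rw [e, fderiv_sum_const_mul _ _ fun i => ha (i + 1)]

theorem vField_logField (hσ : AnalyticAt ℂ σ 0) (h0 : σ 0 = 0)
    (hδ : δ = TangentCase.distinct → b = 0)
    (hb : ∀ v : ℂ × ℂ, fderiv ℂ σ 0 v = (v.1 + b * v.2, v.2)) (K : ℕ) :
    VField δ (logField K σ) := by
  have a1 := analyticAt_logOp hσ h0 K (f := Prod.fst) analyticAt_fst
  have a2 := analyticAt_logOp hσ h0 K (f := Prod.snd) analyticAt_snd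
  choose c hc0 hc using fderiv_compSub_pow_fst hσ h0 hb
  refine ⟨a1.prod a2, ?_, ∑ i ∈ Finset.range K, logCoeff (i + 1) * c i, fun h => ?_, fun v => ?_⟩
  · simp only [logField, logOp_apply]
    simp [compSub_pow_zero h0 (f := Prod.fst) rfl, compSub_pow_zero h0 (f := Prod.snd) rfl]
  · exact Finset.sum_eq_zero fun i _ => by rw [hc0 i (hδ h), mul_zero]
  · have : fderiv ℂ (logField K σ) 0 = _ :=
      (a1.differentiableAt.hasFDerivAt.prodMk a2.differentiableAt.hasFDerivAt).fderiv
    rw [this]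
    refine Prod.ext ?_ ?_
    · refine (fderiv_logOp hσ h0 K analyticAt_fst v).trans ?_
      simp only [hc, Finset.sum_mul, mul_assoc]
    · refine (fderiv_logOp hσ h0 K analyticAt_snd v).trans ?_
      refine Finset.sum_eq_zero fun i _ => ?_
      have := fderiv_compSub_pow hσ h0 (ContinuousLinearMap.snd ℂ ℂ ℂ) (fun v => by rw [hb]; rfl) i v
      exact mul_eq_zero_of_right _ this

end LogField

section LinearPart

variable {δ : TangentCase} {b : ℂ} {v w : ℂ × ℂ}

theorem coordX_of_unipotent (hδ : δ = TangentCase.distinct → b = 0)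
    (h : w = (v.1 + b * v.2, v.2)) : coordX δ w = coordX δ v + b * coordY δ v := by
  subst h
  cases δ
  · simp [coordX, hδ rfl]
  · rfl

theorem coordY_of_unipotent (hδ : δ = TangentCase.distinct → b = 0)
    (h : w = (v.1 + b * v.2, v.2)) : coordY δ w = coordY δ v := by
  subst h
  cases δ
  · simp [coordY, hδ rfl]
  · rfl

end LinearPart

theorem vvan_comp_inv {a a' : ℂ → ℂ × ℂ} {σ : ℂ × ℂ → ℂ × ℂ} {n : ℕ} (r : GermAut ℂ)
    (h : VVan n (fun t => σ (a (r.invFun t)) - a' t)) :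
    VVan n (fun t => σ (a t) - a' (r.toFun t)) := by
  refine (h.comp ((van_one_iff r.analytic_toFun).2 r.toFun_zero)).congr ?_
  filter_upwards [r.left_inv] with t ht
  rw [ht]

/-- X has order m along the image of γ and order m′ along γ′ ∘ ρ; agreement through degree m forces
equality. -/
theorem PBranch.mult_eq_of_vvan {δ : TangentCase} {γ γ' : ℂ → ℂ × ℂ} {m m' c : ℕ} {q q' : ℂ → ℂ}
    {σ : ℂ × ℂ → ℂ × ℂ} {b : ℂ} (h : PBranch δ γ m q) (h' : PBranch δ γ' m' q')
    (hσ : AnalyticAt ℂ σ 0) (h0 : σ 0 = 0) (hδ : δ = TangentCase.distinct → b = 0)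
    (hb : ∀ v : ℂ × ℂ, fderiv ℂ σ 0 v = (v.1 + b * v.2, v.2)) {ρ : ℂ → ℂ} (hρ : Tangent ρ)
    (hc : m ≤ c) (e : VVan (c + 1) (fun t => σ (γ t) - γ' (ρ t))) : m' = m := by
  obtain ⟨r, hr, e1, -⟩ := exists_puiseux_param hσ h0
    (fun v => coordX_of_unipotent hδ (hb v)) (fun v => coordY_of_unipotent hδ (hb v)) h
  have e2 := ((e (coordX δ)).mono (show m + 1 ≤ c + 1 by omega))
  have e3 : (fun t => coordX δ (γ' (ρ t))) =ᶠ[𝓝 0] fun t => ρ t ^ m' :=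
    h'.X_eq.comp_tendsto (tendsto_zero_of_analytic hρ.van.1 (hρ.van.apply_zero one_pos))
  have e4 : Van (m + 1) (fun t => ρ t ^ m' - t ^ m) := by
    refine ((hr.pow_sub m).sub e2).congr ?_
    filter_upwards [e1, e3] with t h1 h2
    rw [map_sub, h1, h2]
    ring
  have o1 : ord (fun t => ρ t ^ m') = m :=
    ord_eq_of_van_sub (d := 1) (e4.congr (Eventually.of_forall fun t => by ring)) one_ne_zero
  have o2 : ord (fun t => ρ t ^ m') = m' :=
    ord_eq_of_van_sub (d := 1)
      ((hρ.pow_sub m').congr (Eventually.of_forall fun t => by ring)) one_ne_zero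
  exact_mod_cast o2.symm.trans o1

/-- Two normal forms that are equivalent up to order `c` agree up to order `c`. -/
theorem NormalForms.vvan_sub {δ : TangentCase} {Γ L : Set (ℕ∞ × ℕ∞)} {φ ψ : MapPair}
    (hφ : φ ∈ NormalForms δ Γ L) (hψ : ψ ∈ NormalForms δ Γ L) {g : AGroup} (hg : g ∈ ASub δ)
    {c : ℕ} (hc1 : mult φ.fst ≤ c) (hc2 : mult φ.snd ≤ c)
    (e1 : VVan (c + 1) (fun t => (g.act φ).fst t - ψ.fst t))
    (e2 : VVan (c + 1) (fun t => (g.act φ).snd t - ψ.snd t)) :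
    VVan (c + 1) (fun t => ψ.fst t - φ.fst t) ∧ VVan (c + 1) (fun t => ψ.snd t - φ.snd t) := by
  obtain ⟨hg1, hg2, b, hδ, hb⟩ := hg
  have t1 := g.ρ₁.tangent hg1
  have t2 := g.ρ₂.tangent hg2
  obtain ⟨⟨pφ, -, hL⟩, nφ1, nφ2⟩ := hφ
  obtain ⟨⟨pψ, -, -⟩, nψ1, nψ2⟩ := hψ
  obtain ⟨q₁, q₂, h1, h2⟩ := pφ.exists_pBranch
  obtain ⟨q₁', q₂', h1', h2'⟩ := pψ.exists_pBranch
  have d1 := vvan_comp_inv g.ρ₁ e1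
  have d2 := vvan_comp_inv g.ρ₂ e2
  have hs : TangentCase.same = TangentCase.distinct → b = 0 := fun h => nomatch h
  have m1 := h1.mult_eq_of_vvan h1' g.σ.analytic_toFun g.σ.toFun_zero hs hb t1 hc1 d1
  have m2 := h2.mult_eq_of_vvan h2' g.σ.analytic_toFun g.σ.toFun_zero hδ hb t2 hc2 d2
  have X1 : ∀ n, Van n (fun t => coordX .same (ψ.fst t) - coordX .same (φ.fst t)) := by
    intro n
    refine (van_const_zero n).congr ?_
    filter_upwards [h1.X_eq, h1'.X_eq] with t a1 a2
    rw [a1, a2, m1, sub_self]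
  have X2 : ∀ n, Van n (fun t => coordX δ (ψ.snd t) - coordX δ (φ.snd t)) := by
    intro n
    refine (van_const_zero n).congr ?_
    filter_upwards [h2.X_eq, h2'.X_eq] with t a1 a2
    rw [a1, a2, m2, sub_self]
  have key : ∀ k, k ≤ c →
      Van (k + 1) (fun t => coordY .same (ψ.fst t) - coordY .same (φ.fst t)) ∧
      Van (k + 1) (fun t => coordY δ (ψ.snd t) - coordY δ (φ.snd t)) := by
    intro k
    induction k with
    | zero =>
      intro _
      exact ⟨(h1'.Y_van.mono (by omega)).sub (h1.Y_van.mono (by omega)),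
        (h2'.Y_van.mono (by omega)).sub (h2.Y_van.mono (by omega))⟩
    | succ k ih =>
      intro hk
      obtain ⟨i1, i2⟩ := ih (by omega)
      have v1 := van_sub_monomial i1
      have v2 := van_sub_monomial i2
      set a₁ := tcoeff (fun t => coordY .same (ψ.fst t) - coordY .same (φ.fst t)) (k + 1) with ha₁
      set a₂ := tcoeff (fun t => coordY δ (ψ.snd t) - coordY δ (φ.snd t)) (k + 1) with ha₂
      -- The two differences in degree k + 1 are coefficients of the normal parts of one and the
      -- same field, whose pair of orders is a point of Λ[δ].
      have l1 := log_step (Nat.succ_pos k) g.σ.analytic_toFun g.σ.toFun_zero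
        (fun v => coordY_of_unipotent hs (hb v)) h1 t1 (d1.mono (by omega)) (X1 _) v1
      have l2 := log_step (Nat.succ_pos k) g.σ.analytic_toFun g.σ.toFun_zero
        (fun v => coordY_of_unipotent hδ (hb v)) h2 t2 (d2.mono (by omega)) (X2 _) v2
      have hmem : (ord (normalPart .same φ.fst q₁ (logField (k + 1) g.σ.toFun)),
          ord (normalPart δ φ.snd q₂ (logField (k + 1) g.σ.toFun))) ∈ L := by
        rw [← hL, lambdaSet_eq_normalPart h1 h2]
        exact ⟨_, vField_logField g.σ.analytic_toFun g.σ.toFun_zero hδ hb (k + 1), rfl⟩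
      -- A monomial of the difference occurs in `φ` or in `ψ`, and both are normal forms for the
      -- same set `L`.
      have n1 : a₁ ≠ 0 → (k + 1, k + 1) ∉ maximalPoints L ∧ fiber₁ L (k + 1, k + 1) = ∅ := by
        intro h
        rw [ha₁, tcoeff_sub h1'.Y_van.1 h1.Y_van.1] at h
        by_cases h0 : tcoeff (fun t => coordY .same (φ.fst t)) (k + 1) = 0
        · rw [h0, sub_zero] at h
          exact nψ1 _ h
        · exact nφ1 _ h0
      have n2 : a₂ ≠ 0 → fiber₂ L (k + 1, k + 1) = ∅ := by
        intro h
        rw [graph₂_eq_coordY] at nφ2 nψ2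
        rw [ha₂, tcoeff_sub h2'.Y_van.1 h2.Y_van.1] at h
        by_cases h0 : tcoeff (fun t => coordY δ (φ.snd t)) (k + 1) = 0
        · rw [h0, sub_zero] at h
          exact nψ2 _ h
        · exact nφ2 _ h0
      have z1 : a₁ = 0 → ((k + 1 : ℕ) : ℕ∞) <
          ord (normalPart .same φ.fst q₁ (logField (k + 1) g.σ.toFun)) := by
        intro h
        rw [h] at l1
        exact lt_of_lt_of_le (by exact_mod_cast Nat.lt_succ_self (k + 1))
          (l1.congr (Eventually.of_forall fun t => by simp)).2
      have z2 : a₂ = 0 → ((k + 1 : ℕ) : ℕ∞) <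
          ord (normalPart δ φ.snd q₂ (logField (k + 1) g.σ.toFun)) := by
        intro h
        rw [h] at l2
        exact lt_of_lt_of_le (by exact_mod_cast Nat.lt_succ_self (k + 1))
          (l2.congr (Eventually.of_forall fun t => by simp)).2
      -- If just one coefficient were nonzero, the pair of orders would lie in a fiber that has to
      -- be empty. If both were, it would be (k + 1, k + 1) with empty fibers, a forbidden maximal
      -- point.
      have both : a₁ = 0 ∧ a₂ = 0 := by
        by_cases c1 : a₁ = 0 <;> by_cases c2 : a₂ = 0
        · exact ⟨c1, c2⟩
        · exact absurd (show _ ∈ fiber₂ L (k + 1, k + 1) from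
            ⟨hmem, ord_eq_of_van_sub l2 c2, z1 c1⟩) (by rw [n2 c2]; exact fun h => h)
        · exact absurd (show _ ∈ fiber₁ L (k + 1, k + 1) from
            ⟨hmem, ord_eq_of_van_sub l1 c1, z2 c2⟩) (by rw [(n1 c1).2]; exact fun h => h)
        · rw [ord_eq_of_van_sub l1 c1, ord_eq_of_van_sub l2 c2] at hmem
          exact absurd ⟨hmem, (n1 c1).2, n2 c2⟩ (n1 c1).1
      rw [both.1] at v1
      rw [both.2] at v2
      exact ⟨v1.congr (Eventually.of_forall fun t => by simp),
        v2.congr (Eventually.of_forall fun t => by simp)⟩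
  obtain ⟨k1, k2⟩ := key c le_rfl
  exact ⟨VVan.of_coord .same (by simpa only [map_sub] using X1 (c + 1))
      (by simpa only [map_sub] using k1),
    VVan.of_coord δ (by simpa only [map_sub] using X2 (c + 1))
      (by simpa only [map_sub] using k2)⟩

/-! ### Existence of normal forms -/

theorem exists_germAut_of_unipotent {σ : ℂ × ℂ → ℂ × ℂ} (hσ : AnalyticAt ℂ σ 0) (h0 : σ 0 = 0)
    {b : ℂ} (hb : ∀ v : ℂ × ℂ, fderiv ℂ σ 0 v = (v.1 + b * v.2, v.2)) :
    ∃ s : GermAut (ℂ × ℂ), s.toFun = σ := by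
  refine exists_germAut hσ h0 (ContinuousLinearEquiv.equivOfInverse (fderiv ℂ σ 0)
    ((ContinuousLinearMap.fst ℂ ℂ ℂ - b • ContinuousLinearMap.snd ℂ ℂ ℂ).prod
      (ContinuousLinearMap.snd ℂ ℂ ℂ)) (fun v => ?_) (fun v => ?_)) rfl
  · ext <;> simp [hb]
  · ext <;> simp [hb]

/-! ### Linear combinations and exponentials of tangent fields -/

section VField

variable {δ : TangentCase} {η η' : ℂ × ℂ → ℂ × ℂ}

theorem VField.zero (δ : TangentCase) : VField δ fun _ => 0 :=
  ⟨analyticAt_const, rfl, 0, fun _ => rfl, fun v => by simp; rfl⟩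

theorem VField.const_smul (h : VField δ η) (c : ℂ) : VField δ fun z => c • η z := by
  obtain ⟨ha, h0, b, hb, hd⟩ := h
  refine ⟨ha.fun_const_smul, by simp [h0], c * b, fun e => by simp [hb e], fun v => ?_⟩
  have : fderiv ℂ (fun z => c • η z) 0 = _ := (ha.differentiableAt.hasFDerivAt.const_smul c).fderiv
  rw [this]
  simp [hd, mul_assoc]

theorem VField.add (h : VField δ η) (h' : VField δ η') : VField δ fun z => η z + η' z := by
  obtain ⟨ha, h0, b, hb, hd⟩ := h
  obtain ⟨ha', h0', b', hb', hd'⟩ := h'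
  refine ⟨ha.add ha', by simp [h0, h0'], b + b', fun e => by simp [hb e, hb' e], fun v => ?_⟩
  have : fderiv ℂ (fun z => η z + η' z) 0 = _ :=
    (ha.differentiableAt.hasFDerivAt.add ha'.differentiableAt.hasFDerivAt).fderiv
  rw [this]
  simp [hd, hd', add_mul]

/-- The linear part of η squares to zero, so its exponential is the identity plus itself; 0 < k
keeps the first-order term in the truncation. -/
theorem VField.expField (h : VField δ η) {k : ℕ} (hk : 0 < k) :
    AnalyticAt ℂ (expField k η) 0 ∧ TwoBranches.expField k η 0 = 0 ∧
      ∃ b : ℂ, (δ = TangentCase.distinct → b = 0) ∧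
        ∀ v : ℂ × ℂ, fderiv ℂ (TwoBranches.expField k η) 0 v = (v.1 + b * v.2, v.2) := by
  obtain ⟨ha, h0, b, hb, hd⟩ := h
  have an : ∀ (ℓ : ℂ × ℂ →L[ℂ] ℂ) i, AnalyticAt ℂ ((vecD η)^[i] ℓ) 0 := fun ℓ i =>
    analyticAt_vecD_iterate ha (ℓ.analyticAt 0) i
  have a1 : AnalyticAt ℂ (fun z => ∑ i ∈ Finset.range (k + 1), (i.factorial : ℂ)⁻¹ *
      (vecD η)^[i] (ContinuousLinearMap.fst ℂ ℂ ℂ) z) 0 :=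
    Finset.analyticAt_fun_sum _ fun i _ => analyticAt_const.mul (an _ i)
  have a2 : AnalyticAt ℂ (fun z => ∑ i ∈ Finset.range (k + 1), (i.factorial : ℂ)⁻¹ *
      (vecD η)^[i] (ContinuousLinearMap.snd ℂ ℂ ℂ) z) 0 :=
    Finset.analyticAt_fun_sum _ fun i _ => analyticAt_const.mul (an _ i)
  have hd2 : ∀ i v, (fderiv ℂ η 0)^[i + 2] v = 0 := by
    intro i v
    rw [Function.iterate_add_apply]
    have : (fderiv ℂ η 0)^[2] v = 0 := by simp [hd]
    rw [this]
    exact iterate_map_zero (fderiv ℂ η 0) i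
  have hsum : ∀ (ℓ : ℂ × ℂ →L[ℂ] ℂ) v, ∑ i ∈ Finset.range (k + 1), (i.factorial : ℂ)⁻¹ *
      ℓ ((fderiv ℂ η 0)^[i] v) = ℓ v + ℓ (b * v.2, 0) := by
    intro ℓ v
    obtain ⟨k, rfl⟩ := Nat.exists_eq_succ_of_ne_zero hk.ne'
    rw [Finset.sum_range_succ', Finset.sum_range_succ', Finset.sum_eq_zero fun i _ => by
      rw [add_assoc, hd2, map_zero, mul_zero]]
    simp [hd, add_comm]
  refine ⟨a1.prod a2, ?_, b, hb, fun v => ?_⟩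
  · refine Prod.ext ?_ ?_
    · change ∑ i ∈ Finset.range (k + 1), (i.factorial : ℂ)⁻¹ *
        (vecD η)^[i] (ContinuousLinearMap.fst ℂ ℂ ℂ) 0 = 0
      exact Finset.sum_eq_zero fun i _ => mul_eq_zero_of_right _ (vecD_iterate_zero h0 _ i)
    · change ∑ i ∈ Finset.range (k + 1), (i.factorial : ℂ)⁻¹ *
        (vecD η)^[i] (ContinuousLinearMap.snd ℂ ℂ ℂ) 0 = 0
      exact Finset.sum_eq_zero fun i _ => mul_eq_zero_of_right _ (vecD_iterate_zero h0 _ i)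
  · have : fderiv ℂ (TwoBranches.expField k η) 0 = _ :=
      (a1.differentiableAt.hasFDerivAt.prodMk a2.differentiableAt.hasFDerivAt).fderiv
    rw [this]
    refine Prod.ext ?_ ?_
    · refine (fderiv_sum_const_mul _ _ (an _) v).trans ?_
      simp only [fderiv_vecD_iterate ha h0]
      refine (hsum _ v).trans ?_
      simp
    · refine (fderiv_sum_const_mul _ _ (an _) v).trans ?_
      simp only [fderiv_vecD_iterate ha h0]
      refine (hsum _ v).trans ?_
      simp

theorem VField.coordX_fderiv {b : ℂ} (hb : δ = TangentCase.distinct → b = 0)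
    (hd : ∀ v : ℂ × ℂ, fderiv ℂ η 0 v = (b * v.2, 0)) (v : ℂ × ℂ) :
    coordX δ (fderiv ℂ η 0 v) = b * coordY δ v := by
  rw [hd]
  cases δ
  · simp [coordX, hb rfl]
  · rfl

theorem VField.coordY_fderiv {b : ℂ} (hb : δ = TangentCase.distinct → b = 0)
    (hd : ∀ v : ℂ × ℂ, fderiv ℂ η 0 v = (b * v.2, 0)) (v : ℂ × ℂ) :
    coordY δ (fderiv ℂ η 0 v) = 0 := by
  rw [hd]
  cases δ
  · simp [coordY, hb rfl]
  · rfl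

end VField

/-! ### Elimination of monomials degree by degree -/

section Sigma

variable {δ : TangentCase} {Γ L : Set (ℕ∞ × ℕ∞)} {φ ψ : MapPair} {q₁ q₂ : ℂ → ℂ} {k : ℕ}
  {d₁ d₂ e₁ e₂ : ℂ}

theorem mem_sigmaSet_of_aEquiv (hφ : φ ∈ SigmaSet δ Γ L) (h : AEquiv δ φ ψ)
    (h1 : PBranch .same ψ.fst (mult φ.fst) q₁) (h2 : PBranch δ ψ.snd (mult φ.snd) q₂) :
    ψ ∈ SigmaSet δ Γ L := by
  obtain ⟨p, hΓ, hL⟩ := hφ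
  refine ⟨isPuiseux_of_pBranch (h.isBigerm p.isBigerm) h1 h2, ?_, ?_⟩
  · rw [h.semigroup_eq p.isBigerm, hΓ]
  · rw [h.lambdaSet_eq p.isBigerm h1.mult_eq h2.mult_eq, hL]

/-- `(d₁, d₂)` is the pair of coefficients in degree `k` of the normal parts of a vector field
whose normal parts vanish to order at least `k`. -/
def Moves (δ : TangentCase) (φ : MapPair) (q₁ q₂ : ℂ → ℂ) (k : ℕ) (d₁ d₂ : ℂ) : Prop :=
  ∃ η, VField δ η ∧ Van (k + 1) (fun t => normalPart .same φ.fst q₁ η t - d₁ * t ^ k) ∧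
    Van (k + 1) (fun t => normalPart δ φ.snd q₂ η t - d₂ * t ^ k)

theorem Moves.zero : Moves δ φ q₁ q₂ k 0 0 :=
  ⟨_, VField.zero δ, (van_const_zero _).congr (Eventually.of_forall fun t => by simp [normalPart]),
    (van_const_zero _).congr (Eventually.of_forall fun t => by simp [normalPart])⟩

theorem Moves.const_mul (h : Moves δ φ q₁ q₂ k d₁ d₂) (c : ℂ) :
    Moves δ φ q₁ q₂ k (c * d₁) (c * d₂) := by
  obtain ⟨η, h, h1, h2⟩ := h
  refine ⟨_, h.const_smul c, (h1.const_mul c).congr (Eventually.of_forall fun t => ?_),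
    (h2.const_mul c).congr (Eventually.of_forall fun t => ?_)⟩ <;>
  · simp only [normalPart, map_smul, smul_eq_mul]
    ring

theorem Moves.add (h : Moves δ φ q₁ q₂ k d₁ d₂) (h' : Moves δ φ q₁ q₂ k e₁ e₂) :
    Moves δ φ q₁ q₂ k (d₁ + e₁) (d₂ + e₂) := by
  obtain ⟨η, h, h1, h2⟩ := h
  obtain ⟨η', h', h1', h2'⟩ := h'
  refine ⟨_, h.add h', (h1.add h1').congr (Eventually.of_forall fun t => ?_),
    (h2.add h2').congr (Eventually.of_forall fun t => ?_)⟩ <;>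
  · simp only [normalPart, map_add]
    ring

/-- A bigerm in Puiseux form can be moved along a vector field tangent to `𝒜[δ]`. -/
theorem Moves.exists_aEquiv (hk : 0 < k) (hφ : φ ∈ SigmaSet δ Γ L)
    (h1 : PBranch .same φ.fst (mult φ.fst) q₁) (h2 : PBranch δ φ.snd (mult φ.snd) q₂)
    (h : Moves δ φ q₁ q₂ k d₁ d₂) :
    ∃ ψ ∈ SigmaSet δ Γ L, AEquiv δ φ ψ ∧
      Van (k + 1) (fun t => graph₁ ψ t - (graph₁ φ t + d₁ * t ^ k)) ∧
      Van (k + 1) (fun t => graph₂ δ ψ t - (graph₂ δ φ t + d₂ * t ^ k)) := by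
  obtain ⟨η, hη, v1, v2⟩ := h
  obtain ⟨aE, zE, b, hδ, hb⟩ := hη.expField hk
  obtain ⟨ha, h0, c, hc, hd⟩ := hη
  have hs : ∀ b : ℂ, TangentCase.same = TangentCase.distinct → b = 0 := fun _ h => nomatch h
  obtain ⟨s, hs'⟩ := exists_germAut_of_unipotent aE zE hb
  -- The parameters are normalized exactly, so that the image is again a Puiseux form with the same
  -- multiplicities.
  obtain ⟨r₁, t1, x1, y1, z1⟩ := exists_puiseux_param aE zE
    (fun v => coordX_of_unipotent (hs b) (hb v)) (fun v => coordY_of_unipotent (hs b) (hb v)) h1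
  obtain ⟨r₂, t2, x2, y2, z2⟩ := exists_puiseux_param aE zE
    (fun v => coordX_of_unipotent hδ (hb v)) (fun v => coordY_of_unipotent hδ (hb v)) h2
  have w1 := exp_step hk ha h0 (VField.coordX_fderiv (hs c) hd) (VField.coordY_fderiv (hs c) hd)
    h1 v1 t1 x1
  have w2 := exp_step hk ha h0 (VField.coordX_fderiv hc hd) (VField.coordY_fderiv hc hd) h2 v2 t2 x2
  set g : AGroup := ⟨r₁, r₂, s⟩ with hg
  have hgA : g ∈ ASub δ := ⟨t1.deriv_eq, t2.deriv_eq, b, hδ, by rw [← hs'] at hb; exact hb⟩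
  have g1 : (g.act φ).fst = fun t => expField k η (φ.fst (r₁.invFun t)) := by rw [← hs']; rfl
  have g2 : (g.act φ).snd = fun t => expField k η (φ.snd (r₂.invFun t)) := by rw [← hs']; rfl
  obtain ⟨p₁, b1⟩ := exists_pBranch (δ := .same) (γ := (g.act φ).fst) h1.m_pos
    (by rw [g1]; exact y1) (by rw [g1]; exact z1)
  obtain ⟨p₂, b2⟩ := exists_pBranch (δ := δ) (γ := (g.act φ).snd) h2.m_pos
    (by rw [g2]; exact y2) (by rw [g2]; exact z2)
  have hA : AEquiv δ φ (g.act φ) := ⟨g, hgA, GermEq.refl _⟩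
  refine ⟨g.act φ, mem_sigmaSet_of_aEquiv hφ hA b1 b2, hA, ?_, ?_⟩
  · rw [graph₁_eq_coordY, g1]; exact w1
  · rw [graph₂_eq_coordY, graph₂_eq_coordY, g2]; exact w2

theorem exists_coeff_of_ord_eq {f : ℂ → ℂ} (hf : AnalyticAt ℂ f 0) (h : ord f = k) :
    ∃ d : ℂ, d ≠ 0 ∧ Van (k + 1) (fun t => f t - d * t ^ k) := by
  obtain ⟨h1, h2⟩ := (ord_eq_natCast_iff hf k).1 h
  exact ⟨_, h2, van_sub_monomial h1⟩

theorem van_sub_zero_of_lt_ord {f : ℂ → ℂ} (hf : AnalyticAt ℂ f 0) (h : (k : ℕ∞) < ord f) :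
    Van (k + 1) (fun t => f t - 0 * t ^ k) :=
  Van.congr ⟨hf, by exact_mod_cast Order.add_one_le_of_lt h⟩
    (Eventually.of_forall fun t => by simp)

theorem PBranch.analyticAt_normalPart {γ : ℂ → ℂ × ℂ} {m : ℕ} {q : ℂ → ℂ} (h : PBranch δ γ m q)
    {η : ℂ × ℂ → ℂ × ℂ} (hη : AnalyticAt ℂ η 0) : AnalyticAt ℂ (normalPart δ γ q η) 0 := by
  have := AnalyticAt.comp_zero hη h.vvan_one.analytic (h.vvan_one.apply_zero one_pos)
  exact (analyticAt_coordY δ this).sub ((analyticAt_coordX δ this).mul h.q_van.1)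

/-- The monomials excluded in normal forms can be eliminated. -/
theorem exists_moves {m₁ m₂ : ℕ} (h1 : PBranch .same φ.fst m₁ q₁) (h2 : PBranch δ φ.snd m₂ q₂)
    (hL : LambdaSet δ φ = L) (a₁ a₂ : ℂ) : ∃ d₁ d₂, Moves δ φ q₁ q₂ k d₁ d₂ ∧
      (a₁ + d₁ ≠ 0 → (k, k) ∉ maximalPoints L ∧ fiber₁ L (k, k) = ∅) ∧
      (a₂ + d₂ ≠ 0 → fiber₂ L (k, k) = ∅) := by
  rw [lambdaSet_eq_normalPart h1 h2] at hL
  -- A field whose value lies in the vertical fiber changes degree k on the first branch and nothing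
  -- in this degree on the second.
  have f1 : (fiber₁ L (k, k)).Nonempty → ∀ a, Moves δ φ q₁ q₂ k a 0 := by
    rintro ⟨v, hv, e1, e2⟩ a
    rw [← hL] at hv
    obtain ⟨η, hη, rfl⟩ := hv
    obtain ⟨d, hd, w⟩ := exists_coeff_of_ord_eq (h1.analyticAt_normalPart hη.1) e1
    have : Moves δ φ q₁ q₂ k d 0 :=
      ⟨η, hη, w, van_sub_zero_of_lt_ord (h2.analyticAt_normalPart hη.1) e2⟩
    simpa [hd] using this.const_mul (a / d)
  have f2 : (fiber₂ L (k, k)).Nonempty → ∀ a, Moves δ φ q₁ q₂ k 0 a := by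
    rintro ⟨v, hv, e1, e2⟩ a
    rw [← hL] at hv
    obtain ⟨η, hη, rfl⟩ := hv
    obtain ⟨d, hd, w⟩ := exists_coeff_of_ord_eq (h2.analyticAt_normalPart hη.1) e1
    have : Moves δ φ q₁ q₂ k 0 d :=
      ⟨η, hη, van_sub_zero_of_lt_ord (h1.analyticAt_normalPart hη.1) e2, w⟩
    simpa [hd] using this.const_mul (a / d)
  rcases (fiber₁ L (k, k)).eq_empty_or_nonempty with c1 | c1 <;>
    rcases (fiber₂ L (k, k)).eq_empty_or_nonempty with c2 | c2
  · by_cases hM : (k, k) ∈ maximalPoints L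
    · have hv := hM.1
      rw [← hL] at hv
      obtain ⟨η, hη, e⟩ := hv
      obtain ⟨e1, e2⟩ := Prod.mk.inj e
      obtain ⟨d, hd, w⟩ := exists_coeff_of_ord_eq (h1.analyticAt_normalPart hη.1) e1.symm
      obtain ⟨d', -, w'⟩ := exists_coeff_of_ord_eq (h2.analyticAt_normalPart hη.1) e2.symm
      have : Moves δ φ q₁ q₂ k d d' := ⟨η, hη, w, w'⟩
      -- At a maximal point the two coefficients move together: `a₁` is cancelled at the price of
      -- changing `a₂`, which a normal form leaves free here.
      refine ⟨_, _, this.const_mul (-a₁ / d), fun h => absurd ?_ h, fun _ => c2⟩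
      rw [div_mul_cancel₀ _ hd, add_neg_cancel]
    · exact ⟨0, 0, Moves.zero, fun _ => ⟨hM, c1⟩, fun _ => c2⟩
  -- A nonempty horizontal fiber keeps (k, k) out of M, so `a₁` is allowed to stay.
  · refine ⟨0, -a₂, f2 c2 _, fun _ => ⟨fun hM => ?_, c1⟩, fun h => absurd (add_neg_cancel a₂) h⟩
    exact c2.ne_empty hM.2.2
  · exact ⟨-a₁, 0, f1 c1 _, fun h => absurd (add_neg_cancel a₁) h, fun _ => c2⟩
  · refine ⟨-a₁, -a₂, by simpa using (f1 c1 (-a₁)).add (f2 c2 (-a₂)),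
      fun h => absurd (add_neg_cancel a₁) h, fun h => absurd (add_neg_cancel a₂) h⟩

theorem IsPuiseux.analyticAt_graph₁ (h : IsPuiseux δ φ) : AnalyticAt ℂ (graph₁ φ) 0 :=
  analyticAt_coordY .same h.isBigerm.analytic_fst

theorem IsPuiseux.analyticAt_graph₂ (h : IsPuiseux δ φ) : AnalyticAt ℂ (graph₂ δ φ) 0 := by
  rw [graph₂_eq_coordY]
  exact analyticAt_coordY δ h.isBigerm.analytic_snd

/-- A move in degree K + 1 leaves all lower coefficients unchanged, so the degrees can be treated in
increasing order. -/
theorem exists_normal_up_to (hφ : φ ∈ SigmaSet δ Γ L) (K : ℕ) :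
    ∃ ψ ∈ SigmaSet δ Γ L, AEquiv δ φ ψ ∧
      (∀ j ≤ K, tcoeff (graph₁ ψ) j ≠ 0 → (j, j) ∉ maximalPoints L ∧ fiber₁ L (j, j) = ∅) ∧
      (∀ j ≤ K, tcoeff (graph₂ δ ψ) j ≠ 0 → fiber₂ L (j, j) = ∅) := by
  induction K with
  | zero =>
    refine ⟨φ, hφ, AEquiv.refl δ φ, fun j hj h => absurd ?_ h, fun j hj h => absurd ?_ h⟩
    · obtain ⟨q₁, q₂, h1, h2⟩ := hφ.1.exists_pBranch
      exact h1.Y_van.tcoeff_eq (by omega)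
    · obtain ⟨q₁, q₂, h1, h2⟩ := hφ.1.exists_pBranch
      rw [graph₂_eq_coordY]
      exact h2.Y_van.tcoeff_eq (by omega)
  | succ K ih =>
    obtain ⟨ψ, hψ, hA, n1, n2⟩ := ih
    obtain ⟨q₁, q₂, h1, h2⟩ := hψ.1.exists_pBranch
    obtain ⟨d₁, d₂, hm, m1, m2⟩ := exists_moves (k := K + 1) h1 h2 hψ.2.2
      (tcoeff (graph₁ ψ) (K + 1)) (tcoeff (graph₂ δ ψ) (K + 1))
    obtain ⟨χ, hχ, hA', w1, w2⟩ := hm.exists_aEquiv (Nat.succ_pos K) hψ h1 h2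
    have hmono : ∀ d : ℂ, AnalyticAt ℂ (fun t => d * t ^ (K + 1)) 0 := fun d => by fun_prop
    have c1 := (van_sub_iff hχ.1.analyticAt_graph₁
      (hψ.1.analyticAt_graph₁.fun_add (hmono d₁))).1 w1
    have c2 := (van_sub_iff hχ.1.analyticAt_graph₂
      (hψ.1.analyticAt_graph₂.fun_add (hmono d₂))).1 w2
    simp only [tcoeff_add hψ.1.analyticAt_graph₁ (hmono d₁),
      tcoeff_add hψ.1.analyticAt_graph₂ (hmono d₂), tcoeff_const_mul, tcoeff_pow] at c1 c2
    refine ⟨χ, hχ, hA.trans hA', fun j hj h => ?_, fun j hj h => ?_⟩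
    · rw [c1 j (by omega)] at h
      rcases Nat.le_succ_iff.1 hj with hj | rfl
      · rw [if_neg (by omega), mul_zero, add_zero] at h
        exact n1 j hj h
      · rw [if_pos rfl, mul_one] at h
        exact m1 h
    · rw [c2 j (by omega)] at h
      rcases Nat.le_succ_iff.1 hj with hj | rfl
      · rw [if_neg (by omega), mul_zero, add_zero] at h
        exact n2 j hj h
      · rw [if_pos rfl, mul_one] at h
        exact m2 h

end Sigma

/-! ### Finite determinacy -/

section Lift

variable {δ : TangentCase} {Γ L : Set (ℕ∞ × ℕ∞)} {φ ψ : MapPair} {D : ℕ}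

theorem InMaxSq.comp {η : ℂ × ℂ → ℂ} (h : InMaxSq η) {σ : ℂ × ℂ → ℂ × ℂ}
    (hσ : AnalyticAt ℂ σ 0) (h0 : σ 0 = 0) : InMaxSq fun z => η (σ z) := by
  obtain ⟨ha, hz, hd⟩ := h
  refine ⟨AnalyticAt.comp_zero ha hσ h0, by simp [h0, hz], ?_⟩
  have h1 : HasFDerivAt η (fderiv ℂ η 0) (σ 0) := by
    rw [h0]; exact ha.differentiableAt.hasFDerivAt
  have h2 : fderiv ℂ (fun z => η (σ z)) 0 = _ :=
    (h1.comp 0 hσ.differentiableAt.hasFDerivAt).fderiv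
  rw [h2, hd, ContinuousLinearMap.zero_comp]

/-- The bound is unchanged because reparametrizations preserve orders. Hence D can be fixed for the
original bigerm and still serves after the elimination up to degree D. -/
theorem AEquiv.lifts (hφ : IsBigerm φ) (h : AEquiv δ φ ψ) (hD : Lifts φ D) : Lifts ψ D := by
  obtain ⟨g, -, e1, e2⟩ := h
  intro u₁ u₂ h1 h2
  obtain ⟨η, hη, l1, l2⟩ := hD _ _
    (h1.comp ((van_one_iff g.ρ₁.analytic_toFun).2 g.ρ₁.toFun_zero))
    (h2.comp ((van_one_iff g.ρ₂.analytic_toFun).2 g.ρ₂.toFun_zero))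
  refine ⟨_, hη.comp g.σ.analytic_invFun g.σ.invFun_zero, ?_, ?_⟩
  · filter_upwards [e1, (hφ.tendsto_fst.comp g.ρ₁.tendsto_invFun).eventually g.σ.left_inv,
      g.ρ₁.tendsto_invFun.eventually l1, g.ρ₁.right_inv] with t a1 a2 a3 a4
    simp only [Function.comp_apply] at a2
    simp only [a1, AGroup.act, Function.comp_apply, a2, a3, a4]
  · filter_upwards [e2, (hφ.tendsto_snd.comp g.ρ₂.tendsto_invFun).eventually g.σ.left_inv,
      g.ρ₂.tendsto_invFun.eventually l2, g.ρ₂.right_inv] with t a1 a2 a3 a4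
    simp only [Function.comp_apply] at a2
    simp only [a1, AGroup.act, Function.comp_apply, a2, a3, a4]

theorem van_taylorPoly {f : ℂ → ℂ} {n : ℕ} (h : Van n f) (k : ℕ) : Van n (taylorPoly k f) := by
  rw [van_iff_tcoeff (analyticAt_taylorPoly k f)]
  intro i hi
  rw [tcoeff_taylorPoly, h.tcoeff_eq hi, ite_self]

/-- Choose η equal to minus the tail of the graph on the first branch and to 0 on the second, and η′
the other way round. Moving by η and η′ in the respective Y directions removes both tails exactly,
without reparametrization; as η and η′ have no linear part, the change is tangent to the identity.
-/
theorem exists_truncation (hφ : φ ∈ SigmaSet δ Γ L) (hD : Lifts φ D) :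
    ∃ ψ ∈ SigmaSet δ Γ L, AEquiv δ φ ψ ∧
      graph₁ ψ =ᶠ[𝓝 0] taylorPoly D (graph₁ φ) ∧ graph₂ δ ψ =ᶠ[𝓝 0] taylorPoly D (graph₂ δ φ) := by
  obtain ⟨q₁, q₂, h1, h2⟩ := hφ.1.exists_pBranch
  rw [graph₁_eq_coordY, graph₂_eq_coordY δ φ]
  set y₁ := fun t => coordY .same (φ.fst t) with hy₁
  set y₂ := fun t => coordY δ (φ.snd t) with hy₂
  have u1 := (van_sub_taylorPoly h1.Y_van.1 D).neg.mono (Nat.le_succ D)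
  have u2 := (van_sub_taylorPoly h2.Y_van.1 D).neg.mono (Nat.le_succ D)
  obtain ⟨η, ⟨ha, hz, hd⟩, l1, l2⟩ := hD _ _ u1 (van_const_zero D)
  obtain ⟨η', ⟨ha', hz', hd'⟩, l1', l2'⟩ := hD _ _ (van_const_zero D) u2
  set σ : ℂ × ℂ → ℂ × ℂ := fun z => z + (η z • vecY .same + η' z • vecY δ) with hσ
  have aσ : AnalyticAt ℂ σ 0 :=
    analyticAt_id.add ((ha.smul analyticAt_const).add (ha'.smul analyticAt_const))
  have zσ : σ 0 = 0 := by simp [hσ, hz, hz']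
  have dσ : ∀ v : ℂ × ℂ, fderiv ℂ σ 0 v = (v.1 + 0 * v.2, v.2) := by
    intro v
    have : fderiv ℂ σ 0 = _ := ((hasFDerivAt_id (𝕜 := ℂ) (0 : ℂ × ℂ)).add
      ((ha.differentiableAt.hasFDerivAt.smul_const (vecY .same)).add
        (ha'.differentiableAt.hasFDerivAt.smul_const (vecY δ)))).fderiv
    rw [this]
    simp [hd, hd']
  obtain ⟨s, hs⟩ := exists_germAut_of_unipotent aσ zσ dσ
  set g : AGroup := ⟨GermAut.refl, GermAut.refl, s⟩ with hg
  have hgA : g ∈ ASub δ :=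
    ⟨deriv_id 0, deriv_id 0, 0, fun _ => rfl, by rw [← hs] at dσ; exact dσ⟩
  have hA : AEquiv δ φ (g.act φ) := ⟨g, hgA, GermEq.refl _⟩
  have g1 : (g.act φ).fst = fun t => σ (φ.fst t) := by rw [← hs]; rfl
  have g2 : (g.act φ).snd = fun t => σ (φ.snd t) := by rw [← hs]; rfl
  have e1 : (g.act φ).fst =ᶠ[𝓝 0] fun t => φ.fst t + (taylorPoly D y₁ t - y₁ t) • vecY .same := by
    filter_upwards [l1, l1'] with t b1 b2
    simp only [g1, hσ, b1, b2, zero_smul, add_zero, neg_sub]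
    rfl
  have e2 : (g.act φ).snd =ᶠ[𝓝 0] fun t => φ.snd t + (taylorPoly D y₂ t - y₂ t) • vecY δ := by
    filter_upwards [l2, l2'] with t b1 b2
    simp only [g2, hσ, b1, b2, zero_smul, zero_add, neg_sub]
    rfl
  have X1 : (fun t => coordX .same ((g.act φ).fst t)) =ᶠ[𝓝 0] fun t => t ^ mult φ.fst := by
    filter_upwards [e1, h1.X_eq] with t b1 b2
    rw [b1]
    simpa using b2
  have X2 : (fun t => coordX δ ((g.act φ).snd t)) =ᶠ[𝓝 0] fun t => t ^ mult φ.snd := by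
    filter_upwards [e2, h2.X_eq] with t b1 b2
    rw [b1]
    simpa using b2
  have Y1 : (fun t => coordY .same ((g.act φ).fst t)) =ᶠ[𝓝 0] taylorPoly D y₁ := by
    filter_upwards [e1] with t b1
    rw [b1]
    simp [hy₁]
  have Y2 : (fun t => coordY δ ((g.act φ).snd t)) =ᶠ[𝓝 0] taylorPoly D y₂ := by
    filter_upwards [e2] with t b1
    rw [b1]
    simp [hy₂]
  obtain ⟨p₁, b1⟩ := exists_pBranch h1.m_pos X1
    ((van_taylorPoly h1.Y_van D).congr (EventuallyEq.symm Y1))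
  obtain ⟨p₂, b2⟩ := exists_pBranch h2.m_pos X2
    ((van_taylorPoly h2.Y_van D).congr (EventuallyEq.symm Y2))
  refine ⟨g.act φ, mem_sigmaSet_of_aEquiv hφ hA b1 b2, hA, Y1, ?_⟩
  rw [graph₂_eq_coordY]
  exact Y2

/-- Finitely many eliminations and one truncation, so no infinite composition has to converge.
Truncation only deletes monomials and thus preserves the normal form conditions. -/
theorem exists_normalForm (hφ : φ ∈ SigmaSet δ Γ L) : ∃ ψ ∈ NormalForms δ Γ L, AEquiv δ φ ψ := by
  obtain ⟨D, hD⟩ := hφ.1.exists_lifts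
  obtain ⟨ψ, hψ, hA, n1, n2⟩ := exists_normal_up_to hφ D
  obtain ⟨χ, hχ, hA', e1, e2⟩ := exists_truncation hψ (hA.lifts hφ.1.isBigerm hD)
  refine ⟨χ, ⟨hχ, fun j hj => ?_, fun j hj => ?_⟩, hA.trans hA'⟩
  · rw [tcoeff_congr e1, tcoeff_taylorPoly] at hj
    by_cases h : j ≤ D
    · exact n1 j h (by rwa [if_pos h] at hj)
    · exact absurd (if_neg h) hj
  · rw [tcoeff_congr e2, tcoeff_taylorPoly] at hj
    by_cases h : j ≤ D
    · exact n2 j h (by rwa [if_pos h] at hj)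
    · exact absurd (if_neg h) hj

theorem eventuallyEq_of_vvan {a b : ℂ → ℂ × ℂ} (h : ∀ n, VVan n (fun t => a t - b t)) :
    a =ᶠ[𝓝 0] b := by
  have key : ∀ ℓ : ℂ × ℂ →L[ℂ] ℂ, ∀ᶠ t in 𝓝 0, ℓ (a t - b t) = 0 := fun ℓ =>
    analyticOrderAt_eq_top.1 (ENat.eq_top_iff_forall_ge.2 fun n => (h n ℓ).2)
  filter_upwards [key (ContinuousLinearMap.fst ℂ ℂ ℂ), key (ContinuousLinearMap.snd ℂ ℂ ℂ)]
    with t h1 h2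
  exact Prod.ext (sub_eq_zero.1 h1) (sub_eq_zero.1 h2)

theorem vvan_of_eventuallyEq {a b : ℂ → ℂ × ℂ} (h : a =ᶠ[𝓝 0] b) (n : ℕ) :
    VVan n (fun t => a t - b t) := fun ℓ =>
  (van_const_zero n).congr (by filter_upwards [h] with t ht; simp [ht])

theorem NormalForms.germEq_of_aEquiv (hφ : φ ∈ NormalForms δ Γ L) (hψ : ψ ∈ NormalForms δ Γ L)
    (h : AEquiv δ φ ψ) : GermEq ψ φ := by
  obtain ⟨g, hg, e1, e2⟩ := h
  have key := fun n : ℕ => NormalForms.vvan_sub hφ hψ hg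
    (c := n + (mult φ.fst + mult φ.snd)) (by omega) (by omega)
    (vvan_of_eventuallyEq (EventuallyEq.symm e1) _) (vvan_of_eventuallyEq (EventuallyEq.symm e2) _)
  exact ⟨eventuallyEq_of_vvan fun n => (key n).1.mono (by omega),
    eventuallyEq_of_vvan fun n => (key n).2.mono (by omega)⟩

end Lift

/-! ### The conductor -/

/-- The sum of the two functions takes the smaller value on each branch; strict inequalities rule
out cancellation. -/
theorem semigroup_inf_mem {φ : MapPair} {a b a' b' : ℕ} (ha : a < a')
    (hb : b < b') (h : ((a : ℕ∞), (b' : ℕ∞)) ∈ semigroup φ)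
    (h' : ((a' : ℕ∞), (b : ℕ∞)) ∈ semigroup φ) : ((a : ℕ∞), (b : ℕ∞)) ∈ semigroup φ := by
  obtain ⟨η, hη, e⟩ := h
  obtain ⟨η', hη', e'⟩ := h'
  obtain ⟨e1, e2⟩ := Prod.mk.inj e
  obtain ⟨e1', e2'⟩ := Prod.mk.inj e'
  refine ⟨fun z => η z + η' z, hη.add hη', Prod.ext ?_ ?_⟩
  · have : ord (fun t => η (φ.fst t)) < ord (fun t => η' (φ.fst t)) := by
      change valFun φ.fst η < valFun φ.fst η'
      rw [← e1, ← e1']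
      exact_mod_cast ha
    exact e1.trans (analyticOrderAt_add_eq_left_of_lt this).symm
  · have : ord (fun t => η' (φ.snd t)) < ord (fun t => η (φ.snd t)) := by
      change valFun φ.snd η' < valFun φ.snd η
      rw [← e2, ← e2']
      exact_mod_cast hb
    exact e2'.trans (analyticOrderAt_add_eq_right_of_lt this).symm

/-- The least first and the least second coordinate may come from different admissible pairs, say
(c₁, y) and (x, c₂). A point (a, b) beyond (c₁, c₂) but beyond neither pair is the infimum of (a, y)
and (x, b), which `hinf` covers. -/
theorem exists_isConductor {Γ : Set (ℕ∞ × ℕ∞)}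
    (hinf : ∀ a b a' b' : ℕ, a < a' → b < b' → ((a : ℕ∞), (b' : ℕ∞)) ∈ Γ →
      ((a' : ℕ∞), (b : ℕ∞)) ∈ Γ → ((a : ℕ∞), (b : ℕ∞)) ∈ Γ)
    {D : ℕ × ℕ} (hD : ∀ a b : ℕ, D.1 ≤ a → D.2 ≤ b → ((a : ℕ∞), (b : ℕ∞)) ∈ Γ) :
    ∃ c₁ c₂ : ℕ, IsConductor Γ (c₁, c₂) := by
  classical
  set S := {d : ℕ × ℕ | ∀ a b : ℕ, d.1 ≤ a → d.2 ≤ b → ((a : ℕ∞), (b : ℕ∞)) ∈ Γ} with hS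
  have h1 : ∃ n, ∃ y, (n, y) ∈ S := ⟨D.1, D.2, hD⟩
  have h2 : ∃ n, ∃ x, (x, n) ∈ S := ⟨D.2, D.1, hD⟩
  obtain ⟨y, hy⟩ := Nat.find_spec h1
  obtain ⟨x, hx⟩ := Nat.find_spec h2
  refine ⟨Nat.find h1, Nat.find h2, fun a b ha hb => ?_, fun d hd => ?_⟩
  · simp only at ha hb
    rcases le_or_gt y b with h | h
    · exact hy a b ha h
    rcases le_or_gt x a with h' | h'
    · exact hx a b h' hb
    exact hinf a b x y h' h (hy a y ha le_rfl) (hx x b le_rfl hb)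
  · exact ⟨Nat.find_min' h1 ⟨d.2, hd⟩, Nat.find_min' h2 ⟨d.1, hd⟩⟩

theorem IsPuiseux.exists_isConductor {δ : TangentCase} {φ : MapPair} (h : IsPuiseux δ φ) :
    ∃ c₁ c₂ : ℕ, IsConductor (semigroup φ) (c₁, c₂) := by
  obtain ⟨D, hD⟩ := h.exists_lifts
  refine TwoBranches.exists_isConductor (D := (D, D))
    (fun a b a' b' ha hb => semigroup_inf_mem ha hb) fun a b ha hb => ?_
  obtain ⟨η, hη, e1, e2⟩ := hD _ _ ((van_pow a).mono ha) ((van_pow b).mono hb)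
  exact ⟨η, hη.1, Prod.ext ((ord_pow a).symm.trans (ord_congr e1).symm)
    ((ord_pow b).symm.trans (ord_congr e2).symm)⟩

/-! ### Functions of large value -/

theorem PBranch.van_comp {δ : TangentCase} {γ : ℂ → ℂ × ℂ} {m : ℕ} {q : ℂ → ℂ}
    (h : PBranch δ γ m q) {f : ℂ × ℂ → ℂ} (hf : AnalyticAt ℂ f 0) (h0 : f 0 = 0) :
    Van m (fun t => f (γ t)) :=
  (((van_sub_fderiv hf h0 h.m_pos h.vvan).mono (Nat.le_succ m)).add (h.vvan (fderiv ℂ f 0))).congr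
    (Eventually.of_forall fun t => by simp)

theorem PBranch.fderiv_vecX_eq_zero {δ : TangentCase} {γ : ℂ → ℂ × ℂ} {m : ℕ} {q : ℂ → ℂ}
    (h : PBranch δ γ m q) {f : ℂ × ℂ → ℂ} (hf : AnalyticAt ℂ f 0) (h0 : f 0 = 0)
    (hv : Van (m + 1) (fun t => f (γ t))) : fderiv ℂ f 0 (vecX δ) = 0 := by
  by_contra hne
  have h1 := (van_sub_fderiv hf h0 h.m_pos h.vvan).add
    (h.Y_van.mul_right (analyticAt_const (v := fderiv ℂ f 0 (vecY δ))))
  have h2 : ord (fun t => f (γ t)) = m := by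
    refine ord_eq_of_van_sub (d := fderiv ℂ f 0 (vecX δ)) (h1.congr ?_) hne
    filter_upwards [h.X_eq] with t ht
    rw [map_coord_decomp δ _ (γ t), ht]
    ring
  have h3 := hv.2
  rw [h2] at h3
  exact absurd h3 (not_le.2 (by exact_mod_cast Nat.lt_succ_self m))

/-- On branches of large contact with a smooth curve, functions are determined by their
restrictions to this curve up to high order. -/
theorem exists_restriction {h f : ℂ × ℂ → ℂ} (hh : AnalyticAt ℂ h 0) (h0 : h 0 = 0)
    (hx : fderiv ℂ h 0 (1, 0) = 0) (hy : fderiv ℂ h 0 (0, 1) ≠ 0) (hf : AnalyticAt ℂ f 0) :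
    ∃ p : ℂ → ℂ, AnalyticAt ℂ p 0 ∧ ∀ (γ : ℂ → ℂ × ℂ) (m n : ℕ) (q : ℂ → ℂ),
      PBranch .same γ m q → Van n (fun t => h (γ t)) → Van n (fun t => f (γ t) - p (t ^ m)) := by
  -- x and h are local coordinates. The function p is f restricted to the curve h = 0, expressed
  -- through x, which is t^m on the branch.
  set Φ : ℂ × ℂ → ℂ × ℂ := fun z => (z.1, h z) with hΦ
  have aΦ : AnalyticAt ℂ Φ 0 := analyticAt_fst.prod hh
  have zΦ : Φ 0 = 0 := by simp [hΦ, h0]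
  have dΦ : ∀ v : ℂ × ℂ, fderiv ℂ Φ 0 v = (v.1, fderiv ℂ h 0 (0, 1) * v.2) := by
    intro v
    have : fderiv ℂ Φ 0 = _ := (hasFDerivAt_fst.prodMk hh.differentiableAt.hasFDerivAt).fderiv
    rw [this]
    have e := map_coord_decomp .same (fderiv ℂ h 0) v
    change _ = v.1 * fderiv ℂ h 0 (1, 0) + v.2 * fderiv ℂ h 0 (0, 1) at e
    simp [e, hx, mul_comm]
  obtain ⟨s, hs⟩ := exists_germAut aΦ zΦ (ContinuousLinearEquiv.equivOfInverse (fderiv ℂ Φ 0)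
    ((ContinuousLinearMap.fst ℂ ℂ ℂ).prod
      ((fderiv ℂ h 0 (0, 1))⁻¹ • ContinuousLinearMap.snd ℂ ℂ ℂ))
    (fun v => by ext <;> simp [dΦ, hy]) (fun v => by ext <;> simp [dΦ, hy])) rfl
  have aH : AnalyticAt ℂ (fun z => f (s.invFun z)) 0 :=
    AnalyticAt.comp_zero hf s.analytic_invFun s.invFun_zero
  have ai : AnalyticAt ℂ (fun x : ℂ => (x, (0 : ℂ))) 0 := analyticAt_id.prod analyticAt_const
  refine ⟨fun x => f (s.invFun (x, 0)),
    AnalyticAt.comp_zero (g := fun z => f (s.invFun z)) aH ai rfl, fun γ m n q hγ hv => ?_⟩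
  have vm : Van 1 (fun t : ℂ => t ^ m) := (van_pow m).mono hγ.m_pos
  have hγ0 := hγ.vvan_one.apply_zero one_pos
  have hv1 : Van 1 (fun t => h (γ t)) := (van_one_iff hv.1).2 (by rw [hγ0, h0])
  have va : VVan 1 (fun t : ℂ => (t ^ m, h (γ t))) := VVan.of_coord .same vm hv1
  have vb : VVan 1 (fun t : ℂ => (t ^ m, (0 : ℂ))) := VVan.of_coord .same vm (van_const_zero 1)
  have vab : VVan n (fun t : ℂ => (t ^ m, h (γ t)) - (t ^ m, (0 : ℂ))) :=
    VVan.of_coord .same ((van_const_zero n).congr (Eventually.of_forall fun t => by simp [coordX]))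
      (hv.congr (Eventually.of_forall fun t => by simp [coordY]))
  refine (((van_sub_sub_fderiv aH va vb vab).mono (Nat.le_succ n)).add
    (vab (fderiv ℂ (fun z => f (s.invFun z)) 0))).congr ?_
  filter_upwards [hγ.X_eq, (tendsto_zero_of_analytic hγ.vvan_one.analytic hγ0).eventually
    s.left_inv] with t e1 e2
  have e3 : (t ^ m, h (γ t)) = s.toFun (γ t) := by
    rw [hs]
    exact Prod.ext e1.symm rfl
  rw [e3, e2]
  ring

theorem ord_comp_pow {p : ℂ → ℂ} (hp : AnalyticAt ℂ p 0) {m : ℕ} (hm : 0 < m) :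
    ord (fun t => p (t ^ m)) = ord p * m := by
  have h := AnalyticAt.analyticOrderAt_comp (f := p) (g := fun t : ℂ => t ^ m) (z₀ := 0)
    (by simpa [hm.ne'] using hp) (by fun_prop)
  simp only [zero_pow hm.ne', sub_zero] at h
  refine h.trans ?_
  congr 1
  exact ord_pow m

theorem ord_eq_of_van_sub_lt {f g : ℂ → ℂ} {n : ℕ} (h : Van (n + 1) (fun t => f t - g t))
    (hf : ord f = n) : ord g = n := by
  have hlt : ord f < ord (fun t => -(f t - g t)) := by
    rw [hf]
    exact lt_of_lt_of_le (by exact_mod_cast Nat.lt_succ_self n) h.neg.2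
  have := analyticOrderAt_add_eq_left_of_lt hlt
  refine Eq.trans (ord_congr (Eventually.of_forall fun t => ?_)) (this.trans hf)
  simp

section LargeValue

variable {δ : TangentCase} {φ : MapPair} {c : ℕ} {q₁ q₂ : ℂ → ℂ} {m₁ m₂ : ℕ}

/-- A function with value c + 1 on one branch vanishes at the origin, so its value c on the other is
at least the multiplicity there. The pair (c, c) alone would not exclude units when c = 0. -/
theorem le_of_mem_semigroup (h1 : PBranch .same φ.fst m₁ q₁) (h2 : PBranch δ φ.snd m₂ q₂)
    (hc : ((c : ℕ∞), ((c + 1 : ℕ) : ℕ∞)) ∈ semigroup φ)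
    (hc' : (((c + 1 : ℕ) : ℕ∞), (c : ℕ∞)) ∈ semigroup φ) : m₁ ≤ c ∧ m₂ ≤ c := by
  obtain ⟨η, hη, e⟩ := hc
  obtain ⟨η', hη', e'⟩ := hc'
  obtain ⟨e1, e2⟩ := Prod.mk.inj e
  obtain ⟨e1', e2'⟩ := Prod.mk.inj e'
  have a1 := AnalyticAt.comp_zero hη' h1.vvan_one.analytic (h1.vvan_one.apply_zero one_pos)
  have a2 := AnalyticAt.comp_zero hη h2.vvan_one.analytic (h2.vvan_one.apply_zero one_pos)
  have z : η 0 = 0 := by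
    have : Van (c + 1) (fun t => η (φ.snd t)) := ⟨a2, e2.le⟩
    simpa [h2.vvan_one.apply_zero one_pos] using this.apply_zero (Nat.succ_pos c)
  have z' : η' 0 = 0 := by
    have : Van (c + 1) (fun t => η' (φ.fst t)) := ⟨a1, e1'.le⟩
    simpa [h1.vvan_one.apply_zero one_pos] using this.apply_zero (Nat.succ_pos c)
  constructor
  · have : (m₁ : ℕ∞) ≤ c := (h1.van_comp hη z).2.trans e1.ge
    exact_mod_cast this
  · have : (m₂ : ℕ∞) ≤ c := (h2.van_comp hη' z').2.trans e2'.ge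
    exact_mod_cast this

/-- As c is at least both multiplicities, the differential of h kills both tangent directions, which
settles distinct tangents. For a common tangent and nonzero differential, h = 0 is a smooth curve to
which every function f can be restricted: on both branches f is p(t^m) modulo t^(c+1) for the same
p. The value (c, c + 1) then forces m₁ < m₂, and (c + 1, c) forces m₂ < m₁. -/
theorem inMaxSq_of_van (h1 : PBranch .same φ.fst m₁ q₁) (h2 : PBranch δ φ.snd m₂ q₂)
    (hc : ((c : ℕ∞), ((c + 1 : ℕ) : ℕ∞)) ∈ semigroup φ)
    (hc' : (((c + 1 : ℕ) : ℕ∞), (c : ℕ∞)) ∈ semigroup φ) {h : ℂ × ℂ → ℂ}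
    (hh : AnalyticAt ℂ h 0) (v1 : Van (c + 1) (fun t => h (φ.fst t)))
    (v2 : Van (c + 1) (fun t => h (φ.snd t))) : InMaxSq h := by
  obtain ⟨l1, l2⟩ := le_of_mem_semigroup h1 h2 hc hc'
  have h0 : h 0 = 0 := by
    simpa [h1.vvan_one.apply_zero one_pos] using v1.apply_zero (Nat.succ_pos c)
  have hx := h1.fderiv_vecX_eq_zero hh h0 (v1.mono (by omega))
  have hx' := h2.fderiv_vecX_eq_zero hh h0 (v2.mono (by omega))
  suffices hy : fderiv ℂ h 0 (0, 1) = 0 by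
    refine ⟨hh, h0, ContinuousLinearMap.ext fun v => ?_⟩
    have := map_coord_decomp .same (fderiv ℂ h 0) v
    rw [hx] at this
    change _ = _ + _ * fderiv ℂ h 0 (0, 1) at this
    rw [this, hy]
    simp
  cases δ with
  | distinct => exact hx'
  | same =>
    by_contra hy
    obtain ⟨η, hη, e⟩ := hc
    obtain ⟨η', hη', e'⟩ := hc'
    obtain ⟨e1, e2⟩ := Prod.mk.inj e
    obtain ⟨e1', e2'⟩ := Prod.mk.inj e'
    have key : ∀ {f : ℂ × ℂ → ℂ} {γ γ' : ℂ → ℂ × ℂ} {m m' : ℕ} {q q' : ℂ → ℂ}, AnalyticAt ℂ f 0 →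
        PBranch .same γ m q → PBranch .same γ' m' q' → Van (c + 1) (fun t => h (γ t)) →
        Van (c + 1) (fun t => h (γ' t)) → ord (fun t => f (γ t)) = c →
        ord (fun t => f (γ' t)) = (c + 1 : ℕ) → m < m' := by
      intro f γ γ' m m' q q' hf b b' w w' o o'
      obtain ⟨p, hp, hpv⟩ := exists_restriction hh h0 hx hy hf
      have p1 := hpv γ m _ q b w
      have p2 := hpv γ' m' _ q' b' w'
      have o1 := ord_eq_of_van_sub_lt p1 o
      have a : AnalyticAt ℂ (fun t => f (γ' t)) 0 :=
        AnalyticAt.comp_zero hf b'.vvan_one.analytic (b'.vvan_one.apply_zero one_pos)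
      have o2 : ((c + 1 : ℕ) : ℕ∞) ≤ ord (fun t => p (t ^ m')) :=
        (Van.congr (Van.sub ⟨a, o'.ge⟩ p2) (Eventually.of_forall fun t => by simp)).2
      rw [ord_comp_pow hp b.m_pos] at o1
      rw [ord_comp_pow hp b'.m_pos] at o2
      have hne : ord p ≠ ⊤ := by
        intro htop
        rw [htop, ENat.top_mul (by exact_mod_cast b.m_pos.ne')] at o1
        exact ENat.top_ne_natCast c o1
      obtain ⟨n, hn⟩ := ENat.ne_top_iff_exists.1 hne
      rw [← hn] at o1 o2
      have o3 : n * m = c := by exact_mod_cast o1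
      have o4 : c + 1 ≤ n * m' := by exact_mod_cast o2
      exact lt_of_mul_lt_mul_left (show n * m < n * m' by omega) (Nat.zero_le n)
    exact lt_asymm (key hη h1 h2 v1 v2 e1.symm e2.symm) (key hη' h2 h1 v2 v1 e2'.symm e1'.symm)

theorem InMaxSq.vField {h : ℂ × ℂ → ℂ} (hh : InMaxSq h) (w : ℂ × ℂ) :
    VField δ fun z => h z • w := by
  refine ⟨hh.1.smul analyticAt_const, by simp [hh.2.1], 0, fun _ => rfl, fun v => ?_⟩
  rw [(hh.1.differentiableAt.hasFDerivAt.smul_const w).fderiv, hh.2.2]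
  simp
  rfl

/-- Beyond the conductor all fibers of `Λ[δ]` are nonempty. -/
theorem fiber_nonempty (h1 : PBranch .same φ.fst m₁ q₁) (h2 : PBranch δ φ.snd m₂ q₂)
    (hc : ∀ a b : ℕ, c ≤ a → c ≤ b → ((a : ℕ∞), (b : ℕ∞)) ∈ semigroup φ) {j : ℕ} (hj : c < j) :
    (fiber₁ (LambdaSet δ φ) (j, j)).Nonempty ∧ (fiber₂ (LambdaSet δ φ) (j, j)).Nonempty := by
  have hsq : ∀ a b : ℕ, c < a → c < b → ∃ h, InMaxSq h ∧ ord (fun t => h (φ.fst t)) = a ∧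
      ord (fun t => h (φ.snd t)) = b := by
    intro a b ha hb
    obtain ⟨h, hh, e⟩ := hc a b ha.le hb.le
    obtain ⟨e1, e2⟩ := Prod.mk.inj e
    have a1 := AnalyticAt.comp_zero hh h1.vvan_one.analytic (h1.vvan_one.apply_zero one_pos)
    have a2 := AnalyticAt.comp_zero hh h2.vvan_one.analytic (h2.vvan_one.apply_zero one_pos)
    refine ⟨h, inMaxSq_of_van h1 h2 (hc c (c + 1) le_rfl (Nat.le_succ c))
      (hc (c + 1) c (Nat.le_succ c) le_rfl) hh ⟨a1, ?_⟩ ⟨a2, ?_⟩, e1.symm, e2.symm⟩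
    · refine le_trans ?_ e1.le
      exact_mod_cast ha
    · refine le_trans ?_ e2.le
      exact_mod_cast hb
  have hval : ∀ {δ' : TangentCase} {γ : ℂ → ℂ × ℂ} {m : ℕ} {q : ℂ → ℂ}, PBranch δ' γ m q →
      ∀ {h : ℂ × ℂ → ℂ}, InMaxSq h → ∀ w,
      ord (fun t => h (γ t)) ≤ ord (normalPart δ' γ q fun z => h z • w) := by
    intro δ' γ m q hb h hh w
    have e : (normalPart δ' γ q fun z => h z • w) =
        fun t => h (γ t) * (coordY δ' w - coordX δ' w * q t) := by
      funext t
      simp only [normalPart, map_smul, smul_eq_mul]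
      ring
    rw [e, ord_mul (AnalyticAt.comp_zero hh.1 hb.vvan_one.analytic
      (hb.vvan_one.apply_zero one_pos))
      (analyticAt_const.fun_sub (analyticAt_const.fun_mul hb.q_van.1))]
    exact le_self_add
  have hval' : ∀ {δ' : TangentCase} {γ : ℂ → ℂ × ℂ} {q : ℂ → ℂ} (h : ℂ × ℂ → ℂ),
      (normalPart δ' γ q fun z => h z • vecY δ') = fun t => h (γ t) := by
    intro δ' γ q h
    funext t
    simp [normalPart]
  have hlt : ((j : ℕ) : ℕ∞) < ((j + 1 : ℕ) : ℕ∞) := by exact_mod_cast Nat.lt_succ_self j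
  rw [lambdaSet_eq_normalPart h1 h2]
  constructor
  -- The field h times `vecY .same` has normal part h on the first branch, of order j, and order at
  -- least that of h, namely j + 1, on the second.
  · obtain ⟨h, hh, o1, o2⟩ := hsq j (j + 1) hj (by omega)
    refine ⟨_, ⟨_, hh.vField (vecY .same), rfl⟩, ?_, ?_⟩
    · simp only [hval', o1]
    · exact lt_of_lt_of_le hlt (o2.ge.trans (hval h2 hh _))
  · obtain ⟨h, hh, o1, o2⟩ := hsq (j + 1) j (by omega) hj
    refine ⟨_, ⟨_, hh.vField (vecY δ), rfl⟩, ?_, ?_⟩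
    · simp only [hval', o2]
    · exact lt_of_lt_of_le hlt (o1.ge.trans (hval h1 hh _))

end LargeValue

/-! ### Jets -/

section Jet

variable {φ ψ : MapPair} {c : ℕ}

theorem taylorPoly_congr {f g : ℂ → ℂ} (h : ∀ j ≤ c, tcoeff f j = tcoeff g j) :
    taylorPoly c f = taylorPoly c g := by
  funext t
  exact Finset.sum_congr rfl fun j hj => by rw [h j (Nat.lt_succ_iff.1 (Finset.mem_range.1 hj))]

theorem taylorPoly_taylorPoly (f : ℂ → ℂ) : taylorPoly c (taylorPoly c f) = taylorPoly c f :=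
  taylorPoly_congr fun j hj => by rw [tcoeff_taylorPoly, if_pos hj]

theorem jet_jet (φ : MapPair) : jet c (jet c φ) = jet c φ := by
  simp only [jet]
  congr 1 <;> funext t <;> exact Prod.ext (congrFun (taylorPoly_taylorPoly _) t)
    (congrFun (taylorPoly_taylorPoly _) t)

theorem jet_congr (h : GermEq φ ψ) : jet c φ = jet c ψ := by
  simp only [jet]
  congr 1 <;> funext t
  · exact Prod.ext (congrFun (taylorPoly_congr fun j _ => tcoeff_congr (h.1.fun_comp Prod.fst) j) t)
      (congrFun (taylorPoly_congr fun j _ => tcoeff_congr (h.1.fun_comp Prod.snd) j) t)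
  · exact Prod.ext (congrFun (taylorPoly_congr fun j _ => tcoeff_congr (h.2.fun_comp Prod.fst) j) t)
      (congrFun (taylorPoly_congr fun j _ => tcoeff_congr (h.2.fun_comp Prod.snd) j) t)

theorem vvan_sub_taylorPoly {γ : ℂ → ℂ × ℂ} (h : AnalyticAt ℂ γ 0) : VVan (c + 1) (fun t =>
    γ t - (taylorPoly c (fun s => (γ s).1) t, taylorPoly c (fun s => (γ s).2) t)) :=
  VVan.of_coord .same (van_sub_taylorPoly (analyticAt_fst_comp h) c)
    (van_sub_taylorPoly (analyticAt_snd_comp h) c)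

theorem vvan_sub_of_jet_eq (h1 : AnalyticAt ℂ φ.fst 0) (h2 : AnalyticAt ℂ φ.snd 0)
    (h1' : AnalyticAt ℂ ψ.fst 0) (h2' : AnalyticAt ℂ ψ.snd 0) (h : jet c φ = jet c ψ) :
    VVan (c + 1) (fun t => φ.fst t - ψ.fst t) ∧ VVan (c + 1) (fun t => φ.snd t - ψ.snd t) := by
  obtain ⟨e1, e2⟩ := MapPair.mk.inj h
  constructor
  · refine ((vvan_sub_taylorPoly h1).sub (vvan_sub_taylorPoly h1')).congr
      (Eventually.of_forall fun t => ?_)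
    have := congrFun e1 t
    simp only at this ⊢
    rw [this]
    abel
  · refine ((vvan_sub_taylorPoly h2).sub (vvan_sub_taylorPoly h2')).congr
      (Eventually.of_forall fun t => ?_)
    have := congrFun e2 t
    simp only at this ⊢
    rw [this]
    abel

theorem taylorPoly_eq_of_vvan {γ γ' : ℂ → ℂ × ℂ} (h : AnalyticAt ℂ γ 0) (h' : AnalyticAt ℂ γ' 0)
    (hv : VVan (c + 1) (fun t => γ t - γ' t)) :
    (fun t => (taylorPoly c (fun s => (γ s).1) t, taylorPoly c (fun s => (γ s).2) t)) =
      fun t => (taylorPoly c (fun s => (γ' s).1) t, taylorPoly c (fun s => (γ' s).2) t) := by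
  have k1 := (van_sub_iff (analyticAt_fst_comp h) (analyticAt_fst_comp h')).1
    (hv (ContinuousLinearMap.fst ℂ ℂ ℂ))
  have k2 := (van_sub_iff (analyticAt_snd_comp h) (analyticAt_snd_comp h')).1
    (hv (ContinuousLinearMap.snd ℂ ℂ ℂ))
  rw [taylorPoly_congr fun j hj => k1 j (Nat.lt_succ_iff.2 hj),
    taylorPoly_congr fun j hj => k2 j (Nat.lt_succ_iff.2 hj)]

theorem eventuallyEq_taylorPoly {f : ℂ → ℂ} (hf : AnalyticAt ℂ f 0)
    (h : ∀ j, c < j → tcoeff f j = 0) : f =ᶠ[𝓝 0] taylorPoly c f :=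
  eventuallyEq_of_tcoeff hf (analyticAt_taylorPoly c f) fun j => by
    rw [tcoeff_taylorPoly]
    split_ifs with hj
    · rfl
    · exact h j (not_le.1 hj)

/-- A branch in Puiseux form whose graph is a polynomial is its own jet. -/
theorem PBranch.eventuallyEq_taylorPoly {δ : TangentCase} {γ : ℂ → ℂ × ℂ} {m : ℕ} {q : ℂ → ℂ}
    (h : PBranch δ γ m q) (hm : m ≤ c)
    (hY : ∀ j, c < j → tcoeff (fun t => coordY δ (γ t)) j = 0) :
    γ =ᶠ[𝓝 0] fun t => (taylorPoly c (fun s => (γ s).1) t, taylorPoly c (fun s => (γ s).2) t) := by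
  have hX : ∀ j, c < j → tcoeff (fun t => coordX δ (γ t)) j = 0 := fun j hj => by
    rw [tcoeff_congr h.X_eq, tcoeff_pow, if_neg (by omega)]
  have ha := h.vvan_one.analytic
  have key : (∀ j, c < j → tcoeff (fun t => (γ t).1) j = 0) ∧
      ∀ j, c < j → tcoeff (fun t => (γ t).2) j = 0 := by
    cases δ
    · exact ⟨hY, hX⟩
    · exact ⟨hX, hY⟩
  filter_upwards [TwoBranches.eventuallyEq_taylorPoly (analyticAt_fst_comp ha) key.1,
    TwoBranches.eventuallyEq_taylorPoly (analyticAt_snd_comp ha) key.2] with t e1 e2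
  exact Prod.ext e1 e2

end Jet

/-- Beyond degree c both fibers of (j, j) are nonempty, so the graphs carry no monomials there; the
pure powers t^m also fit, since m ≤ c. -/
theorem NormalForms.germEq_jet {δ : TangentCase} {Γ L : Set (ℕ∞ × ℕ∞)} {φ : MapPair} {c : ℕ}
    (hφ : φ ∈ NormalForms δ Γ L)
    (hc : ∀ a b : ℕ, c ≤ a → c ≤ b → ((a : ℕ∞), (b : ℕ∞)) ∈ Γ) :
    mult φ.fst ≤ c ∧ mult φ.snd ≤ c ∧ GermEq φ (jet c φ) := by
  obtain ⟨⟨p, hΓ, hL⟩, n1, n2⟩ := hφ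
  obtain ⟨q₁, q₂, h1, h2⟩ := p.exists_pBranch
  rw [← hΓ] at hc
  obtain ⟨l1, l2⟩ := le_of_mem_semigroup h1 h2 (hc c (c + 1) le_rfl (Nat.le_succ c))
      (hc (c + 1) c (Nat.le_succ c) le_rfl)
  have hne := fun j (hj : c < j) => fiber_nonempty h1 h2 hc hj
  rw [hL] at hne
  refine ⟨l1, l2, h1.eventuallyEq_taylorPoly l1 fun j hj => ?_,
    h2.eventuallyEq_taylorPoly l2 fun j hj => ?_⟩
  · by_contra h
    exact (hne j hj).1.ne_empty (n1 j h).2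
  · by_contra h
    rw [graph₂_eq_coordY] at n2
    exact (hne j hj).2.ne_empty (n2 j h)

theorem AGroup.analyticAt_act (g : AGroup) {φ : MapPair} (h : IsBigerm φ) :
    AnalyticAt ℂ (g.act φ).fst 0 ∧ AnalyticAt ℂ (g.act φ).snd 0 := by
  have a1 := AnalyticAt.comp_zero h.analytic_fst g.ρ₁.analytic_invFun g.ρ₁.invFun_zero
  have a2 := AnalyticAt.comp_zero h.analytic_snd g.ρ₂.analytic_invFun g.ρ₂.invFun_zero
  exact ⟨AnalyticAt.comp_zero (g := g.σ.toFun) g.σ.analytic_toFun a1 (by simp [g.ρ₁.invFun_zero, h.fst_zero]),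
    AnalyticAt.comp_zero (g := g.σ.toFun) g.σ.analytic_toFun a2 (by simp [g.ρ₂.invFun_zero, h.snd_zero])⟩

/-- Since `φ` equals its jet as a germ, the orbit of the jet consists of jets of images of `φ`
itself, and uniqueness of normal forms through degree c applies. -/
theorem NormalForms.jet_inter_jetOrbit {δ : TangentCase} {Γ L : Set (ℕ∞ × ℕ∞)} {φ : MapPair}
    {c : ℕ} (hφ : φ ∈ NormalForms δ Γ L) (h1 : mult φ.fst ≤ c) (h2 : mult φ.snd ≤ c)
    (hj : GermEq φ (jet c φ)) :
    jet c '' NormalForms δ Γ L ∩ jetOrbit δ c (jet c φ) = {jet c φ} := by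
  refine Set.Subset.antisymm ?_ ?_
  · rintro _ ⟨⟨ψ, hψ, rfl⟩, g, hg, e⟩
    rw [← jet_congr (hj.act g)] at e
    have hφb := hφ.1.1.isBigerm
    have hψb := hψ.1.1.isBigerm
    obtain ⟨a1, a2⟩ := g.analyticAt_act hφb
    obtain ⟨v1, v2⟩ := vvan_sub_of_jet_eq a1 a2 hψb.analytic_fst hψb.analytic_snd e.symm
    obtain ⟨w1, w2⟩ := NormalForms.vvan_sub hφ hψ hg h1 h2 v1 v2
    simp only [Set.mem_singleton_iff, jet]
    rw [taylorPoly_eq_of_vvan hψb.analytic_fst hφb.analytic_fst w1,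
      taylorPoly_eq_of_vvan hψb.analytic_snd hφb.analytic_snd w2]
  · rintro _ rfl
    exact ⟨⟨φ, hφ, rfl⟩, AGroup.one, one_mem_ASub δ, by rw [AGroup.act_one, jet_jet]⟩

end TwoBranches

theorem theorem6 (δ : TangentCase) (Γ L : Set (ℕ∞ × ℕ∞)) :
    (∀ φ ∈ SigmaSet δ Γ L, ∃ ψ ∈ NormalForms δ Γ L, AEquiv δ φ ψ ∧
      ∀ ψ' ∈ NormalForms δ Γ L, AEquiv δ φ ψ' → GermEq ψ' ψ) ∧
    (∀ φ ∈ NormalForms δ Γ L, ∃ c₁ c₂ : ℕ, IsConductor Γ (c₁, c₂) ∧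
      GermEq φ (jet (max c₁ c₂) φ) ∧
      jet (max c₁ c₂) '' NormalForms δ Γ L ∩ jetOrbit δ (max c₁ c₂) (jet (max c₁ c₂) φ) =
        {jet (max c₁ c₂) φ}) := by
  refine ⟨fun φ hφ => ?_, fun φ hφ => ?_⟩
  · obtain ⟨ψ, hψ, h⟩ := exists_normalForm hφ
    exact ⟨ψ, hψ, h, fun ψ' hψ' h' =>
      NormalForms.germEq_of_aEquiv hψ hψ' ((h.symm hφ.1.isBigerm).trans h')⟩
  · obtain ⟨c₁, c₂, hc⟩ := hφ.1.1.exists_isConductor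
    rw [hφ.1.2.1] at hc
    obtain ⟨l1, l2, hj⟩ := NormalForms.germEq_jet (c := max c₁ c₂) hφ fun a b ha hb =>
      hc.1 a b ((le_max_left _ _).trans ha) ((le_max_right _ _).trans hb)
    exact ⟨c₁, c₂, hc, hj, NormalForms.jet_inter_jetOrbit hφ l1 l2 hj⟩
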